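/- **Setting.** Let $\mathsf G$ be a finite simple metric graph with vertex set $\mathsf V$, $|\mathsf V|=n$, and edge set $\mathsf E$ (no loops, no multiple edges, no isolated vertices), each edge $\mathsf e$ being identified with $[0,\ell_{\mathsf e}]$, $\ell_{\mathsf e}\in(0,\infty)$. Let $0<c_{\mathsf e}\in C[0,\ell_{\mathsf e}]$ and $0\le p_{\mathsf e}\in L^\infty(0,\ell_{\mathsf e})$ for each edge, and let $M=(b_{ik})$ be a real symmetric $n\times n$ matrix with $b_{ik}\ge 0$ for $i\ne k$ and $b_{ii}+\sum_{k\neq i}b_{ik}<0$ for all $i$. Let $E_2=\prod_{\mathsf e}L^2(0,\ell_{\mathsf e})$ (real valued) with its natural inner product. A function $u=(u_{\mathsf e})$ on the graph is called continuous on $\mathsf G$ if each $u_{\mathsf e}$ is continuous on $[0,\ell_{\mathsf e}]$ and, at each vertex $\mathsf v$, the values of $u_{\mathsf e}$ at $\mathsf v$ for all edges $\mathsf e$ incident to $\mathsf v$ agree; the common value is $u(\mathsf v)$, and $Lu=(u(\mathsf v))_{\mathsf v}\in\mathbb R^n$. If all $u_{\mathsf e}\in C^1[0,\ell_{\mathsf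 e}]$, let $Cu=\big(\sum_{\mathsf e\ni\mathsf v}c_{\mathsf e}(\mathsf v)u_{\mathsf e}'(\mathsf v)\big)_{\mathsf v}$, with the derivatives taken in the direction away from $\mathsf v$. Let $$D(A_2)=\Big\{u\in\prod_{\mathsf e}H^1(0,\ell_{\mathsf e})\colon c_{\mathsf e}u_{\mathsf e}'\in H^1(0,\ell_{\mathsf e})\ \forall \mathsf e,\ u\text{ continuous on }\mathsf G,\ MLu+Cu=0\Big\},\qquad A_2u=\big((c_{\mathsf e}u_{\mathsf e}')'-p_{\mathsf e}u_{\mathsf e}\big)_{\mathsf e}$$ (each such $u_{\mathsf e}$ is in $C^1[0,\ell_{\mathsf e}]$, as $c_{\mathsf e}u_{\mathsf e}'$ and $1/c_{\mathsf e}$ are continuous), and let $$D(\mathfrak a)=\Big\{u\in\prod_{\mathsf e}H^1(0,\ell_{\mathsf e})\colon u\text{ continuous on }\mathsf G\Big\},\quad \mathfrak a(u,v)=\sum_{\mathsf e}\int_0^{\ell_{\mathsf e}}c_{\mathsf e}u_{\mathsf e}'v_{\mathsf e}'\,dx+\sum_{\mathsf e}\int_0^{\ell_{\mathsf e}}p_{\mathsf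 e}u_{\mathsf e}v_{\mathsf e}\,dx-\langle MLu,Lv\rangle_{\mathbb R^n}.$$ **Proposition.** 1. $-A_2$ is the operator associated with $\mathfrak a$: $D(A_2)$ is the set of all $u\in D(\mathfrak a)$ for which there is $h\in E_2$ with $\mathfrak a(u,v)=\langle h,v\rangle_{E_2}$ for all $v\in D(\mathfrak a)$, and then $-A_2u=h$. 2. $\mathfrak a$ is symmetric, densely defined, accretive ($\mathfrak a(u,u)\ge0$), continuous ($|\mathfrak a(u,v)|\le K\|u\|_{\mathfrak a}\|v\|_{\mathfrak a}$ for some constant $K$, where $\|u\|_{\mathfrak a}^2=\mathfrak a(u,u)+\|u\|_{E_2}^2$) and closed ($D(\mathfrak a)$ is complete for $\|\cdot\|_{\mathfrak a}$). 3. $A_2$ is densely defined, dissipative, self-adjoint, with $(0,\infty)\subset\rho(A_2)$, and (the complexification of) $A_2$ is sectorial: there is $\theta\in(0,\pi/2]$ with $\Sigma_{\pi/2+\theta}\subset\rho(A_2)$ and $\sup_{\lambda\in\Sigma_{\pi/2+\theta-\varepsilon}}\|\lambda R(\lambda,A_2)\|<\infty$ for all $\varepsilon>0$, where $\Sigma_\theta=\{z\in\mathbb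 C\setminus\{0\}:|\arg z|<\theta\}$. 4. If moreover $c_{\mathsf e}\in H^1(0,\ell_{\mathsf e})$ for every $\mathsf e$ (for instance $c_{\mathsf e}\in C^1[0,\ell_{\mathsf e}]$), then $D(A_2)=\{u\in\prod_{\mathsf e}H^2(0,\ell_{\mathsf e})\colon u\text{ continuous on }\mathsf G,\ MLu+Cu=0\}$. 5. $A_2$ generates a strongly continuous semigroup $(T_2(t))_{t\ge0}$ on $E_2$ (that is, $R(\lambda,A_2)=\int_0^\infty e^{-\lambda t}T_2(t)\,dt$ for all large $\lambda$) which is positive, contractive ($\|T_2(t)\|\le1$) and bounded analytic: for some $\theta\in(0,\pi/2]$ its complexification has a holomorphic extension to $\Sigma_\theta$ that is bounded on $\Sigma_{\theta'}$ for each $\theta'\in(0,\theta)$. -/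

import Mathlib

open MeasureTheory Set Filter Topology
open scoped ContDiff NNReal ENNReal Matrix

noncomputable section

/-! ### Sobolev functions on an interval `(0, l)` -/

/-- Lebesgue measure on the interval `(0, l)`. -/
def edgeMeasure (l : ℝ) : Measure ℝ := volume.restrict (Ioo 0 l)

/-- `g` is a weak derivative of `f` on `(0, l)`. -/
def IsWeakDeriv (l : ℝ) (f g : ℝ → ℝ) : Prop :=
  ∀ φ : ℝ → ℝ, ContDiff ℝ ∞ φ → HasCompactSupport φ → tsupport φ ⊆ Ioo 0 l →
    ∫ x, f x * deriv φ x ∂(edgeMeasure l) = -∫ x, g x * φ x ∂(edgeMeasure l)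

/-- `f` has a weak derivative in `L²(0, l)`. -/
def HasWeakDeriv (l : ℝ) (f : ℝ → ℝ) : Prop :=
  ∃ g : ℝ → ℝ, MemLp g 2 (edgeMeasure l) ∧ IsWeakDeriv l f g

open Classical in
/-- The weak derivative of `f` on `(0, l)`, which is unique almost everywhere
(`weakDeriv_ae_eq`); zero if `f` has no weak derivative in `L²(0, l)`. -/
def weakDeriv (l : ℝ) (f : ℝ → ℝ) : ℝ → ℝ :=
  if h : HasWeakDeriv l f then h.choose else 0

/-- `f ∈ H¹(0, l)`. -/
def MemH1 (l : ℝ) (f : ℝ → ℝ) : Prop :=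
  MemLp f 2 (edgeMeasure l) ∧ HasWeakDeriv l f

/-- `f ∈ H²(0, l)`. -/
def MemH2 (l : ℝ) (f : ℝ → ℝ) : Prop :=
  MemH1 l f ∧ MemH1 l (weakDeriv l f)

/-- The class of `f` modulo almost everywhere equality contains a function continuous
on `[0, l]`. -/
def HasContRep (l : ℝ) (f : ℝ → ℝ) : Prop :=
  ∃ w : ℝ → ℝ, ContinuousOn w (Icc 0 l) ∧ f =ᵐ[edgeMeasure l] w

open Classical in
/-- The continuous representative of `f`; for `l > 0` it is unique on `[0, l]`
(`contRep_eqOn`). It is zero if there is none. -/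
def contRep (l : ℝ) (f : ℝ → ℝ) : ℝ → ℝ :=
  if h : HasContRep l f then h.choose else 0

instance (l : ℝ) : IsFiniteMeasure (edgeMeasure l) := by
  unfold edgeMeasure
  infer_instance

theorem weakDeriv_spec {l : ℝ} {f : ℝ → ℝ} (h : HasWeakDeriv l f) :
    MemLp (weakDeriv l f) 2 (edgeMeasure l) ∧ IsWeakDeriv l f (weakDeriv l f) := by
  have e : weakDeriv l f = h.choose := by
    unfold weakDeriv
    exact dif_pos h
  rw [e]
  exact h.choose_spec

theorem contRep_spec {l : ℝ} {f : ℝ → ℝ} (h : HasContRep l f) :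
    ContinuousOn (contRep l f) (Icc 0 l) ∧ f =ᵐ[edgeMeasure l] contRep l f := by
  have e : contRep l f = h.choose := by
    unfold contRep
    exact dif_pos h
  rw [e]
  exact h.choose_spec

theorem integrable_mul_test {l : ℝ} {g φ : ℝ → ℝ} (hg : MemLp g 2 (edgeMeasure l))
    (hφ : Continuous φ) (hc : HasCompactSupport φ) :
    Integrable (fun x => g x * φ x) (edgeMeasure l) :=
  MemLp.integrable_mul (p := 2) (q := 2) hg (hφ.memLp_of_hasCompactSupport hc)

theorem isWeakDeriv_unique {l : ℝ} {f g g' : ℝ → ℝ} (hg : MemLp g 2 (edgeMeasure l))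
    (hg' : MemLp g' 2 (edgeMeasure l)) (h : IsWeakDeriv l f g) (h' : IsWeakDeriv l f g') :
    g =ᵐ[edgeMeasure l] g' := by
  have hi : Integrable (g - g') (edgeMeasure l) := (hg.sub hg').integrable (by norm_num)
  have key := isOpen_Ioo.ae_eq_zero_of_integral_contDiff_smul_eq_zero (U := Ioo (0 : ℝ) l)
    (μ := volume) (f := g - g') (IntegrableOn.locallyIntegrableOn hi) (by
      intro φ h1 h2 h3
      have e1 := (h φ h1 h2 h3).symm.trans (h' φ h1 h2 h3)
      have i1 := integrable_mul_test hg h1.continuous h2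
      have i2 := integrable_mul_test hg' h1.continuous h2
      have e2 : ∫ x, φ x • (g - g') x ∂(edgeMeasure l) = 0 := by
        have : (fun x => φ x • (g - g') x) = fun x => g x * φ x - g' x * φ x := by
          funext x
          simp only [Pi.sub_apply, smul_eq_mul]
          ring
        rw [this, integral_sub i1 i2]
        linarith
      rw [← e2, edgeMeasure]
      symm
      apply setIntegral_eq_integral_of_forall_compl_eq_zero
      intro x hx
      have : φ x = 0 := image_eq_zero_of_notMem_tsupport (fun hx' => hx (h3 hx'))
      simp [this])
  have := (ae_restrict_iff' measurableSet_Ioo).2 key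
  filter_upwards [this] with x hx
  simpa [sub_eq_zero] using hx

theorem weakDeriv_ae_eq {l : ℝ} {f g : ℝ → ℝ} (hg : MemLp g 2 (edgeMeasure l))
    (h : IsWeakDeriv l f g) : weakDeriv l f =ᵐ[edgeMeasure l] g :=
  isWeakDeriv_unique (weakDeriv_spec ⟨g, hg, h⟩).1 hg (weakDeriv_spec ⟨g, hg, h⟩).2 h

theorem contRep_eqOn {l : ℝ} (hl : 0 < l) {f w : ℝ → ℝ} (hw : ContinuousOn w (Icc 0 l))
    (h : f =ᵐ[edgeMeasure l] w) : EqOn (contRep l f) w (Icc 0 l) := by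
  have hs := contRep_spec ⟨w, hw, h⟩
  refine Measure.eqOn_Icc_of_ae_eq volume hl.ne ?_ hs.1 hw
  have : contRep l f =ᵐ[edgeMeasure l] w := hs.2.symm.trans h
  rwa [edgeMeasure, restrict_Ioo_eq_restrict_Icc] at this

theorem memH1_lin {l : ℝ} {f g k : ℝ → ℝ} (hf : MemH1 l f) (hg : MemH1 l g) {a b : ℝ}
    (hk : k =ᵐ[edgeMeasure l] fun x => a * f x + b * g x) :
    MemH1 l k ∧ weakDeriv l k =ᵐ[edgeMeasure l]
      fun x => a * weakDeriv l f x + b * weakDeriv l g x := by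
  obtain ⟨f1, f2⟩ := weakDeriv_spec hf.2
  obtain ⟨g1, g2⟩ := weakDeriv_spec hg.2
  have hm : MemLp (fun x => a * weakDeriv l f x + b * weakDeriv l g x) 2 (edgeMeasure l) :=
    (f1.const_mul a).add (g1.const_mul b)
  have hd : IsWeakDeriv l k (fun x => a * weakDeriv l f x + b * weakDeriv l g x) := by
    intro φ h1 h2 h3
    have hφ' : Continuous (deriv φ) := h1.continuous_deriv (by simp)
    have e1 : ∫ x, k x * deriv φ x ∂(edgeMeasure l)
        = ∫ x, (a * (f x * deriv φ x) + b * (g x * deriv φ x)) ∂(edgeMeasure l) := by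
      apply integral_congr_ae
      filter_upwards [hk] with x hx
      rw [hx]
      ring
    have e2 : ∫ x, (a * weakDeriv l f x + b * weakDeriv l g x) * φ x ∂(edgeMeasure l)
        = ∫ x, (a * (weakDeriv l f x * φ x) + b * (weakDeriv l g x * φ x))
          ∂(edgeMeasure l) := by
      apply integral_congr_ae
      filter_upwards with x
      ring
    rw [e1, e2, integral_add ((integrable_mul_test hf.1 hφ' h2.deriv).const_mul a)
        ((integrable_mul_test hg.1 hφ' h2.deriv).const_mul b),
      integral_add ((integrable_mul_test f1 h1.continuous h2).const_mul a)
        ((integrable_mul_test g1 h1.continuous h2).const_mul b)]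
    simp only [integral_const_mul]
    rw [f2 φ h1 h2 h3, g2 φ h1 h2 h3]
    ring
  exact ⟨⟨(memLp_congr_ae hk).2 ((hf.1.const_mul a).add (hg.1.const_mul b)), _, hm, hd⟩,
    weakDeriv_ae_eq hm hd⟩

theorem contRep_lin {l : ℝ} (hl : 0 < l) {f g k : ℝ → ℝ} (hf : HasContRep l f)
    (hg : HasContRep l g) {a b : ℝ}
    (hk : k =ᵐ[edgeMeasure l] fun x => a * f x + b * g x) :
    HasContRep l k ∧
      EqOn (contRep l k) (fun x => a * contRep l f x + b * contRep l g x) (Icc 0 l) := by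
  obtain ⟨f1, f2⟩ := contRep_spec hf
  obtain ⟨g1, g2⟩ := contRep_spec hg
  have hc : ContinuousOn (fun x => a * contRep l f x + b * contRep l g x) (Icc 0 l) :=
    (continuousOn_const.mul f1).add (continuousOn_const.mul g1)
  have he : k =ᵐ[edgeMeasure l] fun x => a * contRep l f x + b * contRep l g x := by
    filter_upwards [hk, f2, g2] with x hx h1 h2
    rw [hx, h1, h2]
  exact ⟨⟨_, hc, he⟩, contRep_eqOn hl hc he⟩

theorem memH1_zero (l : ℝ) {f : ℝ → ℝ} (hf : f =ᵐ[edgeMeasure l] 0) :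
    MemH1 l f ∧ weakDeriv l f =ᵐ[edgeMeasure l] 0 := by
  have hd : IsWeakDeriv l f 0 := by
    intro φ _ _ _
    have : ∫ x, f x * deriv φ x ∂(edgeMeasure l) = ∫ _, (0 : ℝ) ∂(edgeMeasure l) := by
      apply integral_congr_ae
      filter_upwards [hf] with x hx
      simp [hx]
    rw [this]
    simp
  exact ⟨⟨(memLp_congr_ae hf).2 MemLp.zero, 0, MemLp.zero, hd⟩, weakDeriv_ae_eq MemLp.zero hd⟩

theorem contRep_zero {l : ℝ} (hl : 0 < l) {f : ℝ → ℝ} (hf : f =ᵐ[edgeMeasure l] 0) :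
    HasContRep l f ∧ EqOn (contRep l f) 0 (Icc 0 l) :=
  ⟨⟨0, continuousOn_const, hf⟩, contRep_eqOn hl continuousOn_const hf⟩

/-! ### Metric graphs -/

/-- A simple metric graph with vertex set `V` and edge set `E` and without isolated vertices.
The edge `e` has a length `len e > 0` and is parametrised by `[0, len e]`, with
`src e` at the coordinate `0` and `tgt e` at the coordinate `len e`. -/
structure MetricGraph (V E : Type*) where
  src : E → V
  tgt : E → V
  len : E → ℝ
  len_pos : ∀ e, 0 < len e
  no_loops : ∀ e, src e ≠ tgt e
  no_multiple_edges : ∀ e e', s(src e, tgt e) = s(src e', tgt e') → e = e'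
  no_isolated_vertices : ∀ v, ∃ e, src e = v ∨ tgt e = v

namespace MetricGraph

variable {V E : Type*}

/-- The edge `e` is incident to the vertex `v`. -/
def Incident (G : MetricGraph V E) (e : E) (v : V) : Prop := G.src e = v ∨ G.tgt e = v

open Classical in
/-- The coordinate of the vertex `v` on an incident edge `e`. -/
def coord (G : MetricGraph V E) (e : E) (v : V) : ℝ := if G.src e = v then 0 else G.len e

open Classical in
/-- The derivative at `v` along `e` in the direction away from `v` is `outward e v` times the
derivative with respect to the coordinate. -/
def outward (G : MetricGraph V E) (e : E) (v : V) : ℝ := if G.src e = v then 1 else -1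

theorem coord_mem (G : MetricGraph V E) (e : E) (v : V) : G.coord e v ∈ Icc 0 (G.len e) := by
  unfold coord
  have := (G.len_pos e).le
  split_ifs
  · exact ⟨le_rfl, this⟩
  · exact ⟨this, le_rfl⟩

/-- The real Hilbert space `∏ₑ L²(0, len e)`. -/
abbrev E2 (G : MetricGraph V E) : Type _ :=
  PiLp 2 fun e : E => Lp ℝ 2 (edgeMeasure (G.len e))

/-- The value at `v` along the edge `e` of (the continuous representative of) `u`. -/
def valueAt (G : MetricGraph V E) (u : G.E2) (e : E) (v : V) : ℝ :=
  contRep (G.len e) (u e) (G.coord e v)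

/-- `u` is continuous on the graph: it is continuous on every closed edge, and its values in
each vertex along the incident edges coincide. -/
def IsContinuous (G : MetricGraph V E) (u : G.E2) : Prop :=
  (∀ e, HasContRep (G.len e) (u e)) ∧
    ∀ v e e', G.Incident e v → G.Incident e' v → G.valueAt u e v = G.valueAt u e' v

/-- The vector of the vertex values of a function that is continuous on the graph. -/
def L (G : MetricGraph V E) (u : G.E2) : V → ℝ := fun v =>
  G.valueAt u (G.no_isolated_vertices v).choose v

theorem lin_coe (G : MetricGraph V E) (u w : G.E2) (a b : ℝ) (e : E) :
    ((a • u + b • w : G.E2) e : ℝ → ℝ) =ᵐ[edgeMeasure (G.len e)]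
      fun x => a * u e x + b * w e x := by
  have h : (a • u + b • w : G.E2) e = a • u e + b • w e := rfl
  rw [h]
  filter_upwards [Lp.coeFn_add (a • u e) (b • w e), Lp.coeFn_smul a (u e),
    Lp.coeFn_smul b (w e)] with x h1 h2 h3
  rw [h1, Pi.add_apply, h2, h3]
  rfl

theorem zero_coe (G : MetricGraph V E) (e : E) :
    ((0 : G.E2) e : ℝ → ℝ) =ᵐ[edgeMeasure (G.len e)] 0 :=
  Lp.coeFn_zero ℝ 2 _

theorem isContinuous_lin (G : MetricGraph V E) {u w : G.E2} (hu : G.IsContinuous u)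
    (hw : G.IsContinuous w) (a b : ℝ) :
    G.IsContinuous (a • u + b • w) ∧ G.L (a • u + b • w) = a • G.L u + b • G.L w := by
  have key : ∀ e v, G.valueAt (a • u + b • w) e v
      = a * G.valueAt u e v + b * G.valueAt w e v := fun e v =>
    (contRep_lin (G.len_pos e) (hu.1 e) (hw.1 e) (G.lin_coe u w a b e)).2 (G.coord_mem e v)
  refine ⟨⟨fun e => (contRep_lin (G.len_pos e) (hu.1 e) (hw.1 e) (G.lin_coe u w a b e)).1,
    fun v e e' h h' => ?_⟩, ?_⟩
  · rw [key, key, hu.2 v e e' h h', hw.2 v e e' h h']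
  · funext v
    exact key _ v

theorem isContinuous_zero (G : MetricGraph V E) : G.IsContinuous (0 : G.E2) ∧ G.L 0 = 0 := by
  have key : ∀ e v, G.valueAt (0 : G.E2) e v = 0 := fun e v =>
    (contRep_zero (G.len_pos e) (G.zero_coe e)).2 (G.coord_mem e v)
  refine ⟨⟨fun e => (contRep_zero (G.len_pos e) (G.zero_coe e)).1, fun v e e' _ _ => ?_⟩, ?_⟩
  · rw [key, key]
  · funext v
    exact key _ v

/-- The coefficients of the problem: the conductances `0 < c e ∈ C[0, len e]`, the potentials
`0 ≤ p e ∈ L^∞(0, len e)`, and the real symmetric matrix `M` with nonnegative off-diagonal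
entries and negative row sums. -/
structure Coefficients (G : MetricGraph V E) [Fintype V] where
  c : E → ℝ → ℝ
  c_cont : ∀ e, ContinuousOn (c e) (Icc 0 (G.len e))
  c_pos : ∀ e, ∀ x ∈ Icc 0 (G.len e), 0 < c e x
  p : E → ℝ → ℝ
  p_mem : ∀ e, MemLp (p e) ∞ (edgeMeasure (G.len e))
  p_nonneg : ∀ e, ∀ᵐ x ∂(edgeMeasure (G.len e)), 0 ≤ p e x
  M : Matrix V V ℝ
  M_symm : M.IsSymm
  M_offdiag : ∀ i k, i ≠ k → 0 ≤ M i k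
  M_row : ∀ i, ∑ k, M i k < 0

end MetricGraph

/-! ### Forms and operators on a real Hilbert space -/

/-- A bilinear form on a real Hilbert space `H`, defined on a subspace of `H`. -/
structure PartialForm (H : Type*) [NormedAddCommGroup H] [InnerProductSpace ℝ H] where
  domain : Submodule ℝ H
  toBilin : domain →ₗ[ℝ] domain →ₗ[ℝ] ℝ

namespace PartialForm

variable {H : Type*} [NormedAddCommGroup H] [InnerProductSpace ℝ H]

def IsDenselyDefined (a : PartialForm H) : Prop := Dense (a.domain : Set H)

def IsSymmetric (a : PartialForm H) : Prop := ∀ u v, a.toBilin u v = a.toBilin v u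

def IsAccretive (a : PartialForm H) : Prop := ∀ u, 0 ≤ a.toBilin u u

/-- The form norm `‖u‖ₐ = (a(u, u) + ‖u‖²)^{1/2}` of an accretive form. -/
def formNorm (a : PartialForm H) (u : a.domain) : ℝ :=
  Real.sqrt (a.toBilin u u + ‖(u : H)‖ ^ 2)

/-- Continuity of a form with respect to its form norm. -/
def IsContinuous (a : PartialForm H) : Prop :=
  ∃ K : ℝ, ∀ u v, |a.toBilin u v| ≤ K * a.formNorm u * a.formNorm v

/-- Closedness of an accretive form: its domain is complete for the form norm. -/
def IsClosed (a : PartialForm H) : Prop :=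
  ∀ u : ℕ → a.domain,
    (∀ ε > 0, ∃ N, ∀ m ≥ N, ∀ n ≥ N, a.formNorm (u m - u n) < ε) →
    ∃ w, Tendsto (fun n => a.formNorm (u n - w)) atTop (𝓝 0)

/-- `B` is the operator associated with the form `a`:
`D(B) = {u ∈ D(a) : ∃ h ∈ H, a(u, v) = ⟨h, v⟩ for all v ∈ D(a)}` and `B u = h`. -/
def IsAssociated (a : PartialForm H) (B : H →ₗ.[ℝ] H) : Prop :=
  (∀ u : H, u ∈ B.domain ↔
    ∃ hu : u ∈ a.domain, ∃ h : H, ∀ v : a.domain, a.toBilin ⟨u, hu⟩ v = inner ℝ h (v : H)) ∧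
  ∀ (u : B.domain) (hu : (u : H) ∈ a.domain) (h : H),
    (∀ v : a.domain, a.toBilin ⟨u, hu⟩ v = inner ℝ h (v : H)) → B u = h

end PartialForm

/-- The operator `A` on a real Hilbert space is dissipative. -/
def IsDissipative {H : Type*} [NormedAddCommGroup H] [InnerProductSpace ℝ H]
    (A : H →ₗ.[ℝ] H) : Prop :=
  ∀ u : A.domain, inner ℝ (A u) (u : H) ≤ 0

section Resolvent

variable {𝕜 X : Type*} [RCLike 𝕜] [NormedAddCommGroup X] [NormedSpace 𝕜 X]

/-- The bounded operator `R` is the inverse of `z - A : D(A) → X`, i.e. `R = R(z, A)`. -/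
def IsResolvent (A : X →ₗ.[𝕜] X) (z : 𝕜) (R : X →L[𝕜] X) : Prop :=
  (∀ y : X, ∃ h : R y ∈ A.domain, z • R y - A ⟨R y, h⟩ = y) ∧
    ∀ x : A.domain, R (z • (x : X) - A x) = x

/-- The resolvent set `ρ(A)`. -/
def pmapResolventSet (A : X →ₗ.[𝕜] X) : Set 𝕜 := {z | ∃ R : X →L[𝕜] X, IsResolvent A z R}

end Resolvent

/-- The open sector `Σ_θ = {z ≠ 0 : |arg z| < θ}`. -/
def sector (θ : ℝ) : Set ℂ := {z | z ≠ 0 ∧ |z.arg| < θ}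

/-- Sectoriality of an operator on a complex Banach space. -/
def IsSectorial {X : Type*} [NormedAddCommGroup X] [NormedSpace ℂ X] (A : X →ₗ.[ℂ] X) : Prop :=
  ∃ θ : ℝ, 0 < θ ∧ θ ≤ Real.pi / 2 ∧ sector (Real.pi / 2 + θ) ⊆ pmapResolventSet A ∧
    ∀ ε > 0, ∃ K : ℝ, ∀ z ∈ sector (Real.pi / 2 + θ - ε), ∀ R : X →L[ℂ] X,
      IsResolvent A z R → ‖z • R‖ ≤ K

section Semigroup

variable {X : Type*} [NormedAddCommGroup X] [NormedSpace ℝ X]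

/-- `T` is a strongly continuous (`C₀`-)semigroup. -/
structure IsC0Semigroup (T : ℝ≥0 → X →L[ℝ] X) : Prop where
  map_zero : T 0 = ContinuousLinearMap.id ℝ X
  map_add : ∀ t s, T (t + s) = (T t).comp (T s)
  continuous : ∀ x, Continuous fun t => T t x

/-- `A` is the generator of the semigroup `T`: for some `K, s ≥ 0` one has
`‖T(t)‖ ≤ K e^{st}`, the interval `(s, ∞)` lies in `ρ(A)`, and
`R(z, A) x = ∫₀^∞ e^{-zt} T(t) x dt` for all `z > s`. -/
def IsGenerator (A : X →ₗ.[ℝ] X) (T : ℝ≥0 → X →L[ℝ] X) : Prop :=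
  ∃ K s : ℝ, 0 ≤ K ∧ 0 ≤ s ∧ (∀ t : ℝ≥0, ‖T t‖ ≤ K * Real.exp (s * t)) ∧
    ∀ z > s, ∃ R : X →L[ℝ] X, IsResolvent A z R ∧
      ∀ x, R x = ∫ t in Ioi (0 : ℝ), Real.exp (-z * t) • T t.toNNReal x

/-- The semigroup `T` consists of contractions. -/
def IsContractive (T : ℝ≥0 → X →L[ℝ] X) : Prop := ∀ t, ‖T t‖ ≤ 1

end Semigroup

namespace MetricGraph

variable {V E : Type*}

/-! ### The form on the graph -/

namespace Coefficients

variable {G : MetricGraph V E} [Fintype V]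

theorem bdd_c (K : G.Coefficients) (e : E) : MemLp (K.c e) ∞ (edgeMeasure (G.len e)) := by
  obtain ⟨B, hB⟩ := isCompact_Icc.exists_bound_of_continuousOn (K.c_cont e)
  refine memLp_top_of_bound ?_ B ?_
  · rw [edgeMeasure]
    exact ((K.c_cont e).mono Ioo_subset_Icc_self).aestronglyMeasurable measurableSet_Ioo
  · rw [edgeMeasure, ae_restrict_iff' measurableSet_Ioo]
    exact Eventually.of_forall fun x hx => hB x (Ioo_subset_Icc_self hx)

theorem integrable_triple {μ : Measure ℝ} {q f g : ℝ → ℝ} (hq : MemLp q ∞ μ)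
    (hf : MemLp f 2 μ) (hg : MemLp g 2 μ) : Integrable (fun x => q x * f x * g x) μ :=
  (hf.mul (r := 2) hq).integrable_mul hg

/-- `D(a) = {u ∈ ∏ₑ H¹(0, len e) : u is continuous on the graph}`. -/
def formDomain (_K : G.Coefficients) : Submodule ℝ G.E2 where
  carrier := {u | (∀ e, MemH1 (G.len e) (u e)) ∧ G.IsContinuous u}
  zero_mem' := ⟨fun e => (memH1_zero _ (G.zero_coe e)).1, G.isContinuous_zero.1⟩
  add_mem' := by
    intro u w hu hw
    have := G.lin_coe u w 1 1
    have h2 := (G.isContinuous_lin hu.2 hw.2 1 1).1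
    simp only [one_smul] at this h2
    exact ⟨fun e => (memH1_lin (hu.1 e) (hw.1 e) (this e)).1, h2⟩
  smul_mem' := by
    intro a u hu
    have := G.lin_coe u u a 0
    have h2 := (G.isContinuous_lin hu.2 hu.2 a 0).1
    simp only [zero_smul, add_zero] at this h2
    exact ⟨fun e => (memH1_lin (hu.1 e) (hu.1 e) (this e)).1, h2⟩

/-- The flux `cₑ uₑ'` on the edge `e`. -/
def flux (K : G.Coefficients) (u : G.E2) (e : E) : ℝ → ℝ := fun x =>
  K.c e x * weakDeriv (G.len e) (u e) x

theorem flux_lin (K : G.Coefficients) {u w : G.E2} (hu : ∀ e, MemH1 (G.len e) (u e))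
    (hw : ∀ e, MemH1 (G.len e) (w e)) (a b : ℝ) (e : E) :
    K.flux (a • u + b • w) e =ᵐ[edgeMeasure (G.len e)]
      fun x => a * K.flux u e x + b * K.flux w e x := by
  filter_upwards [(memH1_lin (hu e) (hw e) (G.lin_coe u w a b e)).2] with x hx
  unfold flux
  rw [hx]
  ring

variable [Fintype E]

/-- `a(u, v) = ∑ₑ ∫ cₑ uₑ' vₑ' + ∑ₑ ∫ pₑ uₑ vₑ - ⟨M L u, L v⟩`. -/
def formValue (K : G.Coefficients) (u v : G.E2) : ℝ :=
  ∑ e, ∫ x, K.c e x * weakDeriv (G.len e) (u e) x * weakDeriv (G.len e) (v e) x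
      ∂(edgeMeasure (G.len e))
    + ∑ e, ∫ x, K.p e x * u e x * v e x ∂(edgeMeasure (G.len e))
    - (K.M *ᵥ G.L u) ⬝ᵥ G.L v

theorem formValue_symm (K : G.Coefficients) (u v : G.E2) :
    K.formValue u v = K.formValue v u := by
  have h1 : ∀ (q f g : ℝ → ℝ) (x : ℝ), q x * f x * g x = q x * g x * f x := by
    intros
    ring
  have h2 : (K.M *ᵥ G.L u) ⬝ᵥ G.L v = (K.M *ᵥ G.L v) ⬝ᵥ G.L u := by
    rw [dotProduct_comm, Matrix.dotProduct_mulVec, ← Matrix.mulVec_transpose, K.M_symm.eq]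
  unfold formValue
  rw [h2]
  simp only [h1 _ (weakDeriv _ (u _)), h1 _ (u _)]

theorem formValue_lin (K : G.Coefficients) {u w v : G.E2} (hu : u ∈ K.formDomain)
    (hw : w ∈ K.formDomain) (hv : v ∈ K.formDomain) (a b : ℝ) :
    K.formValue (a • u + b • w) v = a * K.formValue u v + b * K.formValue w v := by
  have A : ∀ (q f g k h : ℝ → ℝ) (μ : Measure ℝ), MemLp q ∞ μ → MemLp f 2 μ → MemLp g 2 μ →
      MemLp h 2 μ → (k =ᵐ[μ] fun x => a * f x + b * g x) →
      ∫ x, q x * k x * h x ∂μ = a * ∫ x, q x * f x * h x ∂μ + b * ∫ x, q x * g x * h x ∂μ := by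
    intro q f g k h μ hq hf hg hh hk
    rw [← integral_const_mul, ← integral_const_mul,
      ← integral_add ((integrable_triple hq hf hh).const_mul a)
        ((integrable_triple hq hg hh).const_mul b)]
    apply integral_congr_ae
    filter_upwards [hk] with x hx
    rw [hx]
    ring
  have s1 : ∀ e, ∫ x, K.c e x * weakDeriv (G.len e) ((a • u + b • w : G.E2) e) x
        * weakDeriv (G.len e) (v e) x ∂(edgeMeasure (G.len e)) = _ := fun e =>
    A (K.c e) _ _ _ _ _ (K.bdd_c e) (weakDeriv_spec (hu.1 e).2).1 (weakDeriv_spec (hw.1 e).2).1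
      (weakDeriv_spec (hv.1 e).2).1
      (memH1_lin (hu.1 e) (hw.1 e) (G.lin_coe u w a b e)).2
  have s2 : ∀ e, ∫ x, K.p e x * (a • u + b • w : G.E2) e x * v e x
        ∂(edgeMeasure (G.len e)) = _ := fun e =>
    A (K.p e) _ _ _ _ _ (K.p_mem e) (hu.1 e).1 (hw.1 e).1 (hv.1 e).1 (G.lin_coe u w a b e)
  unfold formValue
  rw [Finset.sum_congr rfl fun e _ => s1 e, Finset.sum_congr rfl fun e _ => s2 e,
    (G.isContinuous_lin hu.2 hw.2 a b).2, Matrix.mulVec_add, Matrix.mulVec_smul,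
    Matrix.mulVec_smul, add_dotProduct, smul_dotProduct, smul_dotProduct,
    Finset.sum_add_distrib, Finset.sum_add_distrib]
  simp only [← Finset.mul_sum, smul_eq_mul]
  ring

/-- The form `a` with its domain `D(a)`. -/
def form (K : G.Coefficients) : PartialForm G.E2 where
  domain := K.formDomain
  toBilin := LinearMap.mk₂ ℝ (fun u v => K.formValue u v)
    (fun u w v => by simpa using K.formValue_lin u.2 w.2 v.2 1 1)
    (fun a u v => by simpa using K.formValue_lin u.2 u.2 v.2 a 0)
    (fun u v w => by
      have := K.formValue_lin v.2 w.2 u.2 1 1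
      simp only [one_smul, one_mul] at this
      rw [K.formValue_symm u v, K.formValue_symm u w, K.formValue_symm]
      exact this)
    (fun a u v => by
      have := K.formValue_lin v.2 v.2 u.2 a 0
      simp only [zero_smul, add_zero, zero_mul] at this
      rw [K.formValue_symm u v, K.formValue_symm]
      exact this)

/-! ### The operator on the graph -/

open Classical in
/-- `C_v u = ∑ c_e(v) u_e'(v)`, the sum over the edges `e` incident to `v`, with the derivatives
taken in the directions away from `v`. -/
def C (K : G.Coefficients) (u : G.E2) : V → ℝ := fun v =>
  ∑ e with G.Incident e v, K.c e (G.coord e v) *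
    (G.outward e v * contRep (G.len e) (weakDeriv (G.len e) (u e)) (G.coord e v))

/-- Membership in `D(A₂)`: on each edge `uₑ ∈ H¹` and `cₑ uₑ' ∈ H¹`, i.e. `(cₑ uₑ')'` exists
in `L²`; `u` is continuous on the graph; `uₑ'` is continuous on the closed edge, so that
`C u` makes sense; and `M L u + C u = 0`. -/
def InOpDomain (K : G.Coefficients) (u : G.E2) : Prop :=
  (∀ e, MemH1 (G.len e) (u e) ∧ MemH1 (G.len e) (K.flux u e)) ∧ G.IsContinuous u ∧
    (∀ e, HasContRep (G.len e) (weakDeriv (G.len e) (u e))) ∧ K.M *ᵥ G.L u + K.C u = 0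

theorem inOpDomain_lin (K : G.Coefficients) {u w : G.E2} (hu : K.InOpDomain u)
    (hw : K.InOpDomain w) (a b : ℝ) : K.InOpDomain (a • u + b • w) := by
  have d := fun e => contRep_lin (G.len_pos e) (hu.2.2.1 e) (hw.2.2.1 e)
    (memH1_lin (hu.1 e).1 (hw.1 e).1 (G.lin_coe u w a b e)).2
  have hC : K.C (a • u + b • w) = a • K.C u + b • K.C w := by
    funext v
    simp only [C, Pi.add_apply, Pi.smul_apply, smul_eq_mul, Finset.mul_sum]
    rw [← Finset.sum_add_distrib]
    refine Finset.sum_congr rfl fun e _ => ?_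
    rw [(d e).2 (G.coord_mem e v)]
    ring
  refine ⟨fun e => ⟨(memH1_lin (hu.1 e).1 (hw.1 e).1 (G.lin_coe u w a b e)).1,
    (memH1_lin (hu.1 e).2 (hw.1 e).2 (K.flux_lin (fun e => (hu.1 e).1)
      (fun e => (hw.1 e).1) a b e)).1⟩,
    (G.isContinuous_lin hu.2.1 hw.2.1 a b).1, fun e => (d e).1, ?_⟩
  have e1 : K.M *ᵥ G.L (a • u + b • w) + K.C (a • u + b • w)
      = a • (K.M *ᵥ G.L u + K.C u) + b • (K.M *ᵥ G.L w + K.C w) := by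
    rw [hC, (G.isContinuous_lin hu.2.1 hw.2.1 a b).2, Matrix.mulVec_add, Matrix.mulVec_smul,
      Matrix.mulVec_smul]
    module
  rw [e1, hu.2.2.2, hw.2.2.2, smul_zero, smul_zero, add_zero]

theorem inOpDomain_zero (K : G.Coefficients) : K.InOpDomain (0 : G.E2) := by
  have d := fun e => memH1_zero _ (G.zero_coe e)
  have r := fun e => contRep_zero (G.len_pos e) (d e).2
  refine ⟨fun e => ⟨(d e).1, (memH1_zero _ ?_).1⟩, G.isContinuous_zero.1, fun e => (r e).1, ?_⟩
  · filter_upwards [(d e).2] with x hx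
    simp only [flux]
    rw [hx]
    simp
  · rw [G.isContinuous_zero.2, Matrix.mulVec_zero, zero_add]
    funext v
    refine Finset.sum_eq_zero fun e _ => ?_
    rw [(r e).2 (G.coord_mem e v)]
    simp

/-- The function `(cₑ uₑ')' - pₑ uₑ` on the edge `e`. -/
def opFun (K : G.Coefficients) (u : G.E2) (e : E) : ℝ → ℝ := fun x =>
  weakDeriv (G.len e) (K.flux u e) x - K.p e x * u e x

theorem memLp_opFun (K : G.Coefficients) {u : G.E2} (hu : K.InOpDomain u) (e : E) :
    MemLp (K.opFun u e) 2 (edgeMeasure (G.len e)) :=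
  (weakDeriv_spec (hu.1 e).2.2).1.sub ((Lp.memLp (u e)).mul (r := 2) (K.p_mem e))

theorem opFun_lin (K : G.Coefficients) {u w : G.E2} (hu : K.InOpDomain u)
    (hw : K.InOpDomain w) (a b : ℝ) (e : E) :
    K.opFun (a • u + b • w) e =ᵐ[edgeMeasure (G.len e)]
      fun x => a * K.opFun u e x + b * K.opFun w e x := by
  filter_upwards [(memH1_lin (hu.1 e).2 (hw.1 e).2 (K.flux_lin (fun e => (hu.1 e).1)
    (fun e => (hw.1 e).1) a b e)).2, G.lin_coe u w a b e] with x h1 h2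
  unfold opFun
  rw [h1, h2]
  ring

/-- The domain `D(A₂)`. -/
def opDomain (K : G.Coefficients) : Submodule ℝ G.E2 where
  carrier := {u | K.InOpDomain u}
  zero_mem' := K.inOpDomain_zero
  add_mem' := fun {u w} hu hw => by simpa using K.inOpDomain_lin hu hw 1 1
  smul_mem' := fun a u hu => by simpa using K.inOpDomain_lin hu hu a 0

/-- The element `((cₑ uₑ')' - pₑ uₑ)ₑ` of the state space. -/
def opValue (K : G.Coefficients) (u : K.opDomain) : G.E2 :=
  WithLp.toLp 2 fun e => (K.memLp_opFun u.2 e).toLp (K.opFun u e)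

theorem opValue_coe (K : G.Coefficients) (u : K.opDomain) (e : E) :
    (K.opValue u e : ℝ → ℝ) =ᵐ[edgeMeasure (G.len e)] K.opFun u e :=
  MemLp.coeFn_toLp (K.memLp_opFun u.2 e)

theorem opValue_lin (K : G.Coefficients) (u w : K.opDomain) (a b : ℝ) :
    K.opValue (a • u + b • w) = a • K.opValue u + b • K.opValue w := by
  ext1 e
  apply Lp.ext
  filter_upwards [K.opValue_coe (a • u + b • w) e, K.opFun_lin u.2 w.2 a b e,
    G.lin_coe (K.opValue u) (K.opValue w) a b e, K.opValue_coe u e, K.opValue_coe w e]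
    with x h1 h2 h3 h4 h5
  rw [h1, h3, h4, h5]
  exact h2

/-- The operator `A₂ u = ((cₑ uₑ')' - pₑ uₑ)ₑ` with domain `D(A₂)`. -/
def A2 (K : G.Coefficients) : G.E2 →ₗ.[ℝ] G.E2 where
  domain := K.opDomain
  toFun :=
    { toFun := K.opValue
      map_add' := fun u w => by simpa using K.opValue_lin u w 1 1
      map_smul' := fun a u => by simpa using K.opValue_lin u u a 0 }

end Coefficients

/-! ### Complexification and positivity -/

/-- The complexification `∏ₑ L²(0, len e; ℂ)` of `E2`. -/
abbrev E2C (G : MetricGraph V E) : Type _ :=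
  PiLp 2 fun e : E => Lp ℂ 2 (edgeMeasure (G.len e))

/-- The inclusion of the real into the complex space. -/
def toC (G : MetricGraph V E) (u : G.E2) : G.E2C :=
  WithLp.toLp 2 fun e => Complex.ofRealCLM.compLp (u e)

/-- The real part. -/
def reC (G : MetricGraph V E) (f : G.E2C) : G.E2 :=
  WithLp.toLp 2 fun e => Complex.reCLM.compLp (f e)

/-- The imaginary part. -/
def imC (G : MetricGraph V E) (f : G.E2C) : G.E2 :=
  WithLp.toLp 2 fun e => Complex.imCLM.compLp (f e)

theorem toC_lin (G : MetricGraph V E) (u w : G.E2) (a b : ℝ) :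
    G.toC (a • u + b • w) = (a : ℂ) • G.toC u + (b : ℂ) • G.toC w := by
  ext1 e
  change Complex.ofRealCLM.compLp (a • u e + b • w e)
    = (a : ℂ) • Complex.ofRealCLM.compLp (u e) + (b : ℂ) • Complex.ofRealCLM.compLp (w e)
  apply Lp.ext
  filter_upwards [ContinuousLinearMap.coeFn_compLp Complex.ofRealCLM (a • u e + b • w e),
    Lp.coeFn_add (a • u e) (b • w e), Lp.coeFn_smul a (u e), Lp.coeFn_smul b (w e),
    Lp.coeFn_add ((a : ℂ) • Complex.ofRealCLM.compLp (u e))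
      ((b : ℂ) • Complex.ofRealCLM.compLp (w e)),
    Lp.coeFn_smul (a : ℂ) (Complex.ofRealCLM.compLp (u e)),
    Lp.coeFn_smul (b : ℂ) (Complex.ofRealCLM.compLp (w e)),
    ContinuousLinearMap.coeFn_compLp Complex.ofRealCLM (u e),
    ContinuousLinearMap.coeFn_compLp Complex.ofRealCLM (w e)] with x h1 h2 h3 h4 h5 h6 h7 h8 h9
  rw [h1, h2, h5, Pi.add_apply, Pi.add_apply, h3, h4, h6, h7]
  simp only [Pi.smul_apply, h8, h9, Complex.ofRealCLM_apply, smul_eq_mul, Complex.ofReal_add,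
    Complex.ofReal_mul]

theorem reC_lin (G : MetricGraph V E) (f g : G.E2C) (z : ℂ) :
    G.reC (z • f + g) = z.re • G.reC f + (-z.im) • G.imC f + G.reC g := by
  ext1 e
  change Complex.reCLM.compLp (z • f e + g e) = z.re • Complex.reCLM.compLp (f e)
    + (-z.im) • Complex.imCLM.compLp (f e) + Complex.reCLM.compLp (g e)
  apply Lp.ext
  filter_upwards [ContinuousLinearMap.coeFn_compLp Complex.reCLM (z • f e + g e),
    Lp.coeFn_add (z • f e) (g e), Lp.coeFn_smul z (f e),
    Lp.coeFn_add (z.re • Complex.reCLM.compLp (f e) + (-z.im) • Complex.imCLM.compLp (f e))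
      (Complex.reCLM.compLp (g e)),
    Lp.coeFn_add (z.re • Complex.reCLM.compLp (f e)) ((-z.im) • Complex.imCLM.compLp (f e)),
    Lp.coeFn_smul z.re (Complex.reCLM.compLp (f e)),
    Lp.coeFn_smul (-z.im) (Complex.imCLM.compLp (f e)),
    ContinuousLinearMap.coeFn_compLp Complex.reCLM (f e),
    ContinuousLinearMap.coeFn_compLp Complex.imCLM (f e),
    ContinuousLinearMap.coeFn_compLp Complex.reCLM (g e)]
    with x h1 h2 h3 h4 h5 h6 h7 h8 h9 h10
  rw [h1, h2, h4, Pi.add_apply, Pi.add_apply, h3, h5, Pi.add_apply, h6, h7, h10]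
  simp only [Pi.smul_apply, h8, h9, Complex.reCLM_apply, Complex.imCLM_apply, Complex.add_re,
    smul_eq_mul, Complex.mul_re]
  ring

theorem imC_lin (G : MetricGraph V E) (f g : G.E2C) (z : ℂ) :
    G.imC (z • f + g) = z.re • G.imC f + z.im • G.reC f + G.imC g := by
  ext1 e
  change Complex.imCLM.compLp (z • f e + g e) = z.re • Complex.imCLM.compLp (f e)
    + z.im • Complex.reCLM.compLp (f e) + Complex.imCLM.compLp (g e)
  apply Lp.ext
  filter_upwards [ContinuousLinearMap.coeFn_compLp Complex.imCLM (z • f e + g e),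
    Lp.coeFn_add (z • f e) (g e), Lp.coeFn_smul z (f e),
    Lp.coeFn_add (z.re • Complex.imCLM.compLp (f e) + z.im • Complex.reCLM.compLp (f e))
      (Complex.imCLM.compLp (g e)),
    Lp.coeFn_add (z.re • Complex.imCLM.compLp (f e)) (z.im • Complex.reCLM.compLp (f e)),
    Lp.coeFn_smul z.re (Complex.imCLM.compLp (f e)),
    Lp.coeFn_smul z.im (Complex.reCLM.compLp (f e)),
    ContinuousLinearMap.coeFn_compLp Complex.reCLM (f e),
    ContinuousLinearMap.coeFn_compLp Complex.imCLM (f e),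
    ContinuousLinearMap.coeFn_compLp Complex.imCLM (g e)]
    with x h1 h2 h3 h4 h5 h6 h7 h8 h9 h10
  rw [h1, h2, h4, Pi.add_apply, Pi.add_apply, h3, h5, Pi.add_apply, h6, h7, h10]
  simp only [Pi.smul_apply, h8, h9, Complex.reCLM_apply, Complex.imCLM_apply, Complex.add_im,
    smul_eq_mul, Complex.mul_im]

theorem reC_imC_smul (G : MetricGraph V E) (f : G.E2C) (z : ℂ) :
    G.reC (z • f) = z.re • G.reC f + (-z.im) • G.imC f ∧
      G.imC (z • f) = z.re • G.imC f + z.im • G.reC f := by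
  have r0 : G.reC (0 : G.E2C) = 0 := by simpa using G.reC_lin (0 : G.E2C) 0 (-1)
  have i0 : G.imC (0 : G.E2C) = 0 := by simpa using G.imC_lin (0 : G.E2C) 0 (-1)
  have h1 := G.reC_lin f 0 z
  have h2 := G.imC_lin f 0 z
  rw [r0, add_zero, add_zero] at h1
  rw [i0, add_zero, add_zero] at h2
  exact ⟨h1, h2⟩

/-- The domain `{f : Re f ∈ D(A), Im f ∈ D(A)}` of the complexification of `A`. -/
def complexDomain (G : MetricGraph V E) (A : G.E2 →ₗ.[ℝ] G.E2) : Submodule ℂ G.E2C where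
  carrier := {f | G.reC f ∈ A.domain ∧ G.imC f ∈ A.domain}
  zero_mem' := by
    have h1 := G.reC_lin (0 : G.E2C) 0 (-1)
    have h2 := G.imC_lin (0 : G.E2C) 0 (-1)
    simp only [smul_zero, add_zero, Complex.neg_re, Complex.neg_im, Complex.one_re,
      Complex.one_im, neg_zero, zero_smul, neg_smul, one_smul, neg_add_cancel] at h1 h2
    exact ⟨h1 ▸ A.domain.zero_mem, h2 ▸ A.domain.zero_mem⟩
  add_mem' := by
    intro f g hf hg
    have h1 := G.reC_lin f g 1
    have h2 := G.imC_lin f g 1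
    simp only [one_smul, Complex.one_re, Complex.one_im, neg_zero, zero_smul, add_zero] at h1 h2
    refine ⟨?_, ?_⟩
    · rw [h1]
      exact A.domain.add_mem hf.1 hg.1
    · rw [h2]
      exact A.domain.add_mem hf.2 hg.2
  smul_mem' := by
    intro z f hf
    obtain ⟨h1, h2⟩ := G.reC_imC_smul f z
    refine ⟨?_, ?_⟩
    · rw [h1]
      exact A.domain.add_mem (A.domain.smul_mem _ hf.1) (A.domain.smul_mem _ hf.2)
    · rw [h2]
      exact A.domain.add_mem (A.domain.smul_mem _ hf.2) (A.domain.smul_mem _ hf.1)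

/-- The complexification `A(v + iw) = A v + i A w` of `A`. -/
def complexify (G : MetricGraph V E) (A : G.E2 →ₗ.[ℝ] G.E2) : G.E2C →ₗ.[ℂ] G.E2C where
  domain := G.complexDomain A
  toFun :=
    { toFun := fun f => G.toC (A ⟨G.reC f, f.2.1⟩) + Complex.I • G.toC (A ⟨G.imC f, f.2.2⟩)
      map_add' := fun f g => by
        have h1 := G.reC_lin (f : G.E2C) g 1
        have h2 := G.imC_lin (f : G.E2C) g 1
        simp only [one_smul, Complex.one_re, Complex.one_im, neg_zero, zero_smul, add_zero]
          at h1 h2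
        have e1 : A ⟨G.reC (f + g : G.complexDomain A), (f + g).2.1⟩
            = (1 : ℝ) • A ⟨G.reC f, f.2.1⟩ + (1 : ℝ) • A ⟨G.reC g, g.2.1⟩ := by
          rw [← A.map_smul, ← A.map_smul, ← A.map_add]
          congr 1
          apply Subtype.ext
          simpa using h1
        have e2 : A ⟨G.imC (f + g : G.complexDomain A), (f + g).2.2⟩
            = (1 : ℝ) • A ⟨G.imC f, f.2.2⟩ + (1 : ℝ) • A ⟨G.imC g, g.2.2⟩ := by
          rw [← A.map_smul, ← A.map_smul, ← A.map_add]
          congr 1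
          apply Subtype.ext
          simpa using h2
        rw [e1, e2, toC_lin, toC_lin]
        push_cast
        module
      map_smul' := fun z f => by
        obtain ⟨h1, h2⟩ := G.reC_imC_smul (f : G.E2C) z
        have e1 : A ⟨G.reC (z • f : G.complexDomain A), (z • f).2.1⟩
            = z.re • A ⟨G.reC f, f.2.1⟩ + (-z.im) • A ⟨G.imC f, f.2.2⟩ := by
          rw [← A.map_smul, ← A.map_smul, ← A.map_add]
          congr 1
          apply Subtype.ext
          simpa using h1
        have e2 : A ⟨G.imC (z • f : G.complexDomain A), (z • f).2.2⟩
            = z.re • A ⟨G.imC f, f.2.2⟩ + z.im • A ⟨G.reC f, f.2.1⟩ := by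
          rw [← A.map_smul, ← A.map_smul, ← A.map_add]
          congr 1
          apply Subtype.ext
          simpa using h2
        rw [e1, e2, toC_lin, toC_lin]
        simp only [RingHom.id_apply]
        have hz : z = (z.re : ℂ) + (z.im : ℂ) * Complex.I := (Complex.re_add_im z).symm
        clear h1 h2 e1 e2
        push_cast
        match_scalars
        · linear_combination -hz
        · linear_combination -Complex.I * hz - (z.im : ℂ) * Complex.I_mul_I }

variable [Fintype E]

/-- The semigroup `T` is positive: it maps functions that are nonnegative almost everywhere
on each edge to such functions. -/
def IsPositive (G : MetricGraph V E) (T : ℝ≥0 → G.E2 →L[ℝ] G.E2) : Prop :=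
  ∀ t u, (∀ e, 0 ≤ u e) → ∀ e, 0 ≤ T t u e

/-- The semigroup `T` is bounded analytic: for some `θ ∈ (0, π/2]` it (that is, its
complexification) has a holomorphic extension to the sector `Σ_θ` which is bounded on `Σ_θ'`
for each `θ' ∈ (0, θ)`. -/
def IsBoundedAnalytic (G : MetricGraph V E) (T : ℝ≥0 → G.E2 →L[ℝ] G.E2) : Prop :=
  ∃ θ : ℝ, 0 < θ ∧ θ ≤ Real.pi / 2 ∧ ∃ S : ℂ → G.E2C →L[ℂ] G.E2C,
    DifferentiableOn ℂ S (sector θ) ∧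
    (∀ θ' : ℝ, 0 < θ' → θ' < θ → ∃ K : ℝ, ∀ z ∈ sector θ', ‖S z‖ ≤ K) ∧
    ∀ t : ℝ≥0, 0 < t → ∀ u : G.E2, S ((t : ℝ) : ℂ) (G.toC u) = G.toC (T t u)

end MetricGraph

end

noncomputable section

/-! ### Sobolev functions and absolutely continuous functions -/

/-! On an interval, `H¹` consists of the absolutely continuous functions with derivative in `L²`
(`AbsolutelyContinuousOnInterval.memH1`, `MemH1.contRep`). This yields integration by parts,
stability under products, inverses and moduli, and the Sobolev estimate `MemH1.sq_contRep_le`.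
Integrating by parts on each edge gives Green's formula `formValue_eq`, whose boundary term is the
pairing of `M L u + C u` with `L v`. Functions supported inside one edge identify the differential
expression; arbitrary vertex values then force the vertex condition, so the form has `-A₂` as its
operator (`form_isAssociated`). The form is accretive because the hypotheses on `M` make it negative
semidefinite. It is closed because the conductances are bounded below: the form norm controls the
`H¹` norm on every edge, and hence the vertex values (`form_isClosed`). For a closed symmetric
accretive form, Riesz representation makes `r - A` surjective for every `r > 0`. Together with
symmetry and dissipativity this gives resolvents, a dense domain and self-adjointness
(`IsMDissipativeSymmetric`). Sectoriality and the semigroup come from the continuous functional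
calculus of the single bounded operator `R(1, A)` on the complexification, a positive contraction
with spectrum in `[0, 1]`. The substitution `s = 1 / (1 + x)` turns functions `k` on `[0, ∞)`
vanishing at infinity into continuous functions of `s`, so that `k(-A)` is defined with norm at most
`sup |k|`. The symbol `1 / (z + x)` gives `R(z, A)` and `exp (-z x)` gives the semigroup; all
operator estimates become scalar ones. Euler's formula `exp (-t x) = lim (1 + t x / n)⁻ⁿ` holds
uniformly in `x ≥ 0`, so the semigroup is a limit of powers of resolvents. It follows that the
semigroup preserves real functions. It is positive as well, because the resolvents are, by the
Beurling-Deny inequality `exists_abs`. -/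

theorem AbsolutelyContinuousOnInterval.congr {f g : ℝ → ℝ} {a b : ℝ}
    (hf : AbsolutelyContinuousOnInterval f a b) (h : EqOn f g (uIcc a b)) :
    AbsolutelyContinuousOnInterval g a b := by
  rw [absolutelyContinuousOnInterval_iff] at hf ⊢
  intro ε hε
  obtain ⟨δ, hδ, H⟩ := hf ε hε
  refine ⟨δ, hδ, fun E hE hs => ?_⟩
  convert H E hE hs using 1
  refine Finset.sum_congr rfl fun i hi => ?_
  rw [h (hE.1 i hi).1, h (hE.1 i hi).2]

theorem LipschitzOnWith.comp_absolutelyContinuousOnInterval {F f : ℝ → ℝ} {a b : ℝ} {C : ℝ≥0}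
    {s : Set ℝ} (hF : LipschitzOnWith C F s) (hf : AbsolutelyContinuousOnInterval f a b)
    (hs : MapsTo f (uIcc a b) s) : AbsolutelyContinuousOnInterval (fun x => F (f x)) a b := by
  rw [absolutelyContinuousOnInterval_iff] at hf ⊢
  intro ε hε
  -- Dividing by `C + 1` rather than `C` covers the case `C = 0`.
  obtain ⟨δ, hδ, H⟩ := hf (ε / (C + 1)) (by positivity)
  refine ⟨δ, hδ, fun E hE hd => ?_⟩
  have h1 := H E hE hd
  have h2 : ∑ i ∈ Finset.range E.1, dist (F (f (E.2 i).1)) (F (f (E.2 i).2))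
      ≤ C * ∑ i ∈ Finset.range E.1, dist (f (E.2 i).1) (f (E.2 i).2) := by
    rw [Finset.mul_sum]
    exact Finset.sum_le_sum fun i hi =>
      hF.dist_le_mul _ (hs (hE.1 i hi).1) _ (hs (hE.1 i hi).2)
  rw [lt_div_iff₀ (by positivity)] at h1
  have h3 : 0 ≤ ∑ i ∈ Finset.range E.1, dist (f (E.2 i).1) (f (E.2 i).2) :=
    Finset.sum_nonneg fun _ _ => dist_nonneg
  nlinarith

theorem ae_edgeMeasure_iff {l : ℝ} {P : ℝ → Prop} :
    (∀ᵐ x ∂(edgeMeasure l), P x) ↔ ∀ᵐ x, x ∈ Ioo 0 l → P x := by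
  rw [edgeMeasure, ae_restrict_iff' measurableSet_Ioo]

theorem integral_edgeMeasure {l : ℝ} (hl : 0 < l) (f : ℝ → ℝ) :
    ∫ x, f x ∂(edgeMeasure l) = ∫ x in (0 : ℝ)..l, f x := by
  rw [edgeMeasure, intervalIntegral.integral_of_le hl.le, restrict_Ioo_eq_restrict_Ioc]

theorem MeasureTheory.MemLp.intervalIntegrable_edge {l : ℝ} (hl : 0 < l) {g : ℝ → ℝ}
    (hg : MemLp g 2 (edgeMeasure l)) : IntervalIntegrable g volume 0 l := by
  rw [intervalIntegrable_iff_integrableOn_Ioo_of_le hl.le]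
  exact hg.integrable (by norm_num)

theorem ContinuousOn.memLp_edgeMeasure {l : ℝ} {w : ℝ → ℝ} (hw : ContinuousOn w (Icc 0 l)) :
    MemLp w ∞ (edgeMeasure l) := by
  obtain ⟨B, hB⟩ := isCompact_Icc.exists_bound_of_continuousOn hw
  refine memLp_top_of_bound ?_ B ?_
  · rw [edgeMeasure]
    exact (hw.mono Ioo_subset_Icc_self).aestronglyMeasurable measurableSet_Ioo
  · rw [edgeMeasure, ae_restrict_iff' measurableSet_Ioo]
    exact Eventually.of_forall fun x hx => hB x (Ioo_subset_Icc_self hx)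

theorem isWeakDeriv_congr_left {l : ℝ} {f f' g : ℝ → ℝ} (h : f =ᵐ[edgeMeasure l] f')
    (hf : IsWeakDeriv l f g) : IsWeakDeriv l f' g := by
  intro φ h1 h2 h3
  rw [← hf φ h1 h2 h3]
  apply integral_congr_ae
  filter_upwards [h] with x hx
  rw [hx]

/-- An absolutely continuous function is weakly differentiable. -/
theorem AbsolutelyContinuousOnInterval.isWeakDeriv {l : ℝ} (hl : 0 < l) {w : ℝ → ℝ}
    (hw : AbsolutelyContinuousOnInterval w 0 l) : IsWeakDeriv l w (deriv w) := by
  intro φ h1 h2 h3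
  have hφ : AbsolutelyContinuousOnInterval φ 0 l :=
    ((h1.of_le (by simp)).contDiffOn (s := uIcc 0 l)).absolutelyContinuousOnInterval
  have e0 : φ 0 = 0 := image_eq_zero_of_notMem_tsupport fun h => (h3 h).1.false
  have e1 : φ l = 0 := image_eq_zero_of_notMem_tsupport fun h => (h3 h).2.false
  rw [integral_edgeMeasure hl, integral_edgeMeasure hl, hw.integral_mul_deriv_eq_deriv_mul hφ,
    e0, e1]
  ring

/-- This is how `H¹` membership is established below: it is checked on an absolutely continuous
representative, whose classical derivative then serves as the weak one. -/
theorem AbsolutelyContinuousOnInterval.memH1 {l : ℝ} (hl : 0 < l) {f w g : ℝ → ℝ}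
    (hw : AbsolutelyContinuousOnInterval w 0 l) (hg : MemLp g 2 (edgeMeasure l))
    (hd : deriv w =ᵐ[edgeMeasure l] g) (hf : f =ᵐ[edgeMeasure l] w) :
    MemH1 l f ∧ weakDeriv l f =ᵐ[edgeMeasure l] g := by
  have hg' : MemLp (deriv w) 2 (edgeMeasure l) := (memLp_congr_ae hd).2 hg
  have h := isWeakDeriv_congr_left hf.symm (hw.isWeakDeriv hl)
  have hc : ContinuousOn w (Icc 0 l) := by simpa [uIcc_of_le hl.le] using hw.continuousOn
  exact ⟨⟨(memLp_congr_ae hf).2 (hc.memLp_edgeMeasure.mono_exponent le_top), _, hg', h⟩,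
    (weakDeriv_ae_eq hg' h).trans hd⟩

/-- The compact interval keeps the support away from both endpoints, which lets a primitive vanish
near them as well. -/
theorem exists_Icc_of_tsupport_subset {l : ℝ} (hl : 0 < l) {φ : ℝ → ℝ} (h2 : HasCompactSupport φ)
    (h3 : tsupport φ ⊆ Ioo 0 l) :
    ∃ a b, 0 < a ∧ a ≤ b ∧ b < l ∧ tsupport φ ⊆ Icc a b := by
  rcases (tsupport φ).eq_empty_or_nonempty with h | h
  · exact ⟨l / 2, l / 2, by linarith, le_rfl, by linarith, by simp [h]⟩
  · obtain ⟨a, ha⟩ := IsCompact.exists_isLeast h2 h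
    obtain ⟨b, hb⟩ := IsCompact.exists_isGreatest h2 h
    exact ⟨a, b, (h3 ha.1).1, hb.2 ha.1, (h3 hb.1).2, fun x hx => ⟨ha.2 hx, hb.2 hx⟩⟩

/-- A test function with vanishing integral is the derivative of a test function. -/
theorem exists_primitive_testFunction {l : ℝ} (hl : 0 < l) {χ : ℝ → ℝ} (h1 : ContDiff ℝ ∞ χ)
    (h2 : HasCompactSupport χ) (h3 : tsupport χ ⊆ Ioo 0 l)
    (h0 : ∫ x, χ x ∂(edgeMeasure l) = 0) :
    ∃ φ : ℝ → ℝ, ContDiff ℝ ∞ φ ∧ HasCompactSupport φ ∧ tsupport φ ⊆ Ioo 0 l ∧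
      deriv φ = χ := by
  obtain ⟨a, b, ha, hab, hb, hs⟩ := exists_Icc_of_tsupport_subset hl h2 h3
  have hχ0 : ∀ x, x ∉ Icc a b → χ x = 0 := fun x hx =>
    image_eq_zero_of_notMem_tsupport fun h => hx (hs h)
  have hd : ∀ x, HasDerivAt (fun y => ∫ t in (0 : ℝ)..y, χ t) (χ x) x := fun x =>
    intervalIntegral.integral_hasDerivAt_right (h1.continuous.intervalIntegrable _ _)
      (h1.continuous.stronglyMeasurableAtFilter _ _) h1.continuous.continuousAt
  have hd' : deriv (fun y => ∫ t in (0 : ℝ)..y, χ t) = χ := funext fun x => (hd x).deriv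
  -- Left of `a` the integrand is zero; right of `b` the integral equals the total integral of `χ`,
  -- which vanishes by hypothesis.
  have hz : ∀ x, x ∉ Icc a b → ∫ t in (0 : ℝ)..x, χ t = 0 := by
    intro x hx
    rcases lt_or_ge x a with h | h
    · apply intervalIntegral.integral_zero_ae
      filter_upwards with t ht
      apply hχ0
      rw [mem_uIoc] at ht
      rintro ⟨h4, h5⟩
      rcases ht with ht | ht <;> linarith
    · have hxb : b < x := by
        by_contra h'
        exact hx ⟨h, not_lt.1 h'⟩
      rw [integral_edgeMeasure hl] at h0
      have e := intervalIntegral.integral_add_adjacent_intervals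
        (h1.continuous.intervalIntegrable (μ := volume) 0 l)
        (h1.continuous.intervalIntegrable (μ := volume) l x)
      rw [← e, h0, zero_add]
      apply intervalIntegral.integral_zero_ae
      filter_upwards with t ht
      apply hχ0
      rw [mem_uIoc] at ht
      rintro ⟨h4, h5⟩
      rcases ht with ht | ht <;> linarith
  have hts : tsupport (fun y => ∫ t in (0 : ℝ)..y, χ t) ⊆ Icc a b := by
    refine closure_minimal (fun x hx => ?_) isClosed_Icc
    by_contra h
    exact hx (hz x h)
  refine ⟨_, ?_, HasCompactSupport.of_support_subset_isCompact isCompact_Icc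
    ((subset_tsupport _).trans hts), hts.trans fun x hx => ⟨ha.trans_le hx.1, hx.2.trans_lt hb⟩,
    hd'⟩
  rw [contDiff_infty_iff_deriv]
  exact ⟨fun x => (hd x).differentiableAt, by rwa [hd']⟩

theorem exists_testFunction_integral_eq_one {l : ℝ} (hl : 0 < l) :
    ∃ ψ : ℝ → ℝ, ContDiff ℝ ∞ ψ ∧ HasCompactSupport ψ ∧ tsupport ψ ⊆ Ioo 0 l ∧
      ∫ x, ψ x ∂(edgeMeasure l) = 1 := by
  let b : ContDiffBump (l / 2) := ⟨l / 8, l / 4, by linarith, by linarith⟩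
  have hs : tsupport (b.normed volume) ⊆ Ioo 0 l := by
    rw [b.tsupport_normed_eq, Real.closedBall_eq_Icc]
    intro x hx
    simp only [b, mem_Icc] at hx
    constructor <;> linarith [hx.1, hx.2]
  refine ⟨b.normed volume, b.contDiff_normed, b.hasCompactSupport_normed, hs, ?_⟩
  rw [← b.integral_normed (μ := volume), edgeMeasure]
  apply setIntegral_eq_integral_of_forall_compl_eq_zero
  intro x hx
  exact image_eq_zero_of_notMem_tsupport fun h => hx (hs h)

/-- The lemma of du Bois-Reymond. -/
theorem ae_eq_const_of_isWeakDeriv_zero {l : ℝ} (hl : 0 < l) {f : ℝ → ℝ}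
    (hf : MemLp f 2 (edgeMeasure l)) (h : IsWeakDeriv l f 0) :
    ∃ c : ℝ, f =ᵐ[edgeMeasure l] fun _ => c := by
  obtain ⟨ψ, p1, p2, p3, p4⟩ := exists_testFunction_integral_eq_one hl
  have hi := fun {φ : ℝ → ℝ} (h1 : ContDiff ℝ ∞ φ) (h2 : HasCompactSupport φ) =>
    integrable_mul_test hf h1.continuous h2
  have hj : ∀ {φ : ℝ → ℝ}, ContDiff ℝ ∞ φ → HasCompactSupport φ →
      Integrable φ (edgeMeasure l) := fun h1 h2 =>
    h1.continuous.integrable_of_hasCompactSupport h2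
  -- As `ψ` has integral one, this integral is the only possible value of the constant.
  set c := ∫ x, f x * ψ x ∂(edgeMeasure l) with hc
  refine ⟨c, ?_⟩
  have key : ∀ φ : ℝ → ℝ, ContDiff ℝ ∞ φ → HasCompactSupport φ → tsupport φ ⊆ Ioo 0 l →
      ∫ x, φ x * (f x - c) ∂(edgeMeasure l) = 0 := by
    intro φ h1 h2 h3
    set m := ∫ x, φ x ∂(edgeMeasure l) with hm
    have hts : tsupport (fun x => φ x - m * ψ x) ⊆ tsupport φ ∪ tsupport ψ := by
      refine closure_minimal (fun x hx => ?_)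
        ((isClosed_tsupport _).union (isClosed_tsupport _))
      by_contra h'
      rw [mem_union, not_or] at h'
      exact hx (by simp [image_eq_zero_of_notMem_tsupport h'.1,
        image_eq_zero_of_notMem_tsupport h'.2])
    -- Subtracting `m ψ` makes the integral vanish, so `φ - m ψ` is the derivative of a test
    -- function and `f` annihilates it.
    obtain ⟨θ, t1, t2, t3, t4⟩ := exists_primitive_testFunction hl
      (χ := fun x => φ x - m * ψ x) (h1.sub (contDiff_const.mul p1))
      (HasCompactSupport.of_support_subset_isCompact (IsCompact.union h2 p2)
        ((subset_tsupport _).trans hts)) (hts.trans (union_subset h3 p3)) (by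
        rw [integral_sub (hj h1 h2) ((hj p1 p2).const_mul m), integral_const_mul, p4]
        simp [m])
    have e := h θ t1 t2 t3
    rw [t4] at e
    have e1 : ∫ x, f x * (φ x - m * ψ x) ∂(edgeMeasure l)
        = ∫ x, f x * φ x ∂(edgeMeasure l) - m * c := by
      rw [hc, ← integral_const_mul, ← integral_sub (hi h1 h2) ((hi p1 p2).const_mul m)]
      congr 1
      funext x
      ring
    have e2 : ∫ x, φ x * (f x - c) ∂(edgeMeasure l)
        = ∫ x, f x * φ x ∂(edgeMeasure l) - c * m := by
      rw [hm, ← integral_const_mul, ← integral_sub (hi h1 h2) ((hj h1 h2).const_mul c)]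
      congr 1
      funext x
      ring
    rw [e1] at e
    simp only [Pi.zero_apply, zero_mul, integral_zero, neg_zero] at e
    rw [e2]
    linarith
  have hi' : Integrable (fun x => f x - c) (edgeMeasure l) :=
    (hf.sub (memLp_const c)).integrable (by norm_num)
  have := isOpen_Ioo.ae_eq_zero_of_integral_contDiff_smul_eq_zero (U := Ioo (0 : ℝ) l)
    (μ := volume) (f := fun x => f x - c) (IntegrableOn.locallyIntegrableOn hi') (by
      intro φ h1 h2 h3
      rw [← key φ h1 h2 h3, edgeMeasure]
      symm
      apply setIntegral_eq_integral_of_forall_compl_eq_zero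
      intro x hx
      simp [image_eq_zero_of_notMem_tsupport fun hx' => hx (h3 hx')])
  filter_upwards [ae_edgeMeasure_iff.2 this] with x hx
  linarith

/-- The continuous representative of a function in `H¹` is absolutely continuous and its
derivative is the weak derivative. -/
theorem MemH1.contRep {l : ℝ} (hl : 0 < l) {f : ℝ → ℝ} (hf : MemH1 l f) :
    HasContRep l f ∧ AbsolutelyContinuousOnInterval (contRep l f) 0 l ∧
      deriv (contRep l f) =ᵐ[edgeMeasure l] weakDeriv l f := by
  obtain ⟨g1, g2⟩ := weakDeriv_spec hf.2
  set g := weakDeriv l f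
  have hgi := g1.intervalIntegrable_edge hl
  have hw := hgi.absolutelyContinuousOnInterval_intervalIntegral (c := 0) (by simp)
  have hu : uIcc 0 l = Icc 0 l := uIcc_of_le hl.le
  have hd : deriv (fun x => ∫ t in (0 : ℝ)..x, g t) =ᵐ[edgeMeasure l] g := by
    rw [EventuallyEq, ae_edgeMeasure_iff]
    filter_upwards [hgi.ae_hasDerivAt_integral] with x hx hx'
    exact (hx (hu ▸ Ioo_subset_Icc_self hx') 0 (by simp)).deriv
  have h1 := hw.memH1 hl g1 hd ae_eq_rfl
  -- The difference between `f` and the primitive of its weak derivative has weak derivative zero,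
  -- hence is constant.
  have hl1 := memH1_lin hf h1.1 (a := 1) (b := -1)
    (k := fun x => 1 * f x + -1 * ∫ t in (0 : ℝ)..x, g t) ae_eq_rfl
  have hz : weakDeriv l (fun x => 1 * f x + -1 * ∫ t in (0 : ℝ)..x, g t)
      =ᵐ[edgeMeasure l] 0 := by
    filter_upwards [hl1.2, h1.2] with x e1 e2
    rw [e1, e2]
    simp [g]
  obtain ⟨c, hc⟩ := ae_eq_const_of_isWeakDeriv_zero hl hl1.1.1 (by
    intro φ p1 p2 p3
    rw [(weakDeriv_spec hl1.1.2).2 φ p1 p2 p3]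
    congr 1
    apply integral_congr_ae
    filter_upwards [hz] with x hx
    rw [hx])
  have hfe : f =ᵐ[edgeMeasure l] fun x => (∫ t in (0 : ℝ)..x, g t) + c := by
    filter_upwards [hc] with x hx
    linarith
  have hwc : AbsolutelyContinuousOnInterval (fun x => (∫ t in (0 : ℝ)..x, g t) + c) 0 l :=
    hw.fun_add (LipschitzWith.const c).lipschitzOnWith.absolutelyContinuousOnInterval
  have hcont : ContinuousOn (fun x => (∫ t in (0 : ℝ)..x, g t) + c) (Icc 0 l) :=
    hu ▸ hwc.continuousOn
  have heq := contRep_eqOn hl hcont hfe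
  refine ⟨⟨_, hcont, hfe⟩, hwc.congr (hu ▸ heq.symm), ?_⟩
  rw [EventuallyEq, ae_edgeMeasure_iff] at hd ⊢
  filter_upwards [hd] with x hx hx'
  rw [← hx hx']
  -- The two functions agree only on `[0, l]`; at interior points this is a neighbourhood, so the
  -- derivatives agree.
  have : _root_.contRep l f =ᶠ[𝓝 x] fun x => (∫ t in (0 : ℝ)..x, g t) + c := by
    filter_upwards [Ioo_mem_nhds hx'.1 hx'.2] with y hy
    exact heq (Ioo_subset_Icc_self hy)
  rw [this.deriv_eq, deriv_add_const]

theorem memH1_congr {l : ℝ} {f k : ℝ → ℝ} (hf : MemH1 l f) (h : k =ᵐ[edgeMeasure l] f) :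
    MemH1 l k ∧ weakDeriv l k =ᵐ[edgeMeasure l] weakDeriv l f := by
  simpa using memH1_lin hf hf (a := 1) (b := 0) (k := k) (by simpa using h)

theorem MemH1.contRep_ae {l : ℝ} (hl : 0 < l) {f : ℝ → ℝ} (hf : MemH1 l f) :
    f =ᵐ[edgeMeasure l] _root_.contRep l f := (contRep_spec (hf.contRep hl).1).2

theorem MemH1.continuousOn {l : ℝ} (hl : 0 < l) {f : ℝ → ℝ} (hf : MemH1 l f) :
    ContinuousOn (_root_.contRep l f) (Icc 0 l) := (contRep_spec (hf.contRep hl).1).1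

/-- Integration by parts. -/
theorem MemH1.integral_mul_weakDeriv {l : ℝ} (hl : 0 < l) {f g : ℝ → ℝ} (hf : MemH1 l f)
    (hg : MemH1 l g) :
    ∫ x, f x * weakDeriv l g x ∂(edgeMeasure l)
      = _root_.contRep l f l * _root_.contRep l g l - _root_.contRep l f 0 * _root_.contRep l g 0
        - ∫ x, weakDeriv l f x * g x ∂(edgeMeasure l) := by
  obtain ⟨-, f2, f3⟩ := hf.contRep hl
  obtain ⟨-, g2, g3⟩ := hg.contRep hl
  have h := f2.integral_mul_deriv_eq_deriv_mul g2
  rw [← integral_edgeMeasure hl, ← integral_edgeMeasure hl] at h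
  have e1 : ∫ x, f x * weakDeriv l g x ∂(edgeMeasure l)
      = ∫ x, _root_.contRep l f x * deriv (_root_.contRep l g) x ∂(edgeMeasure l) := by
    apply integral_congr_ae
    filter_upwards [hf.contRep_ae hl, g3] with x h1 h2
    rw [← h1, h2]
  have e2 : ∫ x, weakDeriv l f x * g x ∂(edgeMeasure l)
      = ∫ x, deriv (_root_.contRep l f) x * _root_.contRep l g x ∂(edgeMeasure l) := by
    apply integral_congr_ae
    filter_upwards [hg.contRep_ae hl, f3] with x h1 h2
    rw [← h1, h2]
  rw [e1, e2, h]

theorem AbsolutelyContinuousOnInterval.ae_differentiableAt_edge {l : ℝ} (hl : 0 < l) {w : ℝ → ℝ}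
    (hw : AbsolutelyContinuousOnInterval w 0 l) :
    ∀ᵐ x ∂(edgeMeasure l), DifferentiableAt ℝ w x := by
  rw [ae_edgeMeasure_iff]
  filter_upwards [hw.ae_differentiableAt] with x hx hx'
  exact hx (uIcc_of_le hl.le ▸ Ioo_subset_Icc_self hx')

theorem MemH1.memLp_deriv_contRep {l : ℝ} (hl : 0 < l) {f : ℝ → ℝ} (hf : MemH1 l f) :
    MemLp (deriv (_root_.contRep l f)) 2 (edgeMeasure l) :=
  (memLp_congr_ae (hf.contRep hl).2.2).2 (weakDeriv_spec hf.2).1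

/-- In the product rule each summand is an `L²` derivative times a continuous, hence bounded,
function. -/
theorem MemH1.mul {l : ℝ} (hl : 0 < l) {f g : ℝ → ℝ} (hf : MemH1 l f) (hg : MemH1 l g) :
    MemH1 l (fun x => f x * g x) := by
  obtain ⟨-, f2, f3⟩ := hf.contRep hl
  obtain ⟨-, g2, g3⟩ := hg.contRep hl
  have hm := ((hf.memLp_deriv_contRep hl).mul (r := 2) (hg.continuousOn hl).memLp_edgeMeasure).add
    ((hg.memLp_deriv_contRep hl).mul (r := 2) (hf.continuousOn hl).memLp_edgeMeasure)
  refine ((f2.fun_mul g2).memH1 hl hm ?_ ?_).1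
  · filter_upwards [f2.ae_differentiableAt_edge hl, g2.ae_differentiableAt_edge hl] with x h1 h2
    rw [deriv_fun_mul h1 h2]
    simp only [Pi.add_apply, Pi.mul_apply]
    ring
  · filter_upwards [hf.contRep_ae hl, hg.contRep_ae hl] with x h1 h2
    rw [h1, h2]

/-- The continuous representative has a positive minimum `m`, and inversion is Lipschitz with
constant `m⁻²` on `[m, ∞)`, so the composition remains absolutely continuous. -/
theorem MemH1.inv {l : ℝ} (hl : 0 < l) {f : ℝ → ℝ} (hf : MemH1 l f)
    (hpos : ∀ x ∈ Icc 0 l, 0 < _root_.contRep l f x) : MemH1 l (fun x => (f x)⁻¹) := by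
  obtain ⟨-, f2, f3⟩ := hf.contRep hl
  have hc := hf.continuousOn hl
  obtain ⟨x0, hx0, hmin⟩ := isCompact_Icc.exists_isMinOn (nonempty_Icc.2 hl.le) hc
  set m := _root_.contRep l f x0
  have hm : 0 < m := hpos x0 hx0
  have hu : uIcc 0 l = Icc 0 l := uIcc_of_le hl.le
  have hlip : LipschitzOnWith (Real.toNNReal (m ^ 2)⁻¹) (fun y : ℝ => y⁻¹) (Ici m) := by
    refine LipschitzOnWith.of_dist_le_mul fun x hx y hy => ?_
    have hx' : 0 < x := hm.trans_le hx
    have hy' : 0 < y := hm.trans_le hy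
    rw [Real.coe_toNNReal _ (by positivity), Real.dist_eq, Real.dist_eq, inv_sub_inv hx'.ne' hy'.ne',
      abs_div, abs_of_pos (mul_pos hx' hy'), abs_sub_comm, div_eq_inv_mul]
    gcongr
    rw [sq]
    exact mul_le_mul hx hy hm.le hx'.le
  have hac := hlip.comp_absolutelyContinuousOnInterval f2 (fun x hx => hmin (hu ▸ hx))
  have hcont : ContinuousOn (fun x => -(_root_.contRep l f x ^ 2)⁻¹) (Icc 0 l) :=
    ((hc.pow 2).inv₀ fun x hx => (pow_pos (hpos x hx) 2).ne').neg
  refine (hac.memH1 hl ((hf.memLp_deriv_contRep hl).mul (r := 2) hcont.memLp_edgeMeasure)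
    ?_ ?_).1
  · have := f2.ae_differentiableAt_edge hl
    rw [EventuallyEq, ae_edgeMeasure_iff] at *
    filter_upwards [this] with x h1 hx
    rw [deriv_fun_inv'' (h1 hx) (hpos x (Ioo_subset_Icc_self hx)).ne']
    simp only [Pi.mul_apply]
    ring
  · filter_upwards [hf.contRep_ae hl] with x h1
    rw [h1]

/-- At a zero of `w` the modulus has a minimum, so its derivative is zero, either truly or as the
default value of `deriv`; elsewhere the chain rule applies with a factor `±1`. -/
theorem abs_deriv_abs_le {w : ℝ → ℝ} {x : ℝ} (h : DifferentiableAt ℝ w x) :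
    |deriv (fun y => |w y|) x| ≤ |deriv w x| := by
  by_cases h0 : w x = 0
  · have : IsLocalMin (fun y => |w y|) x := Eventually.of_forall fun y => by simp [h0]
    rw [this.deriv_eq_zero, abs_zero]
    exact abs_nonneg _
  · have := (hasDerivAt_abs h0).comp x h.hasDerivAt
    have e : deriv (fun y => |w y|) x = (SignType.sign (w x) : ℝ) * deriv w x := this.deriv
    rw [e, abs_mul]
    refine mul_le_of_le_one_left (abs_nonneg _) ?_
    rcases lt_or_gt_of_ne h0 with h | h
    · simp [sign_neg h]
    · simp [sign_pos h]

/-- The edgewise ingredient of the Beurling-Deny criterion: taking moduli does not increase the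
energy and takes moduli of the boundary values. -/
theorem MemH1.abs {l : ℝ} (hl : 0 < l) {f : ℝ → ℝ} (hf : MemH1 l f) :
    MemH1 l (fun x => |f x|) ∧
      (∀ᵐ x ∂(edgeMeasure l), |weakDeriv l (fun x => |f x|) x| ≤ |weakDeriv l f x|) ∧
      EqOn (_root_.contRep l fun x => |f x|) (fun x => |_root_.contRep l f x|) (Icc 0 l) := by
  obtain ⟨-, f2, f3⟩ := hf.contRep hl
  have hac := (LipschitzWith.lipschitzOnWith (s := univ)
    (lipschitzWith_one_norm (E := ℝ))).comp_absolutelyContinuousOnInterval f2 (mapsTo_univ _ _)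
  simp only [Real.norm_eq_abs] at hac
  have hle : ∀ᵐ x ∂(edgeMeasure l),
      |deriv (fun y => |_root_.contRep l f y|) x| ≤ |deriv (_root_.contRep l f) x| := by
    filter_upwards [f2.ae_differentiableAt_edge hl] with x hx using abs_deriv_abs_le hx
  have hm : MemLp (deriv fun y => |_root_.contRep l f y|) 2 (edgeMeasure l) :=
    (hf.memLp_deriv_contRep hl).of_le (aestronglyMeasurable_deriv _ _) hle
  have hae : (fun x => |f x|) =ᵐ[edgeMeasure l] fun x => |_root_.contRep l f x| := by
    filter_upwards [hf.contRep_ae hl] with x h1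
    rw [h1]
  have h := hac.memH1 hl hm ae_eq_rfl hae
  refine ⟨h.1, ?_, contRep_eqOn hl (hf.continuousOn hl).abs hae⟩
  filter_upwards [h.2, hle, f3] with x h1 h2 h3
  rw [h1, ← h3]
  exact h2

/-! ### Integral estimates, the Sobolev embedding and limits of weak derivatives -/

theorem integrable_sq {l : ℝ} {g : ℝ → ℝ} (hg : MemLp g 2 (edgeMeasure l)) :
    Integrable (fun x => g x ^ 2) (edgeMeasure l) := hg.integrable_sq

/-- Cauchy-Schwarz, obtained by expanding the nonnegative integral of `(|g| - I / l)²`, where `I /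
l` is the mean of `|g|`. -/
theorem sq_integral_abs_le {l : ℝ} (hl : 0 < l) {g : ℝ → ℝ} (hg : MemLp g 2 (edgeMeasure l)) :
    (∫ x, |g x| ∂(edgeMeasure l)) ^ 2 ≤ l * ∫ x, g x ^ 2 ∂(edgeMeasure l) := by
  set I := ∫ x, |g x| ∂(edgeMeasure l) with hI
  have h1 : Integrable (fun x => |g x|) (edgeMeasure l) := (hg.integrable (by norm_num)).abs
  have h0 : 0 ≤ ∫ x, (|g x| - I / l) ^ 2 ∂(edgeMeasure l) :=
    integral_nonneg fun x => sq_nonneg _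
  have e : ∀ x, (|g x| - I / l) ^ 2 = g x ^ 2 - 2 * (I / l) * |g x| + (I / l) ^ 2 := by
    intro x
    rw [← sq_abs (g x)]
    ring
  simp_rw [e] at h0
  have h2 := integrable_sq hg
  have h3 := h1.const_mul (2 * (I / l))
  rw [integral_add (f := fun x => g x ^ 2 - 2 * (I / l) * |g x|) (h2.sub h3)
    (integrable_const _), integral_sub h2 h3, integral_const_mul, ← hI] at h0
  have hv : (edgeMeasure l).real univ = l := by
    simp [edgeMeasure, Measure.real, hl.le]
  rw [integral_const, hv, smul_eq_mul] at h0
  have : l * (∫ x, g x ^ 2 ∂(edgeMeasure l) - 2 * (I / l) * I + l * (I / l) ^ 2)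
      = l * ∫ x, g x ^ 2 ∂(edgeMeasure l) - I ^ 2 := by
    field_simp
    ring
  nlinarith [mul_nonneg hl.le h0]

/-- The Sobolev embedding `H¹ ⊆ C[0, l]`. -/
theorem MemH1.sq_contRep_le {l : ℝ} (hl : 0 < l) {f : ℝ → ℝ} (hf : MemH1 l f) {x : ℝ}
    (hx : x ∈ Icc 0 l) :
    _root_.contRep l f x ^ 2 ≤ 2 * l⁻¹ * ∫ x, f x ^ 2 ∂(edgeMeasure l)
      + 2 * l * ∫ x, weakDeriv l f x ^ 2 ∂(edgeMeasure l) := by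
  obtain ⟨-, f2, f3⟩ := hf.contRep hl
  have hu : uIcc 0 l = Icc 0 l := uIcc_of_le hl.le
  have hD := (weakDeriv_spec hf.2).1
  set w := _root_.contRep l f
  set I := ∫ x, |f x| ∂(edgeMeasure l)
  set J := ∫ x, |weakDeriv l f x| ∂(edgeMeasure l) with hJ
  have hint : IntervalIntegrable (fun t => |deriv w t|) volume 0 l :=
    f2.intervalIntegrable_deriv.abs
  have hJ' : J = ∫ t in (0 : ℝ)..l, |deriv w t| := by
    rw [hJ, ← integral_edgeMeasure hl]
    apply integral_congr_ae
    filter_upwards [f3] with t ht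
    rw [ht]
  -- By the fundamental theorem of calculus the oscillation of `w` is at most the `L¹` norm of its
  -- derivative.
  have key : ∀ y ∈ Icc 0 l, |w x| ≤ |w y| + J := by
    intro y hy
    have h1 := (f2.mono (c := y) (d := x)
      (uIcc_subset_uIcc (hu ▸ hy) (hu ▸ hx))).integral_deriv_eq_sub
    have h2 : |w x - w y| ≤ J := by
      rw [← h1, hJ', intervalIntegral.integral_of_le hl.le]
      refine (intervalIntegral.norm_integral_le_integral_norm_uIoc (f := deriv w)
        (μ := volume)).trans ?_
      refine setIntegral_mono_set hint.1 (Eventually.of_forall fun t => abs_nonneg _) ?_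
      refine LE.le.eventuallyLE fun t ht => ?_
      rw [mem_uIoc] at ht
      rcases ht with ht | ht
      · exact ⟨hy.1.trans_lt ht.1, ht.2.trans hx.2⟩
      · exact ⟨hx.1.trans_lt ht.1, ht.2.trans hy.2⟩
    have := abs_sub_abs_le_abs_sub (w x) (w y)
    linarith
  have hv : (edgeMeasure l).real univ = l := by
    simp [edgeMeasure, Measure.real, hl.le]
  -- Integrating the previous bound over `y` replaces the unknown value `|w y|` by the `L¹` norm of
  -- `f`.
  have h3 : l * |w x| ≤ I + l * J := by
    have hi : Integrable (fun x => |f x|) (edgeMeasure l) :=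
      (hf.1.integrable (by norm_num)).abs
    have := integral_mono_ae (μ := edgeMeasure l) (f := fun _ => |w x|)
      (g := fun y => |f y| + J) (integrable_const _) (hi.add (integrable_const _)) (by
        have h4 := hf.contRep_ae hl
        rw [EventuallyEq, ae_edgeMeasure_iff] at h4
        rw [EventuallyLE, ae_edgeMeasure_iff]
        filter_upwards [h4] with y hy hy'
        rw [hy hy']
        exact key y (Ioo_subset_Icc_self hy'))
    rw [integral_add hi (integrable_const _)] at this
    simpa [hv] using this
  have h4 : |w x| ≤ l⁻¹ * I + J := by
    rw [← mul_le_mul_iff_right₀ hl, mul_add, mul_inv_cancel_left₀ hl.ne']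
    exact h3
  have hI2 := sq_integral_abs_le hl hf.1
  have hJ2 := sq_integral_abs_le hl hD
  have h5 : w x ^ 2 ≤ (l⁻¹ * I + J) ^ 2 := by
    rw [← sq_abs]
    gcongr
  have h6 : l⁻¹ ^ 2 * I ^ 2 ≤ l⁻¹ * ∫ x, f x ^ 2 ∂(edgeMeasure l) := by
    calc l⁻¹ ^ 2 * I ^ 2 ≤ l⁻¹ ^ 2 * (l * ∫ x, f x ^ 2 ∂(edgeMeasure l)) := by gcongr
      _ = _ := by field_simp
  nlinarith [sq_nonneg (l⁻¹ * I - J)]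

theorem Lp_inner_eq {l : ℝ} (f g : Lp ℝ 2 (edgeMeasure l)) :
    inner ℝ f g = ∫ x, f x * g x ∂(edgeMeasure l) := by
  rw [L2.inner_def]
  congr 1
  funext x
  simp [mul_comm]

/-- Weak derivatives pass to the limit in `L²`. -/
theorem isWeakDeriv_of_tendsto {l : ℝ} {F G : ℕ → Lp ℝ 2 (edgeMeasure l)}
    {f g : Lp ℝ 2 (edgeMeasure l)} (hF : Tendsto F atTop (𝓝 f)) (hG : Tendsto G atTop (𝓝 g))
    (h : ∀ n, IsWeakDeriv l (F n) (G n)) : IsWeakDeriv l f g := by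
  intro φ h1 h2 h3
  have hφ' : MemLp (deriv φ) 2 (edgeMeasure l) :=
    (h1.continuous_deriv (by simp)).memLp_of_hasCompactSupport h2.deriv
  have hφ : MemLp φ 2 (edgeMeasure l) := h1.continuous.memLp_of_hasCompactSupport h2
  -- Each side of the defining identity is an `L²` inner product with a fixed function, hence
  -- continuous in the other factor.
  have e : ∀ (k : Lp ℝ 2 (edgeMeasure l)) {q : ℝ → ℝ} (hq : MemLp q 2 (edgeMeasure l)),
      ∫ x, k x * q x ∂(edgeMeasure l) = inner ℝ k (hq.toLp q) := by
    intro k q hq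
    rw [Lp_inner_eq]
    apply integral_congr_ae
    filter_upwards [hq.coeFn_toLp] with x hx
    rw [hx]
  have t1 : Tendsto (fun n => inner ℝ (F n) (hφ'.toLp (deriv φ))) atTop
      (𝓝 (inner ℝ f (hφ'.toLp (deriv φ)))) := hF.inner tendsto_const_nhds
  have t2 : Tendsto (fun n => inner ℝ (G n) (hφ.toLp φ)) atTop
      (𝓝 (inner ℝ g (hφ.toLp φ))) := hG.inner tendsto_const_nhds
  rw [e f hφ', e g hφ]
  refine tendsto_nhds_unique t1 ?_
  convert t2.neg using 2 with n
  rw [← e _ hφ', ← e _ hφ]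
  exact h n φ h1 h2 h3

theorem testFunction_memH1 {l : ℝ} (hl : 0 < l) {φ : ℝ → ℝ} (h1 : ContDiff ℝ ∞ φ)
    (h2 : HasCompactSupport φ) (h3 : tsupport φ ⊆ Ioo 0 l) :
    MemH1 l φ ∧ weakDeriv l φ =ᵐ[edgeMeasure l] deriv φ ∧ EqOn (contRep l φ) φ (Icc 0 l) ∧
      φ 0 = 0 ∧ φ l = 0 := by
  have hφ : AbsolutelyContinuousOnInterval φ 0 l :=
    ((h1.of_le (by simp)).contDiffOn (s := uIcc 0 l)).absolutelyContinuousOnInterval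
  have h := hφ.memH1 hl ((h1.continuous_deriv (by simp)).memLp_of_hasCompactSupport h2.deriv)
    ae_eq_rfl (f := φ) ae_eq_rfl
  exact ⟨h.1, h.2, contRep_eqOn hl h1.continuous.continuousOn ae_eq_rfl,
    image_eq_zero_of_notMem_tsupport fun h => (h3 h).1.false,
    image_eq_zero_of_notMem_tsupport fun h => (h3 h).2.false⟩

theorem affine_memH1 {l : ℝ} (hl : 0 < l) (a b : ℝ) :
    MemH1 l (fun x => a + b * x) ∧ EqOn (contRep l fun x => a + b * x) (fun x => a + b * x)
      (Icc 0 l) := by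
  have hs : ContDiff ℝ 1 fun x : ℝ => a + b * x := by fun_prop
  have hd : (deriv fun x : ℝ => a + b * x) = fun _ => b := by
    funext x
    simp
  have hac : AbsolutelyContinuousOnInterval (fun x : ℝ => a + b * x) 0 l :=
    (hs.contDiffOn (s := uIcc 0 l)).absolutelyContinuousOnInterval
  exact ⟨(hac.memH1 hl (g := fun _ => b) (memLp_const b) (by rw [hd]) ae_eq_rfl).1,
    contRep_eqOn hl hs.continuous.continuousOn ae_eq_rfl⟩

theorem Lp_norm_sq {l : ℝ} (f : Lp ℝ 2 (edgeMeasure l)) :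
    ‖f‖ ^ 2 = ∫ x, f x ^ 2 ∂(edgeMeasure l) := by
  rw [← real_inner_self_eq_norm_sq, Lp_inner_eq]
  congr 1
  funext x
  ring

/-! ### Matrices with nonnegative off-diagonal entries -/

section Matrix

variable {V : Type*} [Fintype V] {M : Matrix V V ℝ}

theorem mulVec_dotProduct_eq (x : V → ℝ) :
    (M *ᵥ x) ⬝ᵥ x = ∑ i, ∑ k, M i k * (x i * x k) := by
  simp only [Matrix.mulVec, dotProduct, Finset.sum_mul]
  exact Finset.sum_congr rfl fun i _ => Finset.sum_congr rfl fun k _ => by ring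

/-- Off the diagonal `x i * x k ≤ (x i ^ 2 + x k ^ 2) / 2`, with equality on it. By symmetry the
resulting sum is `∑ i, (∑ k, M i k) * x i ^ 2`, and the row sums are negative. -/
theorem mulVec_dotProduct_nonpos (hs : M.IsSymm) (ho : ∀ i k, i ≠ k → 0 ≤ M i k)
    (hr : ∀ i, ∑ k, M i k < 0) (x : V → ℝ) : (M *ᵥ x) ⬝ᵥ x ≤ 0 := by
  rw [mulVec_dotProduct_eq]
  have h1 : ∑ i, ∑ k, M i k * (x i * x k)
      ≤ ∑ i, ∑ k, M i k * (x i ^ 2 / 2 + x k ^ 2 / 2) := by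
    refine Finset.sum_le_sum fun i _ => Finset.sum_le_sum fun k _ => ?_
    rcases eq_or_ne i k with rfl | h
    · exact le_of_eq (by ring)
    · exact mul_le_mul_of_nonneg_left (by nlinarith [sq_nonneg (x i - x k)]) (ho i k h)
  have h2 : ∑ i, ∑ k, M i k * (x k ^ 2 / 2) = ∑ i, ∑ k, M i k * (x i ^ 2 / 2) := by
    rw [Finset.sum_comm]
    exact Finset.sum_congr rfl fun i _ => Finset.sum_congr rfl fun k _ => by rw [hs.apply]
  have h3 : ∑ i, ∑ k, M i k * (x i ^ 2 / 2 + x k ^ 2 / 2) = ∑ i, (∑ k, M i k) * x i ^ 2 := by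
    simp only [mul_add, Finset.sum_add_distrib]
    rw [h2, ← Finset.sum_add_distrib]
    refine Finset.sum_congr rfl fun i _ => ?_
    rw [← Finset.sum_mul]
    ring
  rw [h3] at h1
  exact h1.trans (Finset.sum_nonpos fun i _ =>
    mul_nonpos_of_nonpos_of_nonneg (hr i).le (sq_nonneg _))

/-- The vertex ingredient of the Beurling-Deny criterion. Diagonal terms are unchanged by taking
moduli, and the others can only grow. -/
theorem mulVec_dotProduct_le_abs (ho : ∀ i k, i ≠ k → 0 ≤ M i k) (x : V → ℝ) :
    (M *ᵥ x) ⬝ᵥ x ≤ (M *ᵥ fun i => |x i|) ⬝ᵥ fun i => |x i| := by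
  rw [mulVec_dotProduct_eq, mulVec_dotProduct_eq]
  refine Finset.sum_le_sum fun i _ => Finset.sum_le_sum fun k _ => ?_
  rcases eq_or_ne i k with rfl | h
  · rw [abs_mul_abs_self]
  · exact mul_le_mul_of_nonneg_left ((le_abs_self _).trans_eq (abs_mul _ _)) (ho i k h)

end Matrix

/-! ### Vertex values and the construction of elements of the form domain -/

namespace MetricGraph

variable {V E : Type*}

theorem coord_src (G : MetricGraph V E) (e : E) : G.coord e (G.src e) = 0 := if_pos rfl

theorem coord_tgt (G : MetricGraph V E) (e : E) : G.coord e (G.tgt e) = G.len e :=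
  if_neg (G.no_loops e)

theorem outward_src (G : MetricGraph V E) (e : E) : G.outward e (G.src e) = 1 := if_pos rfl

theorem outward_tgt (G : MetricGraph V E) (e : E) : G.outward e (G.tgt e) = -1 :=
  if_neg (G.no_loops e)

theorem L_eq_valueAt (G : MetricGraph V E) {u : G.E2} (hu : G.IsContinuous u) {e : E} {v : V}
    (h : G.Incident e v) : G.L u v = G.valueAt u e v :=
  hu.2 v _ e (G.no_isolated_vertices v).choose_spec h

theorem contRep_zero_eq (G : MetricGraph V E) {u : G.E2} (hu : G.IsContinuous u) (e : E) :
    contRep (G.len e) (u e) 0 = G.L u (G.src e) := by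
  rw [G.L_eq_valueAt hu (Or.inl rfl), valueAt, coord_src]

theorem contRep_len_eq (G : MetricGraph V E) {u : G.E2} (hu : G.IsContinuous u) (e : E) :
    contRep (G.len e) (u e) (G.len e) = G.L u (G.tgt e) := by
  rw [G.L_eq_valueAt hu (Or.inr rfl), valueAt, coord_tgt]

open Classical in
-- Each edge is incident to exactly its two endpoints, which are distinct as there are no loops.
-- This regroups the sums over vertices in `C u` by edges.
theorem sum_incident (G : MetricGraph V E) [Fintype V] [Fintype E] (F : E → V → ℝ) :
    ∑ v, ∑ e with G.Incident e v, F e v = ∑ e, (F e (G.src e) + F e (G.tgt e)) := by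
  simp only [Finset.sum_filter]
  rw [Finset.sum_comm]
  refine Finset.sum_congr rfl fun e _ => ?_
  rw [← Finset.sum_filter, ← Finset.sum_pair (G.no_loops e)]
  congr 1
  ext v
  simp [Incident, eq_comm]

theorem mem_of_valueAt (G : MetricGraph V E) {u : G.E2} {y : V → ℝ}
    (hu : ∀ e, HasContRep (G.len e) (u e))
    (h0 : ∀ e, contRep (G.len e) (u e) 0 = y (G.src e))
    (h1 : ∀ e, contRep (G.len e) (u e) (G.len e) = y (G.tgt e)) :
    G.IsContinuous u ∧ G.L u = y := by
  have key : ∀ v e, G.Incident e v → G.valueAt u e v = y v := by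
    rintro v e (rfl | rfl)
    · rw [valueAt, coord_src, h0]
    · rw [valueAt, coord_tgt, h1]
  refine ⟨⟨hu, fun v e e' h h' => by rw [key v e h, key v e' h']⟩, ?_⟩
  funext v
  exact key v _ (G.no_isolated_vertices v).choose_spec

namespace Coefficients

variable {G : MetricGraph V E} [Fintype V]

/-- The common way to build elements of the form domain: `H¹` functions on the edges whose endpoint
values come from one vector `y` on the vertices. It serves for test functions, affine interpolants
and moduli. -/
theorem exists_mem_formDomain (K : G.Coefficients) {w : E → ℝ → ℝ} {y : V → ℝ}
    (hw : ∀ e, MemH1 (G.len e) (w e))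
    (h0 : ∀ e, contRep (G.len e) (w e) 0 = y (G.src e))
    (h1 : ∀ e, contRep (G.len e) (w e) (G.len e) = y (G.tgt e)) :
    ∃ u ∈ K.formDomain, (∀ e, u e =ᵐ[edgeMeasure (G.len e)] w e) ∧ G.L u = y := by
  let u : G.E2 := WithLp.toLp 2 fun e => (hw e).1.toLp (w e)
  have hu : ∀ e, u e =ᵐ[edgeMeasure (G.len e)] w e := fun e => (hw e).1.coeFn_toLp
  have hc : ∀ e, EqOn (contRep (G.len e) (u e)) (contRep (G.len e) (w e)) (Icc 0 (G.len e)) :=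
    fun e => contRep_eqOn (G.len_pos e) ((hw e).continuousOn (G.len_pos e))
      ((hu e).trans ((hw e).contRep_ae (G.len_pos e)))
  have hm := fun e => (memH1_congr (hw e) (hu e)).1
  have := G.mem_of_valueAt (u := u) (y := y) (fun e => ((hm e).contRep (G.len_pos e)).1)
    (fun e => (hc e (left_mem_Icc.2 (G.len_pos e).le)).trans (h0 e))
    (fun e => (hc e (right_mem_Icc.2 (G.len_pos e).le)).trans (h1 e))
  exact ⟨u, ⟨hm, this.1⟩, hu, this.2⟩

/-- A test function on one edge, extended by zero, belongs to the form domain. -/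
theorem exists_testFunction_mem_formDomain (K : G.Coefficients) (e : E) {φ : ℝ → ℝ}
    (h1 : ContDiff ℝ ∞ φ) (h2 : HasCompactSupport φ) (h3 : tsupport φ ⊆ Ioo 0 (G.len e)) :
    ∃ u ∈ K.formDomain, u e =ᵐ[edgeMeasure (G.len e)] φ ∧
      (∀ e', e' ≠ e → u e' =ᵐ[edgeMeasure (G.len e')] 0) ∧ G.L u = 0 := by
  classical
  obtain ⟨t1, -, t3, t4, t5⟩ := testFunction_memH1 (G.len_pos e) h1 h2 h3
  have key : ∀ e', MemH1 (G.len e') ((Pi.single e φ : E → ℝ → ℝ) e') ∧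
      contRep (G.len e') ((Pi.single e φ : E → ℝ → ℝ) e') 0 = 0 ∧
      contRep (G.len e') ((Pi.single e φ : E → ℝ → ℝ) e') (G.len e') = 0 := by
    intro e'
    have a0 := left_mem_Icc.2 (G.len_pos e').le
    have a1 := right_mem_Icc.2 (G.len_pos e').le
    rcases eq_or_ne e' e with rfl | h
    · rw [Pi.single_eq_same, t3 a0, t3 a1]
      exact ⟨t1, t4, t5⟩
    · rw [Pi.single_eq_of_ne h]
      have z := (contRep_zero (G.len_pos e') (f := 0) ae_eq_rfl).2
      exact ⟨(memH1_zero _ ae_eq_rfl).1, z a0, z a1⟩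
  obtain ⟨u, u1, u2, u3⟩ := K.exists_mem_formDomain (y := 0) (fun e' => (key e').1)
    (fun e' => (key e').2.1) (fun e' => (key e').2.2)
  refine ⟨u, u1, ?_, fun e' h => ?_, u3⟩
  · simpa using u2 e
  · simpa [Pi.single_eq_of_ne h] using u2 e'

/-- Affine interpolation along each edge realises any vertex values. This surjectivity of `L` is
what extracts the vertex condition from the form. -/
theorem exists_mem_formDomain_L_eq (K : G.Coefficients) (y : V → ℝ) :
    ∃ u ∈ K.formDomain, G.L u = y := by
  have h := fun e => affine_memH1 (G.len_pos e) (y (G.src e))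
    ((y (G.tgt e) - y (G.src e)) / G.len e)
  obtain ⟨u, u1, -, u3⟩ := K.exists_mem_formDomain (y := y) (fun e => (h e).1)
    (fun e => by rw [(h e).2 (left_mem_Icc.2 (G.len_pos e).le)]; ring)
    (fun e => by
      rw [(h e).2 (right_mem_Icc.2 (G.len_pos e).le)]
      simp only
      rw [div_mul_cancel₀ _ (G.len_pos e).ne']
      ring)
  exact ⟨u, u1, u3⟩

theorem integral_c_nonneg (K : G.Coefficients) (e : E) (g : ℝ → ℝ) :
    0 ≤ ∫ x, K.c e x * g x * g x ∂(edgeMeasure (G.len e)) := by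
  apply integral_nonneg_of_ae
  rw [EventuallyLE, ae_edgeMeasure_iff]
  filter_upwards with x hx
  simp only [Pi.zero_apply, mul_assoc]
  exact mul_nonneg (K.c_pos e x (Ioo_subset_Icc_self hx)).le (mul_self_nonneg _)

theorem integral_p_nonneg (K : G.Coefficients) (e : E) (g : ℝ → ℝ) :
    0 ≤ ∫ x, K.p e x * g x * g x ∂(edgeMeasure (G.len e)) := by
  apply integral_nonneg_of_ae
  filter_upwards [K.p_nonneg e] with x hx
  simp only [Pi.zero_apply, mul_assoc]
  exact mul_nonneg hx (mul_self_nonneg _)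

theorem memLp_flux (K : G.Coefficients) {u : G.E2} {e : E} (hu : MemH1 (G.len e) (u e)) :
    MemLp (K.flux u e) 2 (edgeMeasure (G.len e)) :=
  (weakDeriv_spec hu.2).1.mul (r := 2) (K.bdd_c e)

theorem contRep_flux (K : G.Coefficients) {u : G.E2} {e : E}
    (hc : HasContRep (G.len e) (weakDeriv (G.len e) (u e))) :
    EqOn (contRep (G.len e) (K.flux u e))
      (fun x => K.c e x * contRep (G.len e) (weakDeriv (G.len e) (u e)) x)
      (Icc 0 (G.len e)) := by
  obtain ⟨h1, h2⟩ := contRep_spec hc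
  refine contRep_eqOn (G.len_pos e) ((K.c_cont e).mul h1) ?_
  filter_upwards [h2] with x hx
  rw [flux, hx]

/-- The derivative is the continuous flux divided by the positive continuous conductance; hence the
continuity of `uₑ'` demanded in `InOpDomain` is automatic. -/
theorem hasContRep_weakDeriv (K : G.Coefficients) {u : G.E2} {e : E}
    (hf : MemH1 (G.len e) (K.flux u e)) :
    HasContRep (G.len e) (weakDeriv (G.len e) (u e)) := by
  refine ⟨fun x => contRep (G.len e) (K.flux u e) x / K.c e x,
    (hf.continuousOn (G.len_pos e)).div (K.c_cont e) fun x hx => (K.c_pos e x hx).ne', ?_⟩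
  have h := hf.contRep_ae (G.len_pos e)
  rw [EventuallyEq, ae_edgeMeasure_iff] at h ⊢
  filter_upwards [h] with x hx hx'
  rw [← hx hx', flux, mul_div_cancel_left₀ _ (K.c_pos e x (Ioo_subset_Icc_self hx')).ne']

variable [Fintype E]

/-- Test functions on a single edge already detect `h` there. This yields both the density of the
form domain and the uniqueness of the representing element. -/
theorem eq_zero_of_inner_formDomain (K : G.Coefficients) {h : G.E2}
    (H : ∀ u ∈ K.formDomain, inner ℝ u h = 0) : h = 0 := by
  ext1 e
  apply Lp.ext
  refine EventuallyEq.trans ?_ (Lp.coeFn_zero ℝ 2 _).symm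
  have hi : Integrable (h e) (edgeMeasure (G.len e)) := (Lp.memLp (h e)).integrable (by norm_num)
  have := isOpen_Ioo.ae_eq_zero_of_integral_contDiff_smul_eq_zero (U := Ioo (0 : ℝ) (G.len e))
    (μ := volume) (f := h e) (IntegrableOn.locallyIntegrableOn hi) (by
      intro φ h1 h2 h3
      obtain ⟨u, u1, u2, u3, -⟩ := K.exists_testFunction_mem_formDomain e h1 h2 h3
      have e1 := H u u1
      rw [PiLp.inner_apply, Finset.sum_eq_single e (fun e' _ he' => by
          rw [Lp_inner_eq]
          apply integral_eq_zero_of_ae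
          filter_upwards [u3 e' he'] with x hx
          simp [hx]) (fun h => absurd (Finset.mem_univ _) h), Lp_inner_eq] at e1
      rw [← e1, ← setIntegral_eq_integral_of_forall_compl_eq_zero (s := Ioo 0 (G.len e))]
      · apply integral_congr_ae
        filter_upwards [u2] with x hx
        rw [hx, smul_eq_mul]
      · intro x hx
        simp [image_eq_zero_of_notMem_tsupport fun hx' => hx (h3 hx')])
  exact ae_edgeMeasure_iff.2 this

theorem form_isDenselyDefined (K : G.Coefficients) : K.form.IsDenselyDefined := by
  change Dense (K.formDomain : Set G.E2)
  rw [Submodule.dense_iff_topologicalClosure_eq_top, Submodule.topologicalClosure_eq_top_iff,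
    Submodule.eq_bot_iff]
  intro h hh
  exact K.eq_zero_of_inner_formDomain fun u hu => (Submodule.mem_orthogonal _ _).1 hh u hu

theorem form_isSymmetric (K : G.Coefficients) : K.form.IsSymmetric := fun u v =>
  K.formValue_symm u v

theorem integral_c_le_formValue (K : G.Coefficients) (u : G.E2) (e : E) :
    ∫ x, K.c e x * weakDeriv (G.len e) (u e) x * weakDeriv (G.len e) (u e) x
      ∂(edgeMeasure (G.len e)) ≤ K.formValue u u := by
  have h1 := Finset.single_le_sum (f := fun e => ∫ x, K.c e x * weakDeriv (G.len e) (u e) x *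
    weakDeriv (G.len e) (u e) x ∂(edgeMeasure (G.len e)))
    (fun e _ => K.integral_c_nonneg e _) (Finset.mem_univ e)
  have h2 := Finset.sum_nonneg (s := Finset.univ)
    fun e (_ : e ∈ Finset.univ) => K.integral_p_nonneg e (u e)
  have h3 := mulVec_dotProduct_nonpos K.M_symm K.M_offdiag K.M_row (G.L u)
  unfold formValue
  linarith

theorem formValue_self_nonneg (K : G.Coefficients) (u : G.E2) : 0 ≤ K.formValue u u := by
  have h1 := Finset.sum_nonneg (s := Finset.univ)
    fun e (_ : e ∈ Finset.univ) => K.integral_c_nonneg e (weakDeriv (G.len e) (u e))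
  have h2 := Finset.sum_nonneg (s := Finset.univ)
    fun e (_ : e ∈ Finset.univ) => K.integral_p_nonneg e (u e)
  have h3 := mulVec_dotProduct_nonpos K.M_symm K.M_offdiag K.M_row (G.L u)
  unfold formValue
  linarith

theorem form_isAccretive (K : G.Coefficients) : K.form.IsAccretive := fun u =>
  K.formValue_self_nonneg u

/-! ### Green's formula -/

/-- Integration by parts of flux against `v` on every edge. The endpoint terms, regrouped by
vertices, form `-⟨C u, L v⟩`, the signs being those of `outward`. The vertex condition is not
assumed, so that the formula can also be used to derive it. -/
theorem formValue_eq (K : G.Coefficients) {u v : G.E2}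
    (hf : ∀ e, MemH1 (G.len e) (K.flux u e)) (hv : v ∈ K.formDomain) :
    K.formValue u v = -∑ e, ∫ x, K.opFun u e x * v e x ∂(edgeMeasure (G.len e))
      - (K.M *ᵥ G.L u + K.C u) ⬝ᵥ G.L v := by
  classical
  have hd := fun e => K.hasContRep_weakDeriv (hf e)
  have h1 : ∀ e, ∫ x, K.c e x * weakDeriv (G.len e) (u e) x * weakDeriv (G.len e) (v e) x
        ∂(edgeMeasure (G.len e))
      = K.c e (G.len e) * contRep (G.len e) (weakDeriv (G.len e) (u e)) (G.len e)
          * G.L v (G.tgt e)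
        - K.c e 0 * contRep (G.len e) (weakDeriv (G.len e) (u e)) 0 * G.L v (G.src e)
        - ∫ x, weakDeriv (G.len e) (K.flux u e) x * v e x ∂(edgeMeasure (G.len e)) := by
    intro e
    have := (hf e).integral_mul_weakDeriv (G.len_pos e) (hv.1 e)
    rw [K.contRep_flux (hd e) (right_mem_Icc.2 (G.len_pos e).le),
      K.contRep_flux (hd e) (left_mem_Icc.2 (G.len_pos e).le), G.contRep_zero_eq hv.2,
      G.contRep_len_eq hv.2] at this
    exact this
  have h2 : ∀ e, ∫ x, K.opFun u e x * v e x ∂(edgeMeasure (G.len e))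
      = ∫ x, weakDeriv (G.len e) (K.flux u e) x * v e x ∂(edgeMeasure (G.len e))
        - ∫ x, K.p e x * u e x * v e x ∂(edgeMeasure (G.len e)) := by
    intro e
    have i1 : Integrable (fun x => weakDeriv (G.len e) (K.flux u e) x * v e x)
        (edgeMeasure (G.len e)) :=
      (weakDeriv_spec (hf e).2).1.integrable_mul (Lp.memLp (v e))
    rw [← integral_sub i1 (integrable_triple (K.p_mem e) (Lp.memLp (u e)) (Lp.memLp (v e)))]
    congr 1
    funext x
    simp only [opFun]
    ring
  have h3 : K.C u ⬝ᵥ G.L v = ∑ e,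
      (K.c e 0 * contRep (G.len e) (weakDeriv (G.len e) (u e)) 0 * G.L v (G.src e)
        - K.c e (G.len e) * contRep (G.len e) (weakDeriv (G.len e) (u e)) (G.len e)
          * G.L v (G.tgt e)) := by
    simp only [dotProduct, C, Finset.sum_mul]
    refine (G.sum_incident fun e z => K.c e (G.coord e z) * (G.outward e z *
      contRep (G.len e) (weakDeriv (G.len e) (u e)) (G.coord e z)) * G.L v z).trans ?_
    refine Finset.sum_congr rfl fun e _ => ?_
    rw [G.coord_src, G.coord_tgt, G.outward_src, G.outward_tgt]
    ring
  unfold formValue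
  rw [add_dotProduct, h3]
  simp only [h1, h2, Finset.sum_sub_distrib]
  ring

end Coefficients

end MetricGraph

/-! ### Regularity of the operator domain and the operator associated with the form -/

namespace MetricGraph

variable {V E : Type*}

theorem norm_sq_eq (G : MetricGraph V E) [Fintype E] (u : G.E2) :
    ‖u‖ ^ 2 = ∑ e, ∫ x, u e x ^ 2 ∂(edgeMeasure (G.len e)) := by
  rw [PiLp.norm_sq_eq_of_L2]
  exact Finset.sum_congr rfl fun e _ => Lp_norm_sq _

theorem coe_sub_ae (G : MetricGraph V E) (u w : G.E2) (e : E) :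
    ((u - w : G.E2) e : ℝ → ℝ) =ᵐ[edgeMeasure (G.len e)] fun x => 1 * u e x + -1 * w e x := by
  simpa [sub_eq_add_neg] using G.lin_coe u w 1 (-1) e

namespace Coefficients

variable {G : MetricGraph V E} [Fintype V]

theorem exists_pos_le_c (K : G.Coefficients) (e : E) :
    ∃ m, 0 < m ∧ ∀ x ∈ Icc 0 (G.len e), m ≤ K.c e x := by
  obtain ⟨x, hx, h⟩ := isCompact_Icc.exists_isMinOn (nonempty_Icc.2 (G.len_pos e).le)
    (K.c_cont e)
  exact ⟨_, K.c_pos e x hx, h⟩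

variable [Fintype E]

/-- Functions in `D(A₂)` have `H²` regularity if the conductances are in `H¹`. -/
theorem inOpDomain_iff_of_memH1 (K : G.Coefficients) (hc : ∀ e, MemH1 (G.len e) (K.c e))
    (u : G.E2) : K.InOpDomain u ↔
      (∀ e, MemH2 (G.len e) (u e)) ∧ G.IsContinuous u ∧ K.M *ᵥ G.L u + K.C u = 0 := by
  constructor
  · rintro ⟨h1, h2, -, h4⟩
    refine ⟨fun e => ⟨(h1 e).1, ?_⟩, h2, h4⟩
    have heq := contRep_eqOn (G.len_pos e) (K.c_cont e) ae_eq_rfl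
    have hi := (hc e).inv (G.len_pos e) fun x hx => by
      rw [heq hx]
      exact K.c_pos e x hx
    -- The derivative equals `c⁻¹` times the flux, a product of two `H¹` functions.
    refine (memH1_congr (MemH1.mul (G.len_pos e) hi (h1 e).2) ?_).1
    rw [EventuallyEq, ae_edgeMeasure_iff]
    filter_upwards with x hx
    rw [flux, inv_mul_cancel_left₀ (K.c_pos e x (Ioo_subset_Icc_self hx)).ne']
  · rintro ⟨h1, h2, h4⟩
    exact ⟨fun e => ⟨(h1 e).1, MemH1.mul (G.len_pos e) (hc e) (h1 e).2⟩, h2,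
      fun e => ((h1 e).2.contRep (G.len_pos e)).1, h4⟩

theorem formValue_eq_inner (K : G.Coefficients) (u : K.opDomain) {v : G.E2}
    (hv : v ∈ K.formDomain) : K.formValue u v = inner ℝ (-K.opValue u) v := by
  rw [K.formValue_eq (fun e => (u.2.1 e).2) hv, u.2.2.2.2, zero_dotProduct, sub_zero,
    inner_neg_left, PiLp.inner_apply]
  congr 1
  refine Finset.sum_congr rfl fun e _ => ?_
  rw [Lp_inner_eq]
  apply integral_congr_ae
  filter_upwards [K.opValue_coe u e] with x hx
  rw [hx]

theorem opDomain_le (K : G.Coefficients) {u : G.E2} (hu : K.InOpDomain u) : u ∈ K.formDomain :=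
  ⟨fun e => (hu.1 e).1, hu.2.1⟩

/-- Test functions on one edge have zero vertex values, so the equation says that the flux has weak
derivative `p u - h ∈ L²`. Green's formula then applies, its edge terms cancel `⟨h, v⟩`, and what
remains is that `M L u + C u` is orthogonal to every vector `L v`. -/
theorem inOpDomain_of_form (K : G.Coefficients) {u h : G.E2} (hu : u ∈ K.formDomain)
    (H : ∀ v ∈ K.formDomain, K.formValue u v = inner ℝ h v) : K.InOpDomain u := by
  have hw : ∀ e, IsWeakDeriv (G.len e) (K.flux u e) (fun x => K.p e x * u e x - h e x) := by
    intro e φ h1 h2 h3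
    obtain ⟨v, v1, v2, v3, v4⟩ := K.exists_testFunction_mem_formDomain e h1 h2 h3
    obtain ⟨-, t2, -⟩ := testFunction_memH1 (G.len_pos e) h1 h2 h3
    have hd : weakDeriv (G.len e) (v e) =ᵐ[edgeMeasure (G.len e)] deriv φ :=
      (memH1_congr (testFunction_memH1 (G.len_pos e) h1 h2 h3).1 v2).2.trans t2
    have e0 := H v v1
    rw [formValue, v4, dotProduct_zero, sub_zero, PiLp.inner_apply,
      Finset.sum_eq_single e (fun e' _ he' => ?_) (fun h => absurd (Finset.mem_univ _) h),
      Finset.sum_eq_single e (fun e' _ he' => ?_) (fun h => absurd (Finset.mem_univ _) h),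
      Finset.sum_eq_single e (fun e' _ he' => ?_) (fun h => absurd (Finset.mem_univ _) h),
      Lp_inner_eq] at e0
    · have i1 := integrable_triple (K.p_mem e) (Lp.memLp (u e)) (Lp.memLp (v e))
      have i2 : Integrable (fun x => h e x * v e x) (edgeMeasure (G.len e)) :=
        (Lp.memLp (h e)).integrable_mul (Lp.memLp (v e))
      have e1 : ∫ x, K.flux u e x * deriv φ x ∂(edgeMeasure (G.len e))
          = ∫ x, K.c e x * weakDeriv (G.len e) (u e) x * weakDeriv (G.len e) (v e) x
            ∂(edgeMeasure (G.len e)) := by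
        apply integral_congr_ae
        filter_upwards [hd] with x hx
        rw [hx, flux]
      have e2 : ∫ x, (K.p e x * u e x - h e x) * φ x ∂(edgeMeasure (G.len e))
          = ∫ x, K.p e x * u e x * v e x ∂(edgeMeasure (G.len e))
            - ∫ x, h e x * v e x ∂(edgeMeasure (G.len e)) := by
        rw [← integral_sub i1 i2]
        apply integral_congr_ae
        filter_upwards [v2] with x hx
        rw [hx]
        ring
      rw [e1, e2]
      linarith
    · rw [Lp_inner_eq]
      apply integral_eq_zero_of_ae
      filter_upwards [v3 e' he'] with x hx
      simp [hx]
    · apply integral_eq_zero_of_ae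
      filter_upwards [v3 e' he'] with x hx
      simp [hx]
    · apply integral_eq_zero_of_ae
      filter_upwards [(memH1_zero _ (v3 e' he')).2] with x hx
      simp [hx]
  have hg : ∀ e, MemLp (fun x => K.p e x * u e x - h e x) 2 (edgeMeasure (G.len e)) := fun e =>
    ((Lp.memLp (u e)).mul (r := 2) (K.p_mem e)).sub (Lp.memLp (h e))
  have hf : ∀ e, MemH1 (G.len e) (K.flux u e) := fun e =>
    ⟨K.memLp_flux (hu.1 e), _, hg e, hw e⟩
  have hfd := fun e => weakDeriv_ae_eq (hg e) (hw e)
  refine ⟨fun e => ⟨hu.1 e, hf e⟩, hu.2, fun e => K.hasContRep_weakDeriv (hf e), ?_⟩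
  have key : ∀ y : V → ℝ, (K.M *ᵥ G.L u + K.C u) ⬝ᵥ y = 0 := by
    intro y
    obtain ⟨v, v1, rfl⟩ := K.exists_mem_formDomain_L_eq y
    have e0 := H v v1
    rw [K.formValue_eq hf v1, PiLp.inner_apply] at e0
    have e1 : -∑ e, ∫ x, K.opFun u e x * v e x ∂(edgeMeasure (G.len e))
        = ∑ e, inner ℝ (h e) (v e) := by
      rw [← Finset.sum_neg_distrib]
      refine Finset.sum_congr rfl fun e _ => ?_
      rw [Lp_inner_eq, ← integral_neg]
      apply integral_congr_ae
      filter_upwards [hfd e] with x hx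
      rw [opFun, hx]
      ring
    rw [e1] at e0
    linarith
  -- The vector tested against is `M L u + C u` itself.
  exact dotProduct_self_eq_zero.1 (key _)

theorem form_isAssociated (K : G.Coefficients) : K.form.IsAssociated (-K.A2) := by
  constructor
  · intro u
    constructor
    · intro hu
      have hu' : K.InOpDomain u := hu
      exact ⟨K.opDomain_le hu', -K.opValue ⟨u, hu'⟩,
        fun v => K.formValue_eq_inner ⟨u, hu'⟩ v.2⟩
    · rintro ⟨hu, h, H⟩
      exact K.inOpDomain_of_form hu fun v hv => H ⟨v, hv⟩
  · intro u hu h H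
    have hu' : K.InOpDomain u := u.2
    refine sub_eq_zero.1 (K.eq_zero_of_inner_formDomain fun v hv => ?_)
    have h1 := K.formValue_eq_inner ⟨u, hu'⟩ hv
    have h2 := H ⟨v, hv⟩
    have h3 : inner ℝ (-K.opValue ⟨u, hu'⟩) v = inner ℝ h v := h1.symm.trans h2
    rw [inner_sub_right, real_inner_comm, sub_eq_zero, real_inner_comm h]
    exact h3

/-! ### Closedness -/

/-- For positive `m` this is the coercivity behind closedness: the form bounds the `L²` norm of the
derivative on each edge. -/
theorem integral_sq_weakDeriv_le (K : G.Coefficients) {u : G.E2} {e : E} {m : ℝ}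
    (hm : ∀ x ∈ Icc 0 (G.len e), m ≤ K.c e x) (hu : MemH1 (G.len e) (u e)) :
    m * ∫ x, weakDeriv (G.len e) (u e) x ^ 2 ∂(edgeMeasure (G.len e)) ≤ K.formValue u u := by
  refine le_trans ?_ (K.integral_c_le_formValue u e)
  have h := (weakDeriv_spec hu.2).1
  rw [← integral_const_mul]
  refine integral_mono_ae (h.integrable_sq.const_mul m) (integrable_triple (K.bdd_c e) h h) ?_
  rw [EventuallyLE, ae_edgeMeasure_iff]
  filter_upwards with x hx
  rw [mul_assoc, ← sq]
  exact mul_le_mul_of_nonneg_right (hm x (Ioo_subset_Icc_self hx)) (sq_nonneg _)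

theorem _root_.exists_integral_triple_le {l : ℝ} {q : ℝ → ℝ} (hq : MemLp q ∞ (edgeMeasure l)) :
    ∃ B, ∀ g, MemLp g 2 (edgeMeasure l) →
      ∫ x, q x * g x * g x ∂(edgeMeasure l) ≤ B * ∫ x, g x ^ 2 ∂(edgeMeasure l) := by
  refine ⟨(eLpNorm q ∞ (edgeMeasure l)).toReal, fun g hg => ?_⟩
  rw [← integral_const_mul]
  refine integral_mono_ae (integrable_triple hq hg hg) (hg.integrable_sq.const_mul _) ?_
  filter_upwards [ae_le_eLpNormEssSup (f := q) (μ := edgeMeasure l)] with x hx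
  rw [mul_assoc, ← sq]
  refine mul_le_mul_of_nonneg_right ((le_abs_self _).trans ?_) (sq_nonneg _)
  rw [← Real.norm_eq_abs, ← toReal_enorm]
  rw [eLpNorm_exponent_top]
  exact ENNReal.toReal_mono (by simpa using hq.eLpNorm_ne_top) hx

/-- A form-Cauchy sequence converges in `L²` together with its weak derivatives, and weak
derivatives are stable under such limits. The Sobolev estimate turns this into convergence of
endpoint values, so continuity at the vertices survives. Upper bounds on the coefficients finally
bring the form of the difference to zero. -/
theorem form_isClosed (K : G.Coefficients) : K.form.IsClosed := by
  intro u hu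
  have hformNorm : ∀ w : K.form.domain, K.form.formNorm w
      = √(K.formValue w w + ‖(w : G.E2)‖ ^ 2) := fun w => rfl
  have hmem : ∀ n, (u n : G.E2) ∈ K.formDomain := fun n => (u n).2
  have hsub : ∀ m n, ((u m : G.E2) - u n) ∈ K.formDomain := fun m n =>
    K.formDomain.sub_mem (hmem m) (hmem n)
  -- convergence of the functions
  have hC : CauchySeq fun n => (u n : G.E2) := by
    rw [Metric.cauchySeq_iff]
    intro ε hε
    obtain ⟨N, hN⟩ := hu ε hε
    refine ⟨N, fun m hm n hn => lt_of_le_of_lt ?_ (hN m hm n hn)⟩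
    rw [dist_eq_norm, hformNorm]
    refine Real.le_sqrt_of_sq_le ?_
    have := K.formValue_self_nonneg (u m - u n)
    change ‖(u m : G.E2) - u n‖ ^ 2 ≤ K.formValue (u m - u n) (u m - u n)
      + ‖(u m : G.E2) - u n‖ ^ 2
    linarith
  obtain ⟨f, hf⟩ := cauchySeq_tendsto_of_complete hC
  have hfe : ∀ e, Tendsto (fun n => (u n : G.E2) e) atTop (𝓝 (f e)) := fun e =>
    ((PiLp.continuous_apply 2 _ e).tendsto f).comp hf
  -- convergence of the derivatives
  let g : ℕ → ∀ e, Lp ℝ 2 (edgeMeasure (G.len e)) := fun n e =>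
    (weakDeriv_spec ((hmem n).1 e).2).1.toLp _
  have hg : ∀ n e, g n e =ᵐ[edgeMeasure (G.len e)] weakDeriv (G.len e) ((u n : G.E2) e) :=
    fun n e => MemLp.coeFn_toLp _
  have hgC : ∀ e, CauchySeq fun n => g n e := by
    intro e
    obtain ⟨c, hc, hcle⟩ := K.exists_pos_le_c e
    rw [Metric.cauchySeq_iff]
    intro ε hε
    -- The squared form norm is at least `c` times the squared `L²` norm of the derivative on the
    -- edge `e`, which explains the tolerance `√c * ε`.
    obtain ⟨N, hN⟩ := hu (√c * ε) (by positivity)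
    refine ⟨N, fun m hm n hn => ?_⟩
    have h1 := hN m hm n hn
    rw [hformNorm] at h1
    have h2 := K.integral_sq_weakDeriv_le hcle ((hsub m n).1 e)
    have h3 : ‖g m e - g n e‖ ^ 2 = ∫ x, weakDeriv (G.len e) (((u m : G.E2) - u n : G.E2) e) x ^ 2
        ∂(edgeMeasure (G.len e)) := by
      rw [Lp_norm_sq]
      apply integral_congr_ae
      filter_upwards [Lp.coeFn_sub (g m e) (g n e), hg m e, hg n e,
        (memH1_lin ((hmem m).1 e) ((hmem n).1 e) (G.coe_sub_ae (u m) (u n) e)).2]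
        with x a1 a2 a3 a4
      rw [a1, a4, Pi.sub_apply, a2, a3]
      ring
    rw [← h3] at h2
    rw [dist_eq_norm]
    have h4 : √(c * ‖g m e - g n e‖ ^ 2) < √c * ε := by
      refine lt_of_le_of_lt (Real.sqrt_le_sqrt ?_) h1
      have := sq_nonneg ‖(u m : G.E2) - u n‖
      change _ ≤ K.formValue (u m - u n) (u m - u n) + ‖(u m : G.E2) - u n‖ ^ 2
      linarith
    rw [Real.sqrt_mul hc.le, Real.sqrt_sq (norm_nonneg _)] at h4
    exact lt_of_mul_lt_mul_left h4 (Real.sqrt_nonneg _)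
  choose γ hγ using fun e => cauchySeq_tendsto_of_complete (hgC e)
  have hw : ∀ e, IsWeakDeriv (G.len e) (f e) (γ e) := fun e =>
    isWeakDeriv_of_tendsto (hfe e) (hγ e) fun n => by
      intro φ h1 h2 h3
      rw [(weakDeriv_spec ((hmem n).1 e).2).2 φ h1 h2 h3]
      congr 1
      apply integral_congr_ae
      filter_upwards [hg n e] with x hx
      rw [hx]
  have hfH : ∀ e, MemH1 (G.len e) (f e) := fun e => ⟨Lp.memLp _, _, Lp.memLp _, hw e⟩
  have hdH : ∀ n e, MemH1 (G.len e) (((u n : G.E2) - f : G.E2) e) := fun n e =>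
    (memH1_lin ((hmem n).1 e) (hfH e) (G.coe_sub_ae (u n) f e)).1
  have hder : ∀ e, Tendsto (fun n => ∫ x, weakDeriv (G.len e) (((u n : G.E2) - f : G.E2) e) x ^ 2
      ∂(edgeMeasure (G.len e))) atTop (𝓝 0) := by
    intro e
    have h1 : Tendsto (fun n => ‖g n e - γ e‖ ^ 2) atTop (𝓝 0) := by
      simpa using ((tendsto_iff_norm_sub_tendsto_zero.1 (hγ e)).pow 2)
    refine h1.congr fun n => ?_
    rw [Lp_norm_sq]
    apply integral_congr_ae
    filter_upwards [Lp.coeFn_sub (g n e) (γ e), hg n e, weakDeriv_ae_eq (Lp.memLp _) (hw e),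
      (memH1_lin ((hmem n).1 e) (hfH e) (G.coe_sub_ae (u n) f e)).2] with x a1 a2 a3 a4
    rw [a1, a4, Pi.sub_apply, a2, a3]
    ring
  have hfun : ∀ e, Tendsto (fun n => ∫ x, ((u n : G.E2) - f : G.E2) e x ^ 2
      ∂(edgeMeasure (G.len e))) atTop (𝓝 0) := by
    intro e
    have h1 : Tendsto (fun n => ‖(u n : G.E2) e - f e‖ ^ 2) atTop (𝓝 0) := by
      simpa using ((tendsto_iff_norm_sub_tendsto_zero.1 (hfe e)).pow 2)
    refine h1.congr fun n => ?_
    rw [← PiLp.sub_apply, Lp_norm_sq]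
  -- convergence of the boundary values
  have hval0 : ∀ e, ∀ x ∈ Icc 0 (G.len e),
      Tendsto (fun n => contRep (G.len e) (((u n : G.E2) - f : G.E2) e) x) atTop (𝓝 0) := by
    intro e x hx
    have h1 := ((hfun e).const_mul (2 * (G.len e)⁻¹)).add ((hder e).const_mul (2 * G.len e))
    rw [mul_zero, mul_zero, add_zero] at h1
    have h2 := squeeze_zero (fun n => sq_nonneg _)
      (fun n => (hdH n e).sq_contRep_le (G.len_pos e) hx) h1
    have h3 := h2.sqrt
    simp only [Real.sqrt_sq_eq_abs, Real.sqrt_zero] at h3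
    exact (tendsto_zero_iff_abs_tendsto_zero _).2 h3
  have hval : ∀ e v, Tendsto (fun n => G.valueAt (u n) e v) atTop (𝓝 (G.valueAt f e v)) := by
    intro e v
    have h1 := (hval0 e _ (G.coord_mem e v)).add_const (G.valueAt f e v)
    rw [zero_add] at h1
    refine h1.congr fun n => ?_
    rw [(contRep_lin (G.len_pos e) (((hmem n).1 e).contRep (G.len_pos e)).1
      ((hfH e).contRep (G.len_pos e)).1 (G.coe_sub_ae (u n) f e)).2 (G.coord_mem e v)]
    simp only [valueAt]
    ring
  have hfc : G.IsContinuous f := by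
    refine ⟨fun e => ((hfH e).contRep (G.len_pos e)).1, fun v e e' h h' => ?_⟩
    refine tendsto_nhds_unique (hval e v) ((hval e' v).congr fun n => ?_)
    exact (hmem n).2.2 v e' e h' h
  have hfD : f ∈ K.formDomain := ⟨hfH, hfc⟩
  refine ⟨⟨f, hfD⟩, ?_⟩
  have hL : Tendsto (fun n => G.L ((u n : G.E2) - f)) atTop (𝓝 0) := by
    rw [tendsto_pi_nhds]
    intro v
    exact hval0 _ _ (G.coord_mem _ v)
  have hML : Tendsto (fun n => (K.M *ᵥ G.L ((u n : G.E2) - f)) ⬝ᵥ G.L ((u n : G.E2) - f))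
      atTop (𝓝 0) := by
    have hcont : Continuous fun y : V → ℝ => (K.M *ᵥ y) ⬝ᵥ y := by fun_prop
    have h0 := (hcont.tendsto 0).comp hL
    rw [Matrix.mulVec_zero, zero_dotProduct] at h0
    exact h0
  choose Bc hBc using fun e => exists_integral_triple_le (K.bdd_c e)
  choose Bp hBp using fun e => exists_integral_triple_le (K.p_mem e)
  have hupper : Tendsto (fun n =>
      ∑ e, Bc e * ∫ x, weakDeriv (G.len e) (((u n : G.E2) - f : G.E2) e) x ^ 2
          ∂(edgeMeasure (G.len e))
        + ∑ e, Bp e * ∫ x, ((u n : G.E2) - f : G.E2) e x ^ 2 ∂(edgeMeasure (G.len e))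
        - (K.M *ᵥ G.L ((u n : G.E2) - f)) ⬝ᵥ G.L ((u n : G.E2) - f)) atTop (𝓝 0) := by
    have h1 := ((tendsto_finsetSum Finset.univ fun e _ => (hder e).const_mul (Bc e)).add
      (tendsto_finsetSum Finset.univ fun e _ => (hfun e).const_mul (Bp e))).sub hML
    simpa using h1
  have hform : Tendsto (fun n => K.formValue ((u n : G.E2) - f) ((u n : G.E2) - f)) atTop
      (𝓝 0) := by
    refine squeeze_zero (fun n => K.formValue_self_nonneg _) (fun n => ?_) hupper
    unfold formValue
    gcongr with e _ e _
    · exact hBc e _ (weakDeriv_spec (hdH n e).2).1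
    · exact hBp e _ (Lp.memLp _)
  have hnorm : Tendsto (fun n => ‖(u n : G.E2) - f‖ ^ 2) atTop (𝓝 0) := by
    simpa using ((tendsto_iff_norm_sub_tendsto_zero.1 hf).pow 2)
  have := (hform.add hnorm).sqrt
  rw [add_zero, Real.sqrt_zero] at this
  exact this

/-- The first Beurling-Deny criterion for the form. -/
theorem exists_abs (K : G.Coefficients) {u : G.E2} (hu : u ∈ K.formDomain) :
    ∃ w ∈ K.formDomain, (∀ e, w e =ᵐ[edgeMeasure (G.len e)] fun x => |u e x|) ∧
      K.formValue w w ≤ K.formValue u u := by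
  have h := fun e => (hu.1 e).abs (G.len_pos e)
  obtain ⟨w, w1, w2, w3⟩ := K.exists_mem_formDomain (y := fun v => |G.L u v|)
    (fun e => (h e).1)
    (fun e => by
      rw [(h e).2.2 (left_mem_Icc.2 (G.len_pos e).le)]
      simp only [G.contRep_zero_eq hu.2])
    (fun e => by
      rw [(h e).2.2 (right_mem_Icc.2 (G.len_pos e).le)]
      simp only [G.contRep_len_eq hu.2])
  refine ⟨w, w1, w2, ?_⟩
  unfold formValue
  have hM := mulVec_dotProduct_le_abs K.M_offdiag (G.L u)
  rw [w3]
  refine sub_le_sub (add_le_add (Finset.sum_le_sum fun e _ => ?_)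
    (Finset.sum_le_sum fun e _ => ?_)) hM
  · have m1 := (weakDeriv_spec (hu.1 e).2).1
    have m2 := (weakDeriv_spec (w1.1 e).2).1
    refine integral_mono_ae (integrable_triple (K.bdd_c e) m2 m2)
      (integrable_triple (K.bdd_c e) m1 m1) ?_
    have a1 := (memH1_congr (h e).1 (w2 e)).2
    have a2 := (h e).2.1
    rw [EventuallyEq, ae_edgeMeasure_iff] at a1
    rw [ae_edgeMeasure_iff] at a2
    rw [EventuallyLE, ae_edgeMeasure_iff]
    filter_upwards [a1, a2] with x h1 h2 hx
    rw [mul_assoc, mul_assoc, h1 hx]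
    refine mul_le_mul_of_nonneg_left ?_ (K.c_pos e x (Ioo_subset_Icc_self hx)).le
    exact abs_le_iff_mul_self_le.1 (h2 hx)
  · apply le_of_eq
    apply integral_congr_ae
    filter_upwards [w2 e] with x hx
    rw [hx, mul_assoc, mul_assoc, abs_mul_abs_self]

end Coefficients

end MetricGraph

/-! ### Operators associated with closed symmetric forms -/

/-- The Riesz representation theorem for an inner product that is complete along sequences. -/
theorem riesz_of_core {F : Type*} [AddCommGroup F] [Module ℝ F] (c : InnerProductSpace.Core ℝ F)
    (hc : ∀ u : ℕ → F,
      (∀ ε > 0, ∃ N, ∀ m ≥ N, ∀ n ≥ N, √(c.inner (u m - u n) (u m - u n)) < ε) →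
      ∃ w, Tendsto (fun n => √(c.inner (u n - w) (u n - w))) atTop (𝓝 0))
    (φ : F →ₗ[ℝ] ℝ) (C : ℝ) (hφ : ∀ v, |φ v| ≤ C * √(c.inner v v)) :
    ∃ u, ∀ v, c.inner u v = φ v := by
  -- The space `F` starts as a bare module, so this is its only norm. For a form domain it differs
  -- from the norm inherited from the ambient Hilbert space.
  let : NormedAddCommGroup F := c.toNormedAddCommGroup
  let : InnerProductSpace ℝ F := InnerProductSpace.ofCore c.toCore
  have hn : ∀ v : F, ‖v‖ = √(c.inner v v) := fun v => rfl
  have : CompleteSpace F := by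
    refine Metric.complete_of_cauchySeq_tendsto fun u hu => ?_
    rw [Metric.cauchySeq_iff] at hu
    obtain ⟨w, hw⟩ := hc u fun ε hε => by
      obtain ⟨N, hN⟩ := hu ε hε
      refine ⟨N, fun m hm n hn' => ?_⟩
      rw [← hn, ← dist_eq_norm]
      exact hN m hm n hn'
    refine ⟨w, tendsto_iff_norm_sub_tendsto_zero.2 ?_⟩
    exact hw
  let ψ : StrongDual ℝ F := φ.mkContinuous C fun v => by
    rw [Real.norm_eq_abs, hn]
    exact hφ v
  refine ⟨(InnerProductSpace.toDual ℝ F).symm ψ, fun v => ?_⟩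
  exact InnerProductSpace.toDual_symm_apply (x := v) (y := ψ)

namespace PartialForm

variable {H : Type*} [NormedAddCommGroup H] [InnerProductSpace ℝ H]

/-- Cauchy-Schwarz for a nonnegative symmetric form gives continuity with constant one. -/
theorem isContinuous_of_isSymmetric {a : PartialForm H} (hs : a.IsSymmetric)
    (ha : a.IsAccretive) : a.IsContinuous := by
  refine ⟨1, fun u v => ?_⟩
  have h := LinearMap.BilinForm.apply_sq_le_of_symm a.toBilin ha
    ⟨fun x y => hs x y⟩ u v
  have hle : ∀ u : a.domain, √(a.toBilin u u) ≤ a.formNorm u := fun u =>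
    Real.sqrt_le_sqrt (by nlinarith [sq_nonneg ‖(u : H)‖])
  calc |a.toBilin u v| ≤ √(a.toBilin u u * a.toBilin v v) := Real.abs_le_sqrt h
    _ = √(a.toBilin u u) * √(a.toBilin v v) := Real.sqrt_mul (ha u) _
    _ ≤ a.formNorm u * a.formNorm v :=
      mul_le_mul (hle u) (hle v) (Real.sqrt_nonneg _) (Real.sqrt_nonneg _)
    _ = 1 * a.formNorm u * a.formNorm v := by ring

/-- Riesz representation of `v ↦ ⟨h, v⟩` for the inner product `a(u, v) + r ⟨u, v⟩`. Its norm is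
equivalent to the form norm, so closedness supplies completeness. -/
theorem exists_resolvent_equation {a : PartialForm H} (hs : a.IsSymmetric) (ha : a.IsAccretive)
    (hc : a.IsClosed) {r : ℝ} (hr : 0 < r) (h : H) :
    ∃ u : a.domain, ∀ v : a.domain,
      a.toBilin u v + r * inner ℝ (u : H) (v : H) = inner ℝ h (v : H) := by
  let c : InnerProductSpace.Core ℝ a.domain :=
    { inner := fun u v => a.toBilin u v + r * inner ℝ (u : H) (v : H)
      conj_inner_symm := fun u v => by
        simp only [conj_trivial]
        rw [hs v u, real_inner_comm]
      re_inner_nonneg := fun u => by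
        have := ha u
        have h2 := real_inner_self_nonneg (x := (u : H))
        simp only [RCLike.re_to_real]
        positivity
      add_left := fun u v w => by
        simp only [map_add, LinearMap.add_apply, Submodule.coe_add, inner_add_left]
        ring
      smul_left := fun u v s => by
        simp only [map_smul, LinearMap.smul_apply, Submodule.coe_smul, inner_smul_left,
          conj_trivial, smul_eq_mul]
        ring
      definite := fun u hu => by
        have h1 := ha u
        have h2 := real_inner_self_nonneg (x := (u : H))
        have h3 : inner ℝ (u : H) (u : H) = 0 := by
          have : a.toBilin u u + r * inner ℝ (u : H) (u : H) = 0 := hu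
          have h4 : 0 ≤ r * inner ℝ (u : H) (u : H) := by positivity
          have h5 : r * inner ℝ (u : H) (u : H) = 0 := by linarith
          exact (mul_eq_zero.1 h5).resolve_left hr.ne'
        exact Subtype.ext (inner_self_eq_zero.1 h3) }
  have hci : ∀ u, c.inner u u = a.toBilin u u + r * ‖(u : H)‖ ^ 2 := fun u => by
    rw [← real_inner_self_eq_norm_sq (u : H)]
    rfl
  have hn0 : ∀ u : a.domain, 0 ≤ ‖(u : H)‖ ^ 2 := fun u => sq_nonneg _
  -- Since `r ‖v‖²` is at most the new squared norm of `v`, the functional has norm at most `‖h‖ /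
  -- √r`.
  refine riesz_of_core c ?_ ((innerₛₗ ℝ h).comp a.domain.subtype) (‖h‖ * (√r)⁻¹) ?_
  · intro u hu
    obtain ⟨w, hw⟩ := hc u (fun ε hε => by
      -- One half of the norm equivalence: `a + ‖·‖² ≤ (1 + r⁻¹) (a + r ‖·‖²)`. The converse, with
      -- the factor `1 + r`, is used for the limit.
      obtain ⟨N, hN⟩ := hu (ε / √(1 + r⁻¹)) (by positivity)
      refine ⟨N, fun m hm n hn => ?_⟩
      have h1 := hN m hm n hn
      rw [lt_div_iff₀ (by positivity), ← Real.sqrt_mul' _ (by positivity), hci] at h1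
      refine lt_of_le_of_lt (Real.sqrt_le_sqrt ?_) h1
      have h2 := ha (u m - u n)
      have h3 := hn0 (u m - u n)
      have h4 : (a.toBilin (u m - u n) (u m - u n) + r * ‖((u m - u n : a.domain) : H)‖ ^ 2)
          * (1 + r⁻¹) = a.toBilin (u m - u n) (u m - u n) + ‖((u m - u n : a.domain) : H)‖ ^ 2
          + (a.toBilin (u m - u n) (u m - u n) * r⁻¹
            + r * ‖((u m - u n : a.domain) : H)‖ ^ 2) := by
        field_simp
        ring
      rw [h4]
      have : 0 ≤ a.toBilin (u m - u n) (u m - u n) * r⁻¹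
            + r * ‖((u m - u n : a.domain) : H)‖ ^ 2 := by positivity
      linarith)
    refine ⟨w, ?_⟩
    have h1 := hw.const_mul √(1 + r)
    rw [mul_zero] at h1
    refine squeeze_zero (fun n => Real.sqrt_nonneg _) (fun n => ?_) h1
    rw [formNorm, ← Real.sqrt_mul (by positivity), hci]
    apply Real.sqrt_le_sqrt
    have h2 := ha (u n - w)
    have h3 := hn0 (u n - w)
    nlinarith [mul_nonneg hr.le h2]
  · intro v
    have h1 : |inner ℝ h (v : H)| ≤ ‖h‖ * ‖(v : H)‖ := abs_real_inner_le_norm _ _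
    refine h1.trans ?_
    rw [mul_assoc]
    refine mul_le_mul_of_nonneg_left ?_ (norm_nonneg _)
    rw [hci, inv_mul_eq_div, le_div_iff₀ (by positivity)]
    refine Real.le_sqrt_of_sq_le ?_
    rw [mul_pow, Real.sq_sqrt hr.le]
    linarith [ha v]

end PartialForm

/-- A symmetric dissipative operator `A` such that `r - A` is surjective for all `r > 0`. -/
structure IsMDissipativeSymmetric {H : Type*} [NormedAddCommGroup H] [InnerProductSpace ℝ H]
    (A : H →ₗ.[ℝ] H) : Prop where
  symm : ∀ x y : A.domain, inner ℝ (A x) (y : H) = inner ℝ (x : H) (A y)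
  dissipative : IsDissipative A
  surjective : ∀ r : ℝ, 0 < r → ∀ y : H, ∃ x : A.domain, r • (x : H) - A x = y

theorem PartialForm.IsAssociated.isMDissipativeSymmetric {H : Type*} [NormedAddCommGroup H]
    [InnerProductSpace ℝ H] {a : PartialForm H} {A : H →ₗ.[ℝ] H} (h : a.IsAssociated (-A))
    (hs : a.IsSymmetric) (ha : a.IsAccretive) (hc : a.IsClosed) : IsMDissipativeSymmetric A := by
  have key : ∀ x : A.domain, ∃ hx : (x : H) ∈ a.domain, ∀ v : a.domain,
      a.toBilin ⟨x, hx⟩ v = inner ℝ (-A x) (v : H) := by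
    intro x
    obtain ⟨hx, k, hk⟩ := (h.1 x).1 x.2
    refine ⟨hx, ?_⟩
    have : -A x = k := h.2 x hx k hk
    rw [this]
    exact hk
  refine ⟨fun x y => ?_, fun x => ?_, fun r hr y => ?_⟩
  · obtain ⟨hx, kx⟩ := key x
    obtain ⟨hy, ky⟩ := key y
    have h1 := kx ⟨y, hy⟩
    have h2 := ky ⟨x, hx⟩
    rw [hs, h2, inner_neg_left, inner_neg_left, neg_inj] at h1
    rw [← h1, real_inner_comm]
  · obtain ⟨hx, kx⟩ := key x
    have h1 := kx ⟨x, hx⟩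
    have h2 := ha ⟨x, hx⟩
    rw [h1, inner_neg_left] at h2
    linarith
  · obtain ⟨u, hu⟩ := PartialForm.exists_resolvent_equation hs ha hc hr y
    have hu' : ∀ v : a.domain, a.toBilin u v = inner ℝ (y - r • (u : H)) (v : H) := fun v => by
      rw [inner_sub_left, inner_smul_left, ← hu v]
      simp
    have hm : (u : H) ∈ A.domain := (h.1 u).2 ⟨u.2, _, hu'⟩
    refine ⟨⟨u, hm⟩, ?_⟩
    have : -A ⟨u, hm⟩ = y - r • (u : H) := h.2 ⟨u, hm⟩ u.2 _ hu'
    rw [sub_eq_add_neg, this]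
    abel

namespace IsMDissipativeSymmetric

variable {H : Type*} [NormedAddCommGroup H] [InnerProductSpace ℝ H] {A : H →ₗ.[ℝ] H}

/-- Pair `r x - A x` with `x`, use dissipativity and cancel one factor `‖x‖`. For `r > 0` this gives
injectivity of `r - A` and the bound `1 / r` on its inverse. -/
theorem norm_le (hA : IsMDissipativeSymmetric A) {r : ℝ} (x : A.domain) :
    r * ‖(x : H)‖ ≤ ‖r • (x : H) - A x‖ := by
  rcases (norm_nonneg (x : H)).eq_or_lt with h0 | h0
  · rw [← h0, mul_zero]
    exact norm_nonneg _
  · have h1 := real_inner_le_norm (r • (x : H) - A x) x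
    rw [inner_sub_left, inner_smul_left, real_inner_self_eq_norm_sq] at h1
    simp only [conj_trivial] at h1
    have h2 := hA.dissipative x
    refine le_of_mul_le_mul_right ?_ h0
    nlinarith

theorem eq_of_sub_eq (hA : IsMDissipativeSymmetric A) {r : ℝ} (hr : 0 < r) {x y : A.domain}
    (h : r • (x : H) - A x = r • (y : H) - A y) : x = y := by
  have h1 := hA.norm_le (r := r) (x - y)
  have h2 : r • ((x - y : A.domain) : H) - A (x - y) = 0 := by
    rw [A.map_sub, Submodule.coe_sub, smul_sub, ← sub_eq_zero.2 h]
    abel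
  rw [h2, norm_zero] at h1
  have h3 : ‖((x - y : A.domain) : H)‖ ≤ 0 := by
    by_contra h'
    exact absurd h1 (not_le.2 (mul_pos hr (not_le.1 h')))
  exact sub_eq_zero.1 (Subtype.ext (norm_le_zero_iff.1 h3))

theorem exists_resolvent (hA : IsMDissipativeSymmetric A) {r : ℝ} (hr : 0 < r) :
    ∃ R : H →L[ℝ] H, IsResolvent A r R := by
  choose S hS using hA.surjective r hr
  let R : H →ₗ[ℝ] H :=
    { toFun := fun y => S y
      map_add' := fun y z => by
        rw [← Submodule.coe_add]
        congr 1
        apply hA.eq_of_sub_eq hr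
        rw [hS, A.map_add, Submodule.coe_add, smul_add, add_sub_add_comm, hS, hS]
      map_smul' := fun s y => by
        rw [RingHom.id_apply, ← Submodule.coe_smul]
        congr 1
        apply hA.eq_of_sub_eq hr
        rw [hS, A.map_smul, Submodule.coe_smul, smul_comm, ← smul_sub, hS] }
  refine ⟨R.mkContinuous r⁻¹ fun y => ?_, fun y => ⟨(S y).2, hS y⟩, fun x => ?_⟩
  · have := hA.norm_le (r := r) (S y)
    rw [hS] at this
    rw [inv_mul_eq_div, le_div_iff₀' hr]
    exact this
  · change (S _ : H) = x
    congr 1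
    apply hA.eq_of_sub_eq hr
    rw [hS]

/-- A vector orthogonal to the domain has the form `x - A x`; pairing it with `x` gives `‖x‖² = ⟨x,
A x⟩ ≤ 0`. -/
theorem dense_domain (hA : IsMDissipativeSymmetric A) [CompleteSpace H] :
    Dense (A.domain : Set H) := by
  rw [Submodule.dense_iff_topologicalClosure_eq_top, Submodule.topologicalClosure_eq_top_iff,
    Submodule.eq_bot_iff]
  intro u hu
  obtain ⟨x, rfl⟩ := hA.surjective 1 one_pos u
  have h1 : inner ℝ (x : H) ((1 : ℝ) • (x : H) - A x) = 0 :=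
    (Submodule.mem_orthogonal _ _).1 hu x x.2
  have h2 := hA.dissipative x
  rw [one_smul, inner_sub_right, real_inner_self_eq_norm_sq, real_inner_comm] at h1
  have h3 : (x : H) = 0 := by
    have : ‖(x : H)‖ ^ 2 = 0 := le_antisymm (by linarith) (sq_nonneg _)
    simpa using this
  have h4 : x = 0 := Subtype.ext h3
  rw [h4]
  simp

/-- Symmetry gives `A ≤ A*`. For `y ∈ D(A*)` solve `(1 - A) x = (1 - A*) y`; then `y - x` is
orthogonal to the range of `1 - A`, which is everything, so `y = x ∈ D(A)`. -/
theorem isSelfAdjoint (hA : IsMDissipativeSymmetric A) [CompleteSpace H] : IsSelfAdjoint A := by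
  rw [LinearPMap.isSelfAdjoint_def]
  have hd := hA.dense_domain
  have hle : A ≤ A.adjoint := LinearPMap.IsFormalAdjoint.le_adjoint hd fun x y => hA.symm x y
  refine (LinearPMap.eq_of_le_of_domain_eq hle (le_antisymm hle.1 fun y hy => ?_)).symm
  obtain ⟨x, hx⟩ := hA.surjective 1 one_pos (y - A.adjoint ⟨y, hy⟩)
  have h0 : ∀ w : A.domain, inner ℝ (y - x) ((1 : ℝ) • (w : H) - A w) = 0 := by
    intro w
    have h1 : inner ℝ (A.adjoint ⟨y, hy⟩) (w : H) = inner ℝ y (A w) :=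
      LinearPMap.adjoint_isFormalAdjoint hd ⟨y, hy⟩ w
    have h2 := hA.symm x w
    have h3 : inner ℝ ((1 : ℝ) • (x : H) - A x) (w : H)
        = inner ℝ (y - A.adjoint ⟨y, hy⟩) (w : H) := by rw [hx]
    rw [one_smul, inner_sub_left, inner_sub_left, h1, h2] at h3
    rw [one_smul, inner_sub_left, inner_sub_right, inner_sub_right]
    linarith
  obtain ⟨w, hw⟩ := hA.surjective 1 one_pos (y - x)
  have h1 := h0 w
  rw [hw, inner_self_eq_zero, sub_eq_zero] at h1
  rw [h1]
  exact x.2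

theorem resolvent_symm (hA : IsMDissipativeSymmetric A) {r : ℝ} {R : H →L[ℝ] H}
    (hR : IsResolvent A r R) (x y : H) : inner ℝ (R x) y = inner ℝ x (R y) := by
  obtain ⟨hx, ex⟩ := hR.1 x
  obtain ⟨hy, ey⟩ := hR.1 y
  have h1 := hA.symm ⟨R x, hx⟩ ⟨R y, hy⟩
  conv_lhs => rw [← ey]
  conv_rhs => rw [← ex]
  rw [inner_sub_left, inner_sub_right, inner_smul_left, inner_smul_right, ← h1]
  simp

theorem resolvent_inner_self (hA : IsMDissipativeSymmetric A) {r : ℝ} {R : H →L[ℝ] H}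
    (hR : IsResolvent A r R) (x : H) : r * ‖R x‖ ^ 2 ≤ inner ℝ (R x) x := by
  obtain ⟨hx, ex⟩ := hR.1 x
  have h1 := hA.dissipative ⟨R x, hx⟩
  change inner ℝ (A ⟨R x, hx⟩) (R x) ≤ 0 at h1
  have h2 : inner ℝ (R x) (r • R x - A ⟨R x, hx⟩) = inner ℝ (R x) x := by rw [ex]
  rw [inner_sub_right, inner_smul_right, real_inner_self_eq_norm_sq,
    real_inner_comm (A ⟨R x, hx⟩)] at h2
  linarith

end IsMDissipativeSymmetric

/-! ### Functional calculus for the inverse of a positive operator -/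

/-- The spectrum of a positive contraction lies in `[0, 1]`, so the calculus on the spectrum can be
precomposed with restriction from `[0, 1]`. A fixed interval is convenient because norm estimates
then need no knowledge of the spectrum. -/
theorem exists_unitInterval_calculus {H : Type*} [NormedAddCommGroup H] [InnerProductSpace ℂ H]
    [CompleteSpace H] {R : H →L[ℂ] H} (hR : R.IsPositive) (h1 : ‖R‖ ≤ 1) :
    ∃ Φ : C(unitInterval, ℂ) →⋆ₐ[ℂ] (H →L[ℂ] H),
      Φ ⟨fun s => ((s : ℝ) : ℂ), by fun_prop⟩ = R ∧ ∀ f, ‖Φ f‖ ≤ ‖f‖ := by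
  have hsa : IsSelfAdjoint R := hR.isSelfAdjoint
  have hspec : ∀ z ∈ spectrum ℂ R, z.re ∈ unitInterval := by
    intro z hz
    have hz' := hsa.mem_spectrum_eq_re hz
    constructor
    · have : z.re ∈ spectrum ℝ R := by
        rw [hz'] at hz
        exact hsa.coe_mem_spectrum_complex.1 hz
      exact SpectrumRestricts.nnreal_iff.1 hR.spectrumRestricts _ this
    · have h2 := spectrum.norm_le_norm_mul_of_mem hz
      have h3 : ‖(1 : H →L[ℂ] H)‖ ≤ 1 := ContinuousLinearMap.norm_id_le
      have h4 : ‖z‖ ≤ 1 := h2.trans (mul_le_one₀ h1 (norm_nonneg _) h3)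
      exact (Complex.re_le_norm z).trans h4
  let r : C(spectrum ℂ R, unitInterval) := ⟨fun z => ⟨(z : ℂ).re, hspec z z.2⟩, by fun_prop⟩
  let Φ : C(unitInterval, ℂ) →⋆ₐ[ℂ] (H →L[ℂ] H) :=
    (cfcHom hsa.isStarNormal).comp (ContinuousMap.compStarAlgHom' ℂ ℂ r)
  refine ⟨Φ, ?_, fun f => ?_⟩
  · refine Eq.trans ?_ (cfcHom_id (R := ℂ) hsa.isStarNormal)
    change cfcHom hsa.isStarNormal _ = _
    congr 1
    ext z
    exact (hsa.mem_spectrum_eq_re z.2).symm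
  · change ‖cfcHom hsa.isStarNormal (f.comp r)‖ ≤ _
    rw [norm_cfcHom (𝕜 := ℂ) R _ hsa.isStarNormal, ContinuousMap.norm_le _ (norm_nonneg _)]
    exact fun z => f.norm_coe_le_norm _

/-! ### Decaying symbols on the half-line as continuous functions on the unit interval -/

/-- A continuous function on `[0, ∞)` that tends to zero at infinity. -/
def IsDecaying (k : ℝ → ℂ) : Prop := ContinuousOn k (Ici 0) ∧ Tendsto k atTop (𝓝 0)

theorem IsDecaying.mul {k m : ℝ → ℂ} (hk : IsDecaying k) (hm : IsDecaying m) :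
    IsDecaying fun x => k x * m x :=
  ⟨hk.1.mul hm.1, by simpa using hk.2.mul hm.2⟩

theorem IsDecaying.add {k m : ℝ → ℂ} (hk : IsDecaying k) (hm : IsDecaying m) :
    IsDecaying fun x => k x + m x :=
  ⟨hk.1.add hm.1, by simpa using hk.2.add hm.2⟩

theorem IsDecaying.const_mul {k : ℝ → ℂ} (c : ℂ) (hk : IsDecaying k) :
    IsDecaying fun x => c * k x :=
  ⟨continuousOn_const.mul hk.1, by simpa using hk.2.const_mul c⟩

/-- The point `x = s⁻¹ - 1` runs through `[0, ∞)` for `s ∈ (0, 1]`, and `s = 0` corresponds to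
infinity, where decay provides continuity with value zero. -/
theorem IsDecaying.continuous_unitInterval {k : ℝ → ℂ} (hk : IsDecaying k) :
    Continuous fun s : unitInterval => if (s : ℝ) = 0 then 0 else k ((s : ℝ)⁻¹ - 1) := by
  rw [continuous_iff_continuousAt]
  intro s
  rcases eq_or_ne (s : ℝ) 0 with hs | hs
  · have h1 : Tendsto (fun t : ℝ => k (t⁻¹ - 1)) (𝓝[>] 0) (𝓝 0) :=
      hk.2.comp (tendsto_atTop_add_const_right _ _ tendsto_inv_nhdsGT_zero)
    rw [ContinuousAt, if_pos hs, Metric.tendsto_nhds]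
    intro ε hε
    have h2 := (Metric.tendsto_nhds.1 h1) ε hε
    rw [eventually_nhdsWithin_iff] at h2
    have h3 : Tendsto (fun t : unitInterval => (t : ℝ)) (𝓝 s) (𝓝 0) := by
      rw [← hs]
      exact continuous_subtype_val.tendsto s
    filter_upwards [h3.eventually h2] with t ht
    split_ifs with h
    · simpa using hε
    · exact ht (lt_of_le_of_ne t.2.1 (Ne.symm h))
  · have h0 : 0 < (s : ℝ) := lt_of_le_of_ne s.2.1 (Ne.symm hs)
    have h1 : ContinuousOn (fun t : unitInterval => k ((t : ℝ)⁻¹ - 1)) {t | 0 < (t : ℝ)} := by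
      refine hk.1.comp ?_ fun t ht => ?_
      · exact (continuous_subtype_val.continuousOn.inv₀ fun t ht => ne_of_gt ht).sub
          continuousOn_const
      · have := (one_le_inv₀ (show 0 < (t : ℝ) from ht)).2 t.2.2
        simpa using this
    have hopen : {t : unitInterval | 0 < (t : ℝ)} ∈ 𝓝 s :=
      (isOpen_lt continuous_const continuous_subtype_val).mem_nhds h0
    refine (h1.continuousAt hopen).congr ?_
    filter_upwards [hopen] with t ht
    rw [if_neg (ne_of_gt ht)]

open Classical in
/-- The function `s ↦ k (1 / s - 1)` on `[0, 1]` for a decaying function `k` on `[0, ∞)`. -/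
def decayMap (k : ℝ → ℂ) : C(unitInterval, ℂ) :=
  if h : IsDecaying k then ⟨_, h.continuous_unitInterval⟩ else 0

theorem decayMap_apply {k : ℝ → ℂ} (hk : IsDecaying k) (s : unitInterval) :
    decayMap k s = if (s : ℝ) = 0 then 0 else k ((s : ℝ)⁻¹ - 1) := by
  rw [decayMap, dif_pos hk]
  rfl

theorem decayMap_congr {k m : ℝ → ℂ} (hk : IsDecaying k) (hm : IsDecaying m)
    (h : ∀ x, 0 ≤ x → k x = m x) : decayMap k = decayMap m := by
  ext s
  rw [decayMap_apply hk, decayMap_apply hm]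
  split_ifs with h0
  · rfl
  · have := (one_le_inv₀ (lt_of_le_of_ne s.2.1 (Ne.symm h0))).2 s.2.2
    exact h _ (by linarith)

theorem decayMap_mul {k m : ℝ → ℂ} (hk : IsDecaying k) (hm : IsDecaying m) :
    decayMap (fun x => k x * m x) = decayMap k * decayMap m := by
  ext s
  rw [ContinuousMap.mul_apply, decayMap_apply hk, decayMap_apply hm, decayMap_apply (hk.mul hm)]
  split_ifs <;> simp

theorem decayMap_add {k m : ℝ → ℂ} (hk : IsDecaying k) (hm : IsDecaying m) :
    decayMap (fun x => k x + m x) = decayMap k + decayMap m := by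
  ext s
  rw [ContinuousMap.add_apply, decayMap_apply hk, decayMap_apply hm, decayMap_apply (hk.add hm)]
  split_ifs <;> simp

theorem decayMap_const_mul {k : ℝ → ℂ} (c : ℂ) (hk : IsDecaying k) :
    decayMap (fun x => c * k x) = c • decayMap k := by
  ext s
  rw [ContinuousMap.smul_apply, decayMap_apply hk, decayMap_apply (hk.const_mul c)]
  split_ifs <;> simp

/-- Decay need not be assumed: without it `decayMap k` is the default value zero. -/
theorem norm_decayMap_le {k : ℝ → ℂ} {C : ℝ} (hC : 0 ≤ C) (h : ∀ x, 0 ≤ x → ‖k x‖ ≤ C) :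
    ‖decayMap k‖ ≤ C := by
  by_cases hk : IsDecaying k
  · rw [ContinuousMap.norm_le _ hC]
    intro s
    rw [decayMap_apply hk]
    split_ifs with h0
    · simpa using hC
    · have := (one_le_inv₀ (lt_of_le_of_ne s.2.1 (Ne.symm h0))).2 s.2.2
      exact h _ (by linarith)
  · rw [decayMap, dif_neg hk, norm_zero]
    exact hC

/-! ### The functions defining the resolvent and the semigroup -/

theorem isDecaying_exp {z : ℂ} (hz : 0 < z.re) : IsDecaying fun x => Complex.exp (-z * x) := by
  refine ⟨by fun_prop, ?_⟩
  rw [tendsto_zero_iff_norm_tendsto_zero]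
  simp only [Complex.norm_exp, Complex.mul_re, Complex.neg_re, Complex.ofReal_re, Complex.neg_im,
    Complex.ofReal_im, mul_zero, sub_zero]
  refine Real.tendsto_exp_atBot.comp ?_
  exact tendsto_id.const_mul_atTop_of_neg (by linarith)

theorem norm_exp_neg_mul (z : ℂ) (x : ℝ) :
    ‖Complex.exp (-z * x)‖ = Real.exp (-z.re * x) := by
  simp [Complex.norm_exp]

theorem isDecaying_mul_exp {z : ℂ} (hz : 0 < z.re) :
    IsDecaying fun x => -(x : ℂ) * Complex.exp (-z * x) := by
  refine ⟨by fun_prop, ?_⟩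
  rw [tendsto_zero_iff_norm_tendsto_zero]
  have h := Real.tendsto_pow_mul_exp_neg_atTop_nhds_zero 1
  have h2 := (h.comp (tendsto_id.const_mul_atTop hz)).const_mul z.re⁻¹
  rw [mul_zero] at h2
  refine h2.congr' ?_
  filter_upwards [eventually_ge_atTop 0] with x hx
  rw [norm_mul, norm_exp_neg_mul, norm_neg, Complex.norm_real, Real.norm_of_nonneg hx]
  simp only [Function.comp_apply, id, pow_one]
  rw [← mul_assoc, inv_mul_cancel_left₀ hz.ne', neg_mul]

theorem add_ne_zero_of_mem_slitPlane {z : ℂ} (hz : z ∈ Complex.slitPlane) {x : ℝ} (hx : 0 ≤ x) :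
    z + x ≠ 0 := by
  intro h
  have h1 : z = ((-x : ℝ) : ℂ) := by
    rw [Complex.ofReal_neg]
    exact eq_neg_of_add_eq_zero_left h
  rw [h1, Complex.ofReal_mem_slitPlane] at hz
  linarith

theorem isDecaying_inv {z : ℂ} (hz : z ∈ Complex.slitPlane) :
    IsDecaying fun x => (z + x)⁻¹ := by
  refine ⟨ContinuousOn.inv₀ (by fun_prop) fun x hx => add_ne_zero_of_mem_slitPlane hz hx, ?_⟩
  refine tendsto_inv₀_cobounded.comp ?_
  rw [← tendsto_norm_atTop_iff_cobounded]
  refine tendsto_atTop_mono (f := fun x : ℝ => x + z.re) (fun x => ?_)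
    (tendsto_atTop_add_const_right _ _ tendsto_id)
  refine le_trans ?_ (Complex.re_le_norm _)
  simp [add_comm]

/-- The symbol `1 / (1 + x)` is the coordinate `s`, that is, the symbol of `R(1, A)`. -/
theorem decayMap_inv_one :
    decayMap (fun x => ((1 : ℂ) + x)⁻¹) = ⟨fun s => ((s : ℝ) : ℂ), by fun_prop⟩ := by
  ext s
  rw [decayMap_apply (isDecaying_inv Complex.one_mem_slitPlane)]
  split_ifs with h
  · simp [h]
  · simp

/-- Holomorphy in the supremum norm. The second-order Taylor remainder is at most `exp (-r x) (|h|
x)² exp (|h| x)` with `r = Re z`, and for `|h| < r / 2` half of the decay survives to absorb `x²`,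
uniformly in `x ≥ 0`. -/
theorem hasDerivAt_decayMap_exp {z : ℂ} (hz : 0 < z.re) :
    HasDerivAt (fun w : ℂ => decayMap fun x => Complex.exp (-w * x))
      (decayMap fun x => -(x : ℂ) * Complex.exp (-z * x)) z := by
  rw [hasDerivAt_iff_isLittleO_nhds_zero]
  set r := z.re
  have hb : ∀ᶠ h : ℂ in 𝓝 0, ‖(decayMap fun x => Complex.exp (-(z + h) * x))
      - (decayMap fun x => Complex.exp (-z * x))
      - h • (decayMap fun x => -(x : ℂ) * Complex.exp (-z * x))‖
      ≤ 2 * (2 / r) ^ 2 * ‖‖h‖ ^ 2‖ := by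
    have hball : Metric.ball (0 : ℂ) (r / 2) ∈ 𝓝 0 := Metric.ball_mem_nhds _ (by positivity)
    filter_upwards [hball] with h hh
    rw [mem_ball_zero_iff] at hh
    have hre : 0 < (z + h).re := by
      have := (abs_le.1 (Complex.abs_re_le_norm h)).1
      rw [Complex.add_re]
      change 0 < r + h.re
      linarith
    have d1 := isDecaying_exp hre
    have d2 := isDecaying_exp hz
    have d3 := isDecaying_mul_exp hz
    have e : (decayMap fun x => Complex.exp (-(z + h) * x))
        - (decayMap fun x => Complex.exp (-z * x))
        - h • (decayMap fun x => -(x : ℂ) * Complex.exp (-z * x))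
        = decayMap (fun x => (Complex.exp (-(z + h) * x) + (-1) * Complex.exp (-z * x))
          + (-h) * (-(x : ℂ) * Complex.exp (-z * x))) := by
      rw [decayMap_add (d1.add (d2.const_mul _)) (d3.const_mul _), decayMap_add d1
        (d2.const_mul _), decayMap_const_mul _ d2, decayMap_const_mul _ d3]
      module
    rw [e]
    refine norm_decayMap_le (by positivity) fun x hx => ?_
    have e2 : (Complex.exp (-(z + h) * x) + (-1) * Complex.exp (-z * x))
          + (-h) * (-(x : ℂ) * Complex.exp (-z * x))
        = Complex.exp (-z * x) * (Complex.exp (-h * x)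
          - ∑ m ∈ Finset.range 2, (-h * x) ^ m / (m.factorial : ℂ)) := by
      rw [show -(z + h) * (x : ℂ) = -z * x + -h * x by ring, Complex.exp_add]
      simp [Finset.sum_range_succ]
      ring
    rw [e2, norm_mul, norm_exp_neg_mul]
    have h1 := Complex.norm_exp_sub_sum_le_norm_mul_exp (-h * x) 2
    have h2 : ‖-h * (x : ℂ)‖ = ‖h‖ * x := by
      rw [norm_mul, norm_neg, Complex.norm_real, Real.norm_of_nonneg hx]
    rw [h2] at h1
    have h3 : Real.exp (‖h‖ * x) ≤ Real.exp (r / 2 * x) := by gcongr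
    have h4 : Real.exp (-r * x) * Real.exp (r / 2 * x) = Real.exp (-(r / 2 * x)) := by
      rw [← Real.exp_add]
      congr 1
      ring
    have hy : 0 ≤ r / 2 * x := by positivity
    -- This is `y² exp (-y) ≤ 2`, from the quadratic lower bound for the exponential.
    have h5 : (r / 2 * x) ^ 2 * Real.exp (-(r / 2 * x)) ≤ 2 := by
      rw [Real.exp_neg, ← div_eq_mul_inv, div_le_iff₀ (Real.exp_pos _)]
      have := Real.quadratic_le_exp_of_nonneg hy
      nlinarith
    calc Real.exp (-z.re * x) * ‖_‖
        ≤ Real.exp (-r * x) * ((‖h‖ * x) ^ 2 * Real.exp (r / 2 * x)) := by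
          refine mul_le_mul_of_nonneg_left (h1.trans ?_) (Real.exp_pos _).le
          exact mul_le_mul_of_nonneg_left h3 (by positivity)
      _ = ‖h‖ ^ 2 * (2 / r) ^ 2 * ((r / 2 * x) ^ 2 * Real.exp (-(r / 2 * x))) := by
          rw [← h4]
          have : r ≠ 0 := hz.ne'
          field_simp
      _ ≤ ‖h‖ ^ 2 * (2 / r) ^ 2 * 2 := by gcongr
      _ = 2 * (2 / r) ^ 2 * ‖‖h‖ ^ 2‖ := by
          rw [norm_pow, norm_norm]
          ring
  refine (Asymptotics.IsBigO.of_bound _ hb).trans_isLittleO ?_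
  have := (Asymptotics.isLittleO_pow_id (𝕜 := ℝ) (n := 2) one_lt_two).comp_tendsto
    (tendsto_norm_zero (E := ℂ))
  exact this.of_norm_right.congr_left (fun _ => rfl) |>.trans_isBigO
    (Asymptotics.isBigO_refl _ _)

/-- Uniform convergence in the exponential formula. -/
theorem abs_pow_sub_exp_le {n : ℕ} (hn : 2 ≤ n) {h : ℝ} (hh : 0 ≤ h) :
    |((1 + h)⁻¹) ^ n - Real.exp (-h) ^ n| ≤ 2 / (n - 1) := by
  have hn' : (2 : ℝ) ≤ n := by exact_mod_cast hn
  have h1 : 0 < 1 + h := by linarith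
  have hexp : Real.exp (-h) ≤ (1 + h)⁻¹ := by
    rw [Real.exp_neg]
    exact inv_anti₀ h1 (by linarith [Real.add_one_le_exp h])
  have hb0 : 0 ≤ Real.exp (-h) := (Real.exp_pos _).le
  have hdiff : (1 + h)⁻¹ - Real.exp (-h) ≤ h ^ 2 * (1 + h)⁻¹ := by
    have h2 := Real.add_one_le_exp (-h)
    have h3 : 1 - Real.exp (-h) * (1 + h) ≤ h ^ 2 := by nlinarith
    have h4 : (1 + h)⁻¹ - Real.exp (-h) = (1 - Real.exp (-h) * (1 + h)) * (1 + h)⁻¹ := by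
      field_simp
    rw [h4]
    gcongr
  -- The quadratic binomial bound will cancel `n h²` against `(1 + h)ⁿ` and leave `2 / (n - 1)`; the
  -- linear bound is only there to run the induction.
  have hbin : ∀ m : ℕ, (m : ℝ) * (m - 1) / 2 * h ^ 2 ≤ (1 + h) ^ m ∧ 1 + m * h ≤ (1 + h) ^ m := by
    intro m
    induction m with
    | zero => simp
    | succ m ih =>
      obtain ⟨i1, i2⟩ := ih
      have hm : (0 : ℝ) ≤ m := Nat.cast_nonneg m
      rw [pow_succ (1 + h)]
      push_cast
      constructor
      · nlinarith [mul_le_mul_of_nonneg_right i2 hh]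
      · nlinarith [mul_nonneg hm (mul_nonneg hh hh)]
  -- In the factorisation of `aⁿ - bⁿ` with `b ≤ a`, each of the `n` terms is at most `aⁿ⁻¹`.
  have hgeom : ((1 + h)⁻¹) ^ n - Real.exp (-h) ^ n
      ≤ n * ((1 + h)⁻¹) ^ (n - 1) * ((1 + h)⁻¹ - Real.exp (-h)) := by
    rw [← geom_sum₂_mul]
    refine mul_le_mul_of_nonneg_right ?_ (sub_nonneg.2 hexp)
    refine (Finset.sum_le_card_nsmul _ _ (((1 + h)⁻¹) ^ (n - 1)) fun i hi => ?_).trans_eq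
      (by simp)
    rw [Finset.mem_range] at hi
    calc ((1 + h)⁻¹) ^ i * Real.exp (-h) ^ (n - 1 - i)
        ≤ ((1 + h)⁻¹) ^ i * ((1 + h)⁻¹) ^ (n - 1 - i) := by gcongr
      _ = ((1 + h)⁻¹) ^ (n - 1) := by
        rw [← pow_add]
        congr 1
        omega
  rw [abs_of_nonneg (sub_nonneg.2 (pow_le_pow_left₀ hb0 hexp n))]
  calc ((1 + h)⁻¹) ^ n - Real.exp (-h) ^ n
      ≤ n * ((1 + h)⁻¹) ^ (n - 1) * (h ^ 2 * (1 + h)⁻¹) := by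
        refine hgeom.trans ?_
        gcongr
    _ = n * h ^ 2 * ((1 + h) ^ n)⁻¹ := by
        rw [← inv_pow]
        obtain ⟨m, rfl⟩ : ∃ m, n = m + 1 := ⟨n - 1, by omega⟩
        rw [Nat.add_sub_cancel, pow_succ]
        ring
    _ ≤ 2 / (n - 1) := by
        rw [← div_eq_mul_inv, div_le_div_iff₀ (by positivity) (by linarith)]
        have := (hbin n).1
        linarith

theorem norm_decayMap_exp_le {z : ℂ} (hz : 0 ≤ z.re) :
    ‖decayMap fun x => Complex.exp (-z * x)‖ ≤ 1 := by
  refine norm_decayMap_le zero_le_one fun x hx => ?_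
  rw [norm_exp_neg_mul]
  exact Real.exp_le_one_iff.2 (by nlinarith)

theorem decayMap_exp_add {z w : ℂ} (hz : 0 < z.re) (hw : 0 < w.re) :
    decayMap (fun x => Complex.exp (-(z + w) * x))
      = (decayMap fun x => Complex.exp (-z * x)) * decayMap fun x => Complex.exp (-w * x) := by
  rw [← decayMap_mul (isDecaying_exp hz) (isDecaying_exp hw)]
  congr 1
  funext x
  rw [← Complex.exp_add]
  congr 1
  ring

/-- Since `1 - exp (-t x) ≤ t x ≤ t (1 + x)`, the semigroup is norm continuous at zero after
multiplication by `R(1, A)`. This gives strong continuity on the domain. -/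
theorem norm_decayMap_exp_mul_sub_le {t : ℝ} (ht : 0 < t) :
    ‖(decayMap fun x => Complex.exp (-t * x)) * (decayMap fun x => ((1 : ℂ) + x)⁻¹)
      - decayMap fun x => ((1 : ℂ) + x)⁻¹‖ ≤ t := by
  have d1 : IsDecaying fun x => Complex.exp (-(t : ℂ) * x) := isDecaying_exp (by simpa using ht)
  have d2 := isDecaying_inv Complex.one_mem_slitPlane
  have e : (decayMap fun x => Complex.exp (-t * x)) * (decayMap fun x => ((1 : ℂ) + x)⁻¹)
      - (decayMap fun x => ((1 : ℂ) + x)⁻¹)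
      = decayMap fun x => Complex.exp (-t * x) * ((1 : ℂ) + x)⁻¹ + (-1) * ((1 : ℂ) + x)⁻¹ := by
    rw [decayMap_add (d1.mul d2) (d2.const_mul _), decayMap_mul d1 d2, decayMap_const_mul _ d2]
    module
  rw [e]
  refine norm_decayMap_le ht.le fun x hx => ?_
  have e2 : Complex.exp (-t * x) * ((1 : ℂ) + x)⁻¹ + (-1) * ((1 : ℂ) + x)⁻¹
      = (((Real.exp (-(t * x)) - 1) * (1 + x)⁻¹ : ℝ) : ℂ) := by
    push_cast
    rw [neg_mul]
    ring
  rw [e2, Complex.norm_real, Real.norm_eq_abs, abs_mul, abs_of_pos (by positivity : 0 < (1 + x)⁻¹),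
    abs_sub_comm, ← div_eq_mul_inv, div_le_iff₀ (by positivity)]
  have h1 := Real.add_one_le_exp (-(t * x))
  have h2 : Real.exp (-(t * x)) ≤ 1 := Real.exp_le_one_iff.2 (by
    have := mul_nonneg ht.le hx
    linarith)
  rw [abs_of_nonneg (by linarith)]
  nlinarith

/-- The Laplace transform of `exp (-t x)` is `1 / (r + x)`, uniformly in `x ≥ 0`. -/
theorem integral_decayMap_exp {r : ℝ} (hr : 0 < r) :
    Integrable (fun t : ℝ => ((Real.exp (-r * t) : ℝ) : ℂ) •
      decayMap fun x => Complex.exp (-(t : ℂ) * x)) (volume.restrict (Ioi 0)) ∧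
    ∫ t in Ioi (0 : ℝ), ((Real.exp (-r * t) : ℝ) : ℂ) •
      (decayMap fun x => Complex.exp (-(t : ℂ) * x)) = decayMap fun x => ((r : ℂ) + x)⁻¹ := by
  have hpos : ∀ t : ℝ, 0 < t → 0 < ((t : ℝ) : ℂ).re := fun t ht => by simpa using ht
  have hc : ContinuousOn (fun t : ℝ => ((Real.exp (-r * t) : ℝ) : ℂ) •
      decayMap fun x => Complex.exp (-(t : ℂ) * x)) (Ioi 0) := by
    intro t ht
    have h1 := (hasDerivAt_decayMap_exp (hpos t ht)).continuousAt
    have h2 : ContinuousAt (fun s : ℝ => decayMap fun x => Complex.exp (-(s : ℂ) * x)) t :=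
      ContinuousAt.comp (f := fun s : ℝ => (s : ℂ))
        (g := fun w : ℂ => decayMap fun x => Complex.exp (-w * x)) h1
        Complex.continuous_ofReal.continuousAt
    have h3 : ContinuousAt (fun s : ℝ => ((Real.exp (-r * s) : ℝ) : ℂ)) t := by fun_prop
    exact (h3.smul h2).continuousWithinAt
  have hi : Integrable (fun t : ℝ => ((Real.exp (-r * t) : ℝ) : ℂ) •
      decayMap fun x => Complex.exp (-(t : ℂ) * x)) (volume.restrict (Ioi 0)) := by
    refine Integrable.mono' (exp_neg_integrableOn_Ioi 0 hr)
      (hc.aestronglyMeasurable measurableSet_Ioi) ?_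
    filter_upwards [ae_restrict_mem measurableSet_Ioi] with t ht
    rw [norm_smul, Complex.norm_real, Real.norm_of_nonneg (Real.exp_pos _).le]
    exact mul_le_of_le_one_right (Real.exp_pos _).le (norm_decayMap_exp_le (hpos t ht).le)
  refine ⟨hi, ?_⟩
  ext s
  -- Evaluation at `s` commutes with the integral in the space of continuous functions, which
  -- reduces the claim to the scalar Laplace transform.
  rw [ContinuousMap.integral_apply hi, decayMap_apply (isDecaying_inv (by
    simpa [Complex.ofReal_mem_slitPlane] using hr))]
  split_ifs with h0
  · rw [setIntegral_congr_fun (g := fun _ => (0 : ℂ)) measurableSet_Ioi]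
    · simp
    · intro t ht
      simp only [ContinuousMap.smul_apply]
      rw [decayMap_apply (isDecaying_exp (hpos t ht)), if_pos h0, smul_zero]
  · have hs := (one_le_inv₀ (lt_of_le_of_ne s.2.1 (Ne.symm h0))).2 s.2.2
    set x : ℝ := (s : ℝ)⁻¹ - 1
    have hx : 0 ≤ x := by simp only [x]; linarith
    rw [setIntegral_congr_fun (g := fun t : ℝ => ((Real.exp (-(r + x) * t) : ℝ) : ℂ))
      measurableSet_Ioi]
    · have h1 := integral_exp_mul_Ioi (a := -(r + x)) (by linarith) 0
      refine (integral_ofReal (𝕜 := ℂ) (f := fun t => Real.exp (-(r + x) * t))).trans ?_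
      rw [h1, mul_zero, Real.exp_zero, neg_div_neg_eq, one_div]
      push_cast
      rfl
    · intro t ht
      simp only [ContinuousMap.smul_apply]
      rw [decayMap_apply (isDecaying_exp (hpos t ht)), if_neg h0, smul_eq_mul]
      simp only [Complex.ofReal_exp, show (s : ℝ)⁻¹ - 1 = x from rfl]
      rw [← Complex.exp_add]
      congr 1
      push_cast
      ring

/-- Euler's formula for symbols: with `h = t x / n` the difference at `x` is `(1 + h)⁻ⁿ - exp
(-h)ⁿ`. -/
theorem norm_pow_decayMap_inv_sub_le {t : ℝ} (ht : 0 < t) {n : ℕ} (hn : 2 ≤ n) :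
    ‖((((n / t : ℝ) : ℂ)) • decayMap fun x => (((n / t : ℝ) : ℂ) + x)⁻¹) ^ n
      - decayMap fun x => Complex.exp (-(t : ℂ) * x)‖ ≤ 2 / (n - 1) := by
  have hn' : (2 : ℝ) ≤ n := by exact_mod_cast hn
  have hc : 0 < (n / t : ℝ) := by positivity
  have d1 := isDecaying_inv (z := ((n / t : ℝ) : ℂ)) (by
    rw [Complex.ofReal_mem_slitPlane]
    exact hc)
  have d2 : IsDecaying fun x => Complex.exp (-(t : ℂ) * x) := isDecaying_exp (by simpa using ht)
  have hb : 0 ≤ 2 / ((n : ℝ) - 1) := div_nonneg zero_le_two (by linarith)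
  rw [ContinuousMap.norm_le _ hb]
  intro s
  rw [ContinuousMap.sub_apply, ContinuousMap.pow_apply, ContinuousMap.smul_apply,
    decayMap_apply d1, decayMap_apply d2]
  split_ifs with h0
  · rw [smul_zero, zero_pow (by omega), sub_zero, norm_zero]
    exact hb
  · have hs := (one_le_inv₀ (lt_of_le_of_ne s.2.1 (Ne.symm h0))).2 s.2.2
    set x : ℝ := (s : ℝ)⁻¹ - 1
    have hx : 0 ≤ x := by simp only [x]; linarith
    have h := abs_pow_sub_exp_le hn (h := t * x / n) (by positivity)
    refine le_trans (le_of_eq ?_) h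
    rw [← Real.norm_eq_abs, ← Complex.norm_real]
    congr 1
    rw [← Real.exp_nat_mul]
    have e1 : (n / t) * (n / t + x)⁻¹ = (1 + t * x / n)⁻¹ := by
      have : (0 : ℝ) < n := by linarith
      field_simp
    have e2 : (n : ℝ) * -(t * x / n) = -t * x := by
      have : (0 : ℝ) < n := by linarith
      field_simp
    rw [← e1, e2, smul_eq_mul]
    push_cast
    rfl

/-! ### Resolvents -/

section Resolvents

variable {X : Type*} [NormedAddCommGroup X] [NormedSpace ℂ X] {A : X →ₗ.[ℂ] X}

theorem IsResolvent.unique {z : ℂ} {R R' : X →L[ℂ] X} (h : IsResolvent A z R)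
    (h' : IsResolvent A z R') : R = R' := by
  ext y
  obtain ⟨hy, e⟩ := h'.1 y
  have h1 := h.2 ⟨R' y, hy⟩
  rw [e] at h1
  exact h1

/-- The first identity writes `S y` as `R (y - (z - 1) S y)`, which puts it in the domain and makes
`S` a right inverse; the second, with the factors exchanged, makes it a left inverse. -/
theorem IsResolvent.of_resolvent_identity {z : ℂ} {R S : X →L[ℂ] X} (h : IsResolvent A 1 R)
    (h1 : S = R - (z - 1) • (R * S)) (h2 : S = R - (z - 1) • (S * R)) : IsResolvent A z S := by
  have e1 : ∀ y, S y = R (y - (z - 1) • S y) := fun y => by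
    conv_lhs => rw [h1]
    simp
  have e2 : ∀ y, S y + (z - 1) • S (R y) = R y := fun y => by
    conv_lhs => enter [1]; rw [h2]
    simp
  constructor
  · intro y
    obtain ⟨k1, k2⟩ := h.1 (y - (z - 1) • S y)
    have hm : S y ∈ A.domain := by rwa [e1]
    refine ⟨hm, ?_⟩
    have k3 : A ⟨S y, hm⟩ = A ⟨R (y - (z - 1) • S y), k1⟩ := by
      congr 1
      exact Subtype.ext (e1 y)
    rw [k3]
    have k4 : A ⟨R (y - (z - 1) • S y), k1⟩
        = R (y - (z - 1) • S y) - (y - (z - 1) • S y) := by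
      rw [one_smul] at k2
      exact (sub_eq_iff_comm.1 k2).symm
    rw [k4, ← e1]
    module
  · intro x
    have k1 := h.2 x
    set w := (1 : ℂ) • (x : X) - A x with hw
    have k2 : z • (x : X) - A x = (z - 1) • R w + w := by
      rw [k1, hw]
      module
    rw [k2, map_add, map_smul, add_comm, e2, k1]

end Resolvents

/-! ### Resolvents, sectoriality and the semigroup from the functional calculus -/

section Calculus

variable {H : Type*} [NormedAddCommGroup H] [InnerProductSpace ℂ H] [CompleteSpace H]
  {A : H →ₗ.[ℂ] H} {R : H →L[ℂ] H}

/-- The resolvent identity holds for the scalar functions `1 / (1 + x)` and `1 / (z + x)`. The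
calculus transports it to operators, and commutativity of the function algebra gives both orders. -/
theorem isResolvent_calculus {Φ : C(unitInterval, ℂ) →⋆ₐ[ℂ] (H →L[ℂ] H)}
    (hR : IsResolvent A 1 R) (hΦ : Φ (decayMap fun x => ((1 : ℂ) + x)⁻¹) = R) {z : ℂ}
    (hz : z ∈ Complex.slitPlane) : IsResolvent A z (Φ (decayMap fun x => (z + x)⁻¹)) := by
  have d1 := isDecaying_inv Complex.one_mem_slitPlane
  have d2 := isDecaying_inv hz
  have key : decayMap (fun x => (z + x)⁻¹) = decayMap (fun x => ((1 : ℂ) + x)⁻¹)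
      - (z - 1) • (decayMap (fun x => ((1 : ℂ) + x)⁻¹) * decayMap fun x => (z + x)⁻¹) := by
    have e : decayMap (fun x => (z + x)⁻¹) = decayMap fun x => ((1 : ℂ) + x)⁻¹
        + (-(z - 1)) * (((1 : ℂ) + x)⁻¹ * (z + x)⁻¹) := by
      refine decayMap_congr d2 (d1.add ((d1.mul d2).const_mul _)) fun x hx => ?_
      have h1 := add_ne_zero_of_mem_slitPlane hz hx
      have h2 := add_ne_zero_of_mem_slitPlane Complex.one_mem_slitPlane hx
      field_simp
      ring
    rw [decayMap_add d1 ((d1.mul d2).const_mul _), decayMap_const_mul _ (d1.mul d2),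
      decayMap_mul d1 d2] at e
    exact e.trans (by module)
  have k := congrArg Φ key
  refine hR.of_resolvent_identity ?_ ?_
  · rw [map_sub, map_smul, map_mul, hΦ] at k
    exact k
  · rw [mul_comm (decayMap fun x => ((1 : ℂ) + x)⁻¹), map_sub, map_smul, map_mul, hΦ] at k
    exact k

/-- With `γ = |cos ε| < 1` the sector satisfies `Re z ≥ -γ |z|`. Hence `|z + x|² ≥ |z|² - 2 γ x |z|
+ x² ≥ (1 - γ) |z|²`, because `2 x |z| ≤ x² + |z|²`. -/
theorem norm_smul_decayMap_inv_le {z : ℂ} {ε : ℝ} (hε : 0 < ε)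
    (hz : z ∈ sector (Real.pi - ε)) :
    z ∈ Complex.slitPlane ∧
      ‖z • decayMap fun x => (z + x)⁻¹‖ ≤ (√(1 - |Real.cos ε|))⁻¹ := by
  obtain ⟨z0, harg⟩ := hz
  have hslit : z ∈ Complex.slitPlane := by
    rw [Complex.mem_slitPlane_iff_arg]
    refine ⟨fun h => ?_, z0⟩
    rw [h, abs_of_pos Real.pi_pos] at harg
    linarith
  refine ⟨hslit, ?_⟩
  have hε' : ε < Real.pi := by linarith [abs_nonneg z.arg]
  set γ := |Real.cos ε| with hγ
  have hγ1 : γ < 1 := by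
    rw [hγ, abs_lt]
    constructor
    · rw [← Real.cos_pi]
      exact Real.cos_lt_cos_of_nonneg_of_le_pi hε.le le_rfl hε'
    · rw [← Real.cos_zero]
      exact Real.cos_lt_cos_of_nonneg_of_le_pi le_rfl hε'.le hε
  have hre : -(γ * ‖z‖) ≤ z.re := by
    have h1 : Real.cos (Real.pi - ε) ≤ Real.cos |z.arg| :=
      Real.cos_le_cos_of_nonneg_of_le_pi (abs_nonneg _) (by linarith) harg.le
    rw [Real.cos_pi_sub, Real.cos_abs] at h1
    have h2 := Complex.norm_mul_cos_arg z
    rw [← h2]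
    have h3 : Real.cos ε ≤ γ := le_abs_self _
    nlinarith [norm_nonneg z]
  rw [← decayMap_const_mul _ (isDecaying_inv hslit)]
  refine norm_decayMap_le (by positivity) fun x hx => ?_
  have hne := add_ne_zero_of_mem_slitPlane hslit hx
  have hγ0 : 0 < √(1 - γ) := Real.sqrt_pos.2 (by linarith)
  rw [norm_mul, norm_inv, ← div_eq_mul_inv, div_le_iff₀ (norm_pos_iff.2 hne), inv_mul_eq_div,
    le_div_iff₀ hγ0, mul_comm]
  refine (abs_le_of_sq_le_sq' ?_ (norm_nonneg _)).2
  rw [mul_pow, Real.sq_sqrt (by linarith)]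
  have h1 : ‖z + x‖ ^ 2 = ‖z‖ ^ 2 + 2 * x * z.re + x ^ 2 := by
    rw [Complex.sq_norm, Complex.sq_norm, Complex.normSq_apply, Complex.normSq_apply]
    simp
    ring
  rw [h1]
  have h2 : 0 ≤ γ := abs_nonneg _
  nlinarith [mul_le_mul_of_nonneg_left hre hx, mul_nonneg h2 (sq_nonneg (‖z‖ - x)),
    mul_nonneg (sub_nonneg.2 hγ1.le) (sq_nonneg x)]

/-- Nonnegative self-adjoint operators are sectorial of angle `π / 2`. -/
theorem isSectorial_of_calculus {Φ : C(unitInterval, ℂ) →⋆ₐ[ℂ] (H →L[ℂ] H)}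
    (hR : IsResolvent A 1 R) (hΦ : Φ (decayMap fun x => ((1 : ℂ) + x)⁻¹) = R)
    (hn : ∀ f, ‖Φ f‖ ≤ ‖f‖) : IsSectorial A := by
  refine ⟨Real.pi / 2, by positivity, le_rfl, fun z hz => ?_, fun ε hε => ?_⟩
  · have hslit : z ∈ Complex.slitPlane := by
      rw [Complex.mem_slitPlane_iff_arg]
      refine ⟨fun h => ?_, hz.1⟩
      have := hz.2
      rw [h, abs_of_pos Real.pi_pos] at this
      linarith
    exact ⟨_, isResolvent_calculus hR hΦ hslit⟩
  · refine ⟨(√(1 - |Real.cos ε|))⁻¹, fun z hz S hS => ?_⟩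
    rw [add_halves] at hz
    obtain ⟨h1, h2⟩ := norm_smul_decayMap_inv_le hε hz
    rw [hS.unique (isResolvent_calculus hR hΦ h1), ← map_smul]
    exact (hn _).trans h2

/-- The semigroup defined by the functional calculus. -/
theorem exists_semigroup_of_calculus {Φ : C(unitInterval, ℂ) →⋆ₐ[ℂ] (H →L[ℂ] H)}
    (hR : IsResolvent A 1 R) (hΦ : Φ (decayMap fun x => ((1 : ℂ) + x)⁻¹) = R)
    (hn : ∀ f, ‖Φ f‖ ≤ ‖f‖) (hA : Dense (A.domain : Set H)) :
    ∃ S : ℂ → H →L[ℂ] H, DifferentiableOn ℂ S (sector (Real.pi / 2)) ∧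
      (∀ z ∈ sector (Real.pi / 2), ‖S z‖ ≤ 1) ∧
      (∀ t s : ℝ, 0 < t → 0 < s → S ((t + s : ℝ) : ℂ) = S t * S s) ∧
      (∀ y, Tendsto (fun t : ℝ => S t y) (𝓝[>] 0) (𝓝 y)) ∧
      (∀ r : ℝ, 0 < r → ∃ Q : H →L[ℂ] H, IsResolvent A r Q ∧ ∀ y,
        ∫ t in Ioi (0 : ℝ), ((Real.exp (-r * t) : ℝ) : ℂ) • S t y = Q y) ∧
      ∀ t : ℝ, 0 < t → ∃ Q : ℕ → H →L[ℂ] H,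
        (∀ n : ℕ, 2 ≤ n → IsResolvent A ((n / t : ℝ) : ℂ) (Q n)) ∧
        Tendsto (fun n : ℕ => (((n / t : ℝ) : ℂ) • Q n) ^ n) atTop (𝓝 (S t)) := by
  have hsec : ∀ z ∈ sector (Real.pi / 2), 0 < z.re := fun z hz =>
    (Complex.abs_arg_lt_pi_div_two_iff.1 hz.2).resolve_right hz.1
  have hslit : ∀ r : ℝ, 0 < r → (r : ℂ) ∈ Complex.slitPlane := fun r hr => by
    rw [Complex.ofReal_mem_slitPlane]
    exact hr
  have hpos : ∀ t : ℝ, 0 < t → 0 < ((t : ℝ) : ℂ).re := fun t ht => by simpa using ht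
  let Φc : C(unitInterval, ℂ) →L[ℂ] (H →L[ℂ] H) :=
    (Φ : C(unitInterval, ℂ) →ₐ[ℂ] (H →L[ℂ] H)).toLinearMap.mkContinuous 1 fun f => by
      rw [one_mul]
      exact hn f
  have hΦc : ∀ f, Φc f = Φ f := fun f => rfl
  refine ⟨fun z => Φ (decayMap fun x => Complex.exp (-z * x)), ?_, ?_, ?_, ?_, ?_, ?_⟩
  · intro z hz
    have h := (hasDerivAt_decayMap_exp (hsec z hz)).differentiableAt
    exact (Φc.differentiableAt.comp z h).differentiableWithinAt
  · intro z hz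
    exact (hn _).trans (norm_decayMap_exp_le (hsec z hz).le)
  · intro t s ht hs
    rw [← map_mul, ← decayMap_exp_add (hpos t ht) (hpos s hs), Complex.ofReal_add]
  · intro y
    rw [Metric.tendsto_nhds]
    intro ε hε
    -- Approximate `y` by an element `w = R v` of the domain, where convergence is quantitative;
    -- contractivity controls the error uniformly in `t`.
    obtain ⟨w, hw, hyw⟩ := Metric.mem_closure_iff.1 (hA y) (ε / 3) (by positivity)
    obtain ⟨v, hv⟩ : ∃ v, w = R v := ⟨_, (hR.2 ⟨w, hw⟩).symm⟩
    have hsmall : ∀ᶠ t : ℝ in 𝓝[>] 0, t < ε / (3 * (‖v‖ + 1)) :=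
      nhdsWithin_le_nhds (Iio_mem_nhds (by positivity))
    filter_upwards [hsmall, self_mem_nhdsWithin] with t ht ht0
    rw [mem_Ioi] at ht0
    set T := Φ (decayMap fun x => Complex.exp (-(t : ℂ) * x)) with hT
    have hT1 : ‖T‖ ≤ 1 := (hn _).trans (norm_decayMap_exp_le (hpos t ht0).le)
    have hTR : ‖T * R - R‖ ≤ t := by
      rw [← hΦ, hT, ← map_mul, ← map_sub]
      exact (hn _).trans (norm_decayMap_exp_mul_sub_le ht0)
    rw [lt_div_iff₀ (by positivity)] at ht
    have h1 : ‖T (y - w)‖ ≤ ‖y - w‖ := by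
      have := T.le_of_opNorm_le hT1 (y - w)
      rwa [one_mul] at this
    have h2 : ‖T w - w‖ ≤ t * ‖v‖ := by
      have := (T * R - R).le_of_opNorm_le hTR v
      rw [hv]
      exact this
    rw [dist_eq_norm] at hyw ⊢
    have h3 : T y - y = T (y - w) + (T w - w) + (w - y) := by
      rw [map_sub]
      abel
    have h4 : ‖w - y‖ < ε / 3 := by rwa [norm_sub_rev]
    calc ‖T y - y‖ ≤ ‖T (y - w)‖ + ‖T w - w‖ + ‖w - y‖ := by
          rw [h3]
          exact norm_add₃_le
      _ < ε := by nlinarith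
  · intro r hr
    refine ⟨_, isResolvent_calculus hR hΦ (hslit r hr), fun y => ?_⟩
    obtain ⟨hi, e⟩ := integral_decayMap_exp hr
    rw [← e]
    -- The map `f ↦ Φ f y` is bounded and linear, so it passes through the integral of symbols.
    let L : C(unitInterval, ℂ) →L[ℂ] H := (ContinuousLinearMap.apply ℂ H y).comp Φc
    have h := L.integral_comp_comm hi
    have h' : L (∫ t in Ioi (0 : ℝ), ((Real.exp (-r * t) : ℝ) : ℂ) •
      (decayMap fun x => Complex.exp (-(t : ℂ) * x))) = Φ (∫ t in Ioi (0 : ℝ),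
        ((Real.exp (-r * t) : ℝ) : ℂ) • (decayMap fun x => Complex.exp (-(t : ℂ) * x))) y := rfl
    rw [← h', ← h]
    refine integral_congr_ae (Eventually.of_forall fun t => ?_)
    simp only [map_smul]
    rfl
  · intro t ht
    refine ⟨fun n => Φ (decayMap fun x => (((n / t : ℝ) : ℂ) + x)⁻¹), fun n hn2 => ?_, ?_⟩
    · refine isResolvent_calculus hR hΦ (hslit _ ?_)
      have : (0 : ℝ) < n := by
        have : 0 < n := by omega
        exact_mod_cast this
      positivity
    · rw [tendsto_iff_norm_sub_tendsto_zero]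
      have hlim : Tendsto (fun n : ℕ => 2 / ((n : ℝ) - 1)) atTop (𝓝 0) :=
        tendsto_const_nhds.div_atTop
          (tendsto_atTop_add_const_right _ _ tendsto_natCast_atTop_atTop)
      refine squeeze_zero' (Eventually.of_forall fun n => norm_nonneg _) ?_ hlim
      filter_upwards [eventually_ge_atTop 2] with n hn2
      rw [← map_smul, ← map_pow, ← map_sub]
      exact (hn _).trans (norm_pow_decayMap_inv_sub_le ht hn2)

end Calculus

/-! ### Complexification of operators -/

namespace MetricGraph

variable {V E : Type*} (G : MetricGraph V E)

theorem toC_reC_add (f : G.E2C) : G.toC (G.reC f) + Complex.I • G.toC (G.imC f) = f := by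
  ext1 e
  change Complex.ofRealCLM.compLp (Complex.reCLM.compLp (f e))
    + Complex.I • Complex.ofRealCLM.compLp (Complex.imCLM.compLp (f e)) = f e
  apply Lp.ext
  filter_upwards [Lp.coeFn_add (Complex.ofRealCLM.compLp (Complex.reCLM.compLp (f e)))
      (Complex.I • Complex.ofRealCLM.compLp (Complex.imCLM.compLp (f e))),
    Lp.coeFn_smul Complex.I (Complex.ofRealCLM.compLp (Complex.imCLM.compLp (f e))),
    ContinuousLinearMap.coeFn_compLp Complex.ofRealCLM (Complex.reCLM.compLp (f e)),
    ContinuousLinearMap.coeFn_compLp Complex.ofRealCLM (Complex.imCLM.compLp (f e)),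
    ContinuousLinearMap.coeFn_compLp Complex.reCLM (f e),
    ContinuousLinearMap.coeFn_compLp Complex.imCLM (f e)] with x h1 h2 h3 h4 h5 h6
  rw [h1, Pi.add_apply, h2, Pi.smul_apply, h3, h4, h5, h6]
  simp only [Complex.ofRealCLM_apply, Complex.reCLM_apply, Complex.imCLM_apply, smul_eq_mul]
  rw [mul_comm]
  exact Complex.re_add_im _

theorem reC_toC (u : G.E2) : G.reC (G.toC u) = u := by
  ext1 e
  change Complex.reCLM.compLp (Complex.ofRealCLM.compLp (u e)) = u e
  apply Lp.ext
  filter_upwards [ContinuousLinearMap.coeFn_compLp Complex.ofRealCLM (u e),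
    ContinuousLinearMap.coeFn_compLp Complex.reCLM (Complex.ofRealCLM.compLp (u e))] with x h1 h2
  rw [h2, h1]
  simp

theorem imC_toC (u : G.E2) : G.imC (G.toC u) = 0 := by
  ext1 e
  change Complex.imCLM.compLp (Complex.ofRealCLM.compLp (u e)) = 0
  apply Lp.ext
  filter_upwards [ContinuousLinearMap.coeFn_compLp Complex.ofRealCLM (u e),
    ContinuousLinearMap.coeFn_compLp Complex.imCLM (Complex.ofRealCLM.compLp (u e)),
    Lp.coeFn_zero ℝ 2 (edgeMeasure (G.len e))] with x h1 h2 h3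
  rw [h2, h1, h3]
  simp

theorem toC_injective : Function.Injective G.toC := fun u v h => by
  rw [← G.reC_toC u, h, G.reC_toC]

theorem toC_add (u v : G.E2) : G.toC (u + v) = G.toC u + G.toC v := by
  simpa using G.toC_lin u v 1 1

theorem toC_smul (a : ℝ) (u : G.E2) : G.toC (a • u) = (a : ℂ) • G.toC u := by
  simpa using G.toC_lin u u a 0

theorem toC_sub (u v : G.E2) : G.toC (u - v) = G.toC u - G.toC v := by
  have := G.toC_lin u v 1 (-1)
  simpa [sub_eq_add_neg] using this

theorem reC_add (f g : G.E2C) : G.reC (f + g) = G.reC f + G.reC g := by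
  simpa using G.reC_lin f g 1

theorem imC_add (f g : G.E2C) : G.imC (f + g) = G.imC f + G.imC g := by
  simpa using G.imC_lin f g 1

theorem reC_toC_add_I (a b : G.E2) :
    G.reC (G.toC a + Complex.I • G.toC b) = a ∧ G.imC (G.toC a + Complex.I • G.toC b) = b := by
  obtain ⟨h1, h2⟩ := G.reC_imC_smul (G.toC b) Complex.I
  rw [reC_add, imC_add, h1, h2, reC_toC, reC_toC, imC_toC, imC_toC]
  simp

theorem complexify_apply_eq {A : G.E2 →ₗ.[ℝ] G.E2} {f : G.E2C} (hf : f ∈ (G.complexify A).domain)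
    {a b : A.domain} (ha : G.reC f = a) (hb : G.imC f = b) :
    G.complexify A ⟨f, hf⟩ = G.toC (A a) + Complex.I • G.toC (A b) := by
  have e1 : (⟨G.reC f, hf.1⟩ : A.domain) = a := Subtype.ext ha
  have e2 : (⟨G.imC f, hf.2⟩ : A.domain) = b := Subtype.ext hb
  rw [← e1, ← e2]
  rfl

variable [Fintype E]

theorem inner_toC (u v : G.E2) : inner ℂ (G.toC u) (G.toC v) = ((inner ℝ u v : ℝ) : ℂ) := by
  rw [PiLp.inner_apply, PiLp.inner_apply, Complex.ofReal_sum]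
  refine Finset.sum_congr rfl fun e _ => ?_
  rw [Lp_inner_eq, L2.inner_def]
  refine Eq.trans ?_ (integral_ofReal (𝕜 := ℂ) (f := fun x => u e x * v e x))
  apply integral_congr_ae
  filter_upwards [ContinuousLinearMap.coeFn_compLp Complex.ofRealCLM (u e),
    ContinuousLinearMap.coeFn_compLp Complex.ofRealCLM (v e)] with x h1 h2
  change inner ℂ (Complex.ofRealCLM.compLp (u e) x) (Complex.ofRealCLM.compLp (v e) x) = _
  rw [h1, h2]
  simp [mul_comm]

theorem inner_toC_add (a b c d : G.E2) :
    inner ℂ (G.toC a + Complex.I • G.toC b) (G.toC c + Complex.I • G.toC d)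
      = ((inner ℝ a c + inner ℝ b d : ℝ) : ℂ)
        + ((inner ℝ a d - inner ℝ b c : ℝ) : ℂ) * Complex.I := by
  simp only [inner_add_left, inner_add_right, inner_smul_left, inner_smul_right, inner_toC,
    Complex.conj_I]
  push_cast
  linear_combination -((inner ℝ b d : ℝ) : ℂ) * Complex.I_mul_I

theorem norm_toC (u : G.E2) : ‖G.toC u‖ = ‖u‖ := by
  have h := G.inner_toC u u
  rw [inner_self_eq_norm_sq_to_K, real_inner_self_eq_norm_sq] at h
  have h2 : ‖G.toC u‖ ^ 2 = ‖u‖ ^ 2 :=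
    Complex.ofReal_injective ((Complex.ofReal_pow _ _).trans h)
  exact (sq_eq_sq₀ (norm_nonneg _) (norm_nonneg _)).1 h2

theorem norm_sq_eq_reC_add (f : G.E2C) : ‖f‖ ^ 2 = ‖G.reC f‖ ^ 2 + ‖G.imC f‖ ^ 2 := by
  have h := G.inner_toC_add (G.reC f) (G.imC f) (G.reC f) (G.imC f)
  rw [toC_reC_add, inner_self_eq_norm_sq_to_K, real_inner_self_eq_norm_sq,
    real_inner_self_eq_norm_sq, real_inner_comm, sub_self, Complex.ofReal_zero, zero_mul,
    add_zero] at h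
  exact Complex.ofReal_injective ((Complex.ofReal_pow _ _).trans h)

theorem norm_reC_le (f : G.E2C) : ‖G.reC f‖ ≤ ‖f‖ := by
  refine (abs_le_of_sq_le_sq' ?_ (norm_nonneg _)).2
  rw [norm_sq_eq_reC_add]
  linarith [sq_nonneg ‖G.imC f‖]

/-- The embedding of the real space into its complexification. -/
def toCₗᵢ : G.E2 →ₗᵢ[ℝ] G.E2C where
  toFun := G.toC
  map_add' := G.toC_add
  map_smul' a u := by
    rw [toC_smul, RingHom.id_apply]
    exact algebraMap_smul ℂ a (G.toC u)
  norm_map' := G.norm_toC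

theorem isometry_toC : Isometry G.toC := G.toCₗᵢ.isometry

/-- The complexification of a bounded operator. -/
def complexifyCLM (B : G.E2 →L[ℝ] G.E2) : G.E2C →L[ℂ] G.E2C :=
  LinearMap.mkContinuous
    { toFun := fun f => G.toC (B (G.reC f)) + Complex.I • G.toC (B (G.imC f))
      map_add' := fun f g => by
        rw [reC_add, imC_add, map_add, map_add, toC_add, toC_add]
        module
      map_smul' := fun z f => by
        obtain ⟨h1, h2⟩ := G.reC_imC_smul f z
        rw [h1, h2, map_add, map_add, map_smul, map_smul, map_smul, map_smul, toC_lin, toC_lin,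
          RingHom.id_apply]
        have hz : z = (z.re : ℂ) + (z.im : ℂ) * Complex.I := (Complex.re_add_im z).symm
        clear h1 h2
        push_cast
        match_scalars
        · linear_combination -hz
        · linear_combination -Complex.I * hz - (z.im : ℂ) * Complex.I_mul_I } ‖B‖ fun f => by
    refine (abs_le_of_sq_le_sq' ?_ (by positivity)).2
    obtain ⟨h1, h2⟩ := G.reC_toC_add_I (B (G.reC f)) (B (G.imC f))
    change ‖G.toC (B (G.reC f)) + Complex.I • G.toC (B (G.imC f))‖ ^ 2 ≤ _
    rw [norm_sq_eq_reC_add, h1, h2, mul_pow, norm_sq_eq_reC_add, mul_add, ← mul_pow, ← mul_pow]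
    gcongr
    · exact B.le_opNorm _
    · exact B.le_opNorm _

theorem complexifyCLM_apply (B : G.E2 →L[ℝ] G.E2) (f : G.E2C) :
    G.complexifyCLM B f = G.toC (B (G.reC f)) + Complex.I • G.toC (B (G.imC f)) := rfl

theorem complexifyCLM_toC (B : G.E2 →L[ℝ] G.E2) (u : G.E2) :
    G.complexifyCLM B (G.toC u) = G.toC (B u) := by
  have h0 : G.toC 0 = 0 := by simpa using G.toC_smul 0 0
  rw [complexifyCLM_apply, reC_toC, imC_toC, map_zero, h0, smul_zero, add_zero]

theorem norm_complexifyCLM_le (B : G.E2 →L[ℝ] G.E2) : ‖G.complexifyCLM B‖ ≤ ‖B‖ :=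
  LinearMap.mkContinuous_norm_le _ (norm_nonneg _) _

theorem isResolvent_complexifyCLM {A : G.E2 →ₗ.[ℝ] G.E2} {r : ℝ} {B : G.E2 →L[ℝ] G.E2}
    (h : IsResolvent A r B) : IsResolvent (G.complexify A) (r : ℂ) (G.complexifyCLM B) := by
  constructor
  · intro y
    obtain ⟨ha, ea⟩ := h.1 (G.reC y)
    obtain ⟨hb, eb⟩ := h.1 (G.imC y)
    obtain ⟨h1, h2⟩ := G.reC_toC_add_I (B (G.reC y)) (B (G.imC y))
    have hm : G.complexifyCLM B y ∈ (G.complexify A).domain := by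
      constructor
      · rw [complexifyCLM_apply, h1]
        exact ha
      · rw [complexifyCLM_apply, h2]
        exact hb
    refine ⟨hm, ?_⟩
    rw [G.complexify_apply_eq hm (a := ⟨_, ha⟩) (b := ⟨_, hb⟩) h1 h2, complexifyCLM_apply]
    conv_rhs => rw [← G.toC_reC_add y, ← ea, ← eb, toC_sub, toC_sub, toC_smul, toC_smul]
    module
  · rintro ⟨f, hf⟩
    obtain ⟨h1, h2⟩ := G.reC_toC_add_I (r • G.reC f - A ⟨G.reC f, hf.1⟩)
      (r • G.imC f - A ⟨G.imC f, hf.2⟩)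
    have e : (r : ℂ) • f - G.complexify A ⟨f, hf⟩
        = G.toC (r • G.reC f - A ⟨G.reC f, hf.1⟩)
          + Complex.I • G.toC (r • G.imC f - A ⟨G.imC f, hf.2⟩) := by
      rw [G.complexify_apply_eq hf (a := ⟨_, hf.1⟩) (b := ⟨_, hf.2⟩) rfl rfl, toC_sub, toC_sub,
        toC_smul, toC_smul]
      conv_lhs => enter [1]; rw [← G.toC_reC_add f]
      module
    change G.complexifyCLM B ((r : ℂ) • f - G.complexify A ⟨f, hf⟩) = f
    rw [e, complexifyCLM_apply, h1, h2, h.2 ⟨_, hf.1⟩, h.2 ⟨_, hf.2⟩]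
    exact G.toC_reC_add f

theorem dense_complexify_domain {A : G.E2 →ₗ.[ℝ] G.E2} (hA : Dense (A.domain : Set G.E2)) :
    Dense ((G.complexify A).domain : Set G.E2C) := by
  have hc : Continuous fun p : G.E2 × G.E2 => G.toC p.1 + Complex.I • G.toC p.2 := by
    have h1 : Continuous fun p : G.E2 × G.E2 => G.toC p.1 :=
      G.isometry_toC.continuous.comp continuous_fst
    have h2 : Continuous fun p : G.E2 × G.E2 => G.toC p.2 :=
      G.isometry_toC.continuous.comp continuous_snd
    exact h1.add (h2.const_smul Complex.I)
  have hs : Function.Surjective fun p : G.E2 × G.E2 => G.toC p.1 + Complex.I • G.toC p.2 :=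
    fun f => ⟨(G.reC f, G.imC f), G.toC_reC_add f⟩
  refine (hs.denseRange.dense_image hc (hA.prod hA)).mono ?_
  rintro _ ⟨⟨a, b⟩, ⟨ha, hb⟩, rfl⟩
  obtain ⟨h1, h2⟩ := G.reC_toC_add_I a b
  constructor
  · simp only [h1]
    exact ha
  · simp only [h2]
    exact hb

theorem isPositive_complexifyCLM {B : G.E2 →L[ℝ] G.E2}
    (hs : ∀ x y, inner ℝ (B x) y = inner ℝ x (B y)) (hp : ∀ x, 0 ≤ inner ℝ (B x) x) :
    (G.complexifyCLM B).IsPositive := by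
  rw [ContinuousLinearMap.isPositive_def]
  constructor
  · intro f g
    change inner ℂ (G.complexifyCLM B f) g = inner ℂ f (G.complexifyCLM B g)
    conv_lhs => rw [← G.toC_reC_add g]
    conv_rhs => rw [← G.toC_reC_add f]
    rw [complexifyCLM_apply, complexifyCLM_apply, inner_toC_add, inner_toC_add, hs, hs, hs, hs]
  · intro f
    rw [ContinuousLinearMap.reApplyInnerSelf_apply]
    have h : inner ℂ (G.complexifyCLM B f) f = inner ℂ (G.complexifyCLM B f)
      (G.toC (G.reC f) + Complex.I • G.toC (G.imC f)) := by rw [toC_reC_add]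
    rw [h, complexifyCLM_apply, inner_toC_add]
    have h1 := hp (G.reC f)
    have h2 := hp (G.imC f)
    simp
    linarith

/-! ### The semigroup -/

variable {G} {A : G.E2 →ₗ.[ℝ] G.E2}

/-- The inequality `‖B x‖² ≤ ⟨B x, x⟩` for `B = R(1, A)` yields both positivity and `‖B‖ ≤ 1`. -/
theorem exists_calculus_complexify (hA : IsMDissipativeSymmetric A) :
    ∃ (R : G.E2C →L[ℂ] G.E2C) (Φ : C(unitInterval, ℂ) →⋆ₐ[ℂ] (G.E2C →L[ℂ] G.E2C)),
      IsResolvent (G.complexify A) 1 R ∧ Φ (decayMap fun x => ((1 : ℂ) + x)⁻¹) = R ∧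
      ∀ f, ‖Φ f‖ ≤ ‖f‖ := by
  obtain ⟨B, hB⟩ := hA.exists_resolvent one_pos
  have h0 : ∀ x, ‖B x‖ ^ 2 ≤ inner ℝ (B x) x := fun x => by
    simpa using hA.resolvent_inner_self hB x
  have h1 : ‖B‖ ≤ 1 := by
    refine B.opNorm_le_bound zero_le_one fun x => ?_
    rw [one_mul]
    rcases (norm_nonneg (B x)).eq_or_lt with h | h
    · rw [← h]
      exact norm_nonneg _
    · have h2 := (h0 x).trans (real_inner_le_norm _ _)
      rw [sq] at h2
      exact le_of_mul_le_mul_left h2 h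
  obtain ⟨Φ, p1, p2⟩ := exists_unitInterval_calculus
    (G.isPositive_complexifyCLM (hA.resolvent_symm hB) fun x => (sq_nonneg _).trans (h0 x))
    ((G.norm_complexifyCLM_le B).trans h1)
  refine ⟨G.complexifyCLM B, Φ, ?_, ?_, p2⟩
  · have := G.isResolvent_complexifyCLM hB
    rwa [Complex.ofReal_one] at this
  · rw [decayMap_inv_one]
    exact p1

theorem isSectorial_complexify (hA : IsMDissipativeSymmetric A) :
    IsSectorial (G.complexify A) := by
  obtain ⟨R, Φ, h1, h2, h3⟩ := exists_calculus_complexify hA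
  exact isSectorial_of_calculus h1 h2 h3

/-- The complex semigroup is restricted to real functions. The Euler approximants are part of the
conclusion because positivity will be deduced from them. -/
theorem exists_semigroup (hA : IsMDissipativeSymmetric A) :
    ∃ T : ℝ≥0 → G.E2 →L[ℝ] G.E2, IsC0Semigroup T ∧ IsGenerator A T ∧ G.IsBoundedAnalytic T ∧
      IsContractive T ∧ ∀ t : ℝ≥0, 0 < t → ∃ B : ℕ → G.E2 →L[ℝ] G.E2,
        (∀ n : ℕ, 2 ≤ n → IsResolvent A (n / t : ℝ) (B n)) ∧
        ∀ u, Tendsto (fun n : ℕ => (((n / t : ℝ) • B n) ^ n) u) atTop (𝓝 (T t u)) := by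
  obtain ⟨R, Φ, h1, h2, h3⟩ := exists_calculus_complexify hA
  obtain ⟨S, hS1, hS2, hS3, hS4, hS5, hS6⟩ := exists_semigroup_of_calculus h1 h2 h3
    (G.dense_complexify_domain hA.dense_domain)
  have hsec : ∀ t : ℝ, 0 < t → (t : ℂ) ∈ sector (Real.pi / 2) := fun t ht => by
    refine ⟨by exact_mod_cast ht.ne', ?_⟩
    rw [Complex.arg_ofReal_of_nonneg ht.le, abs_zero]
    positivity
  -- the operators are real
  have hreal : ∀ t : ℝ, 0 < t → ∃ B : ℕ → G.E2 →L[ℝ] G.E2,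
      (∀ n : ℕ, 2 ≤ n → IsResolvent A (n / t : ℝ) (B n)) ∧
      ∀ u, G.toC (G.reC (S t (G.toC u))) = S t (G.toC u) ∧
        Tendsto (fun n : ℕ => (((n / t : ℝ) • B n) ^ n) u) atTop
          (𝓝 (G.reC (S t (G.toC u)))) := by
    intro t ht
    obtain ⟨Q, q1, q2⟩ := hS6 t ht
    have hex : ∀ n : ℕ, ∃ B : G.E2 →L[ℝ] G.E2, 2 ≤ n → IsResolvent A (n / t : ℝ) B := by
      intro n
      by_cases hn : 2 ≤ n
      · have : (0 : ℝ) < n := by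
          have : 0 < n := by omega
          exact_mod_cast this
        obtain ⟨B, hB⟩ := hA.exists_resolvent (r := n / t) (by positivity)
        exact ⟨B, fun _ => hB⟩
      · exact ⟨0, fun h => absurd h hn⟩
    choose B hB using hex
    have hpow : ∀ n : ℕ, 2 ≤ n → ∀ (k : ℕ) (u : G.E2),
        ((((n / t : ℝ) : ℂ) • Q n) ^ k) (G.toC u) = G.toC ((((n / t : ℝ) • B n) ^ k) u) := by
      intro n hn k
      -- By uniqueness the complex resolvent is the complexification of the real one, so its powers
      -- preserve real functions.
      have hQ := (q1 n hn).unique (G.isResolvent_complexifyCLM (hB n hn))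
      induction k with
      | zero => simp
      | succ k ih =>
        intro u
        rw [pow_succ, pow_succ, mul_apply_eq_comp, mul_apply_eq_comp,
          ← ih, _root_.smul_apply, _root_.smul_apply, hQ,
          complexifyCLM_toC, toC_smul]
    refine ⟨B, hB, fun u => ?_⟩
    have hlim : Tendsto (fun n : ℕ => G.toC ((((n / t : ℝ) • B n) ^ n) u)) atTop
        (𝓝 (S t (G.toC u))) := by
      have h := ((ContinuousLinearMap.apply ℂ G.E2C (G.toC u)).continuous.tendsto _).comp q2
      refine Tendsto.congr' ?_ h
      filter_upwards [eventually_ge_atTop 2] with n hn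
      exact hpow n hn n u
    -- The real subspace is closed, so it contains the limit of the real approximants.
    have hcl : IsClosed (range G.toC) := G.isometry_toC.isClosedEmbedding.isClosed_range
    obtain ⟨v, hv⟩ := hcl.mem_of_tendsto hlim (Eventually.of_forall fun n => mem_range_self _)
    rw [← hv, G.reC_toC]
    rw [← hv] at hlim
    exact ⟨rfl, G.isometry_toC.isEmbedding.tendsto_nhds_iff.2 hlim⟩
  have hreal' : ∀ t : ℝ, 0 < t → ∀ u, G.toC (G.reC (S t (G.toC u))) = S t (G.toC u) :=
    fun t ht u => ((hreal t ht).choose_spec.2 u).1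
  let T' : ℝ → G.E2 →L[ℝ] G.E2 := fun t => LinearMap.mkContinuous
    { toFun := fun u => G.reC (S t (G.toC u))
      map_add' := fun u v => by rw [toC_add, map_add, reC_add]
      map_smul' := fun a u => by
        rw [toC_smul, map_smul, (G.reC_imC_smul _ _).1]
        simp } ‖S t‖ fun u => by
    refine (G.norm_reC_le _).trans ?_
    rw [← G.norm_toC u]
    exact (S t).le_opNorm _
  have hT' : ∀ t : ℝ, 0 < t → ∀ u, G.toC (T' t u) = S t (G.toC u) := hreal'
  -- The operators `S z` are only controlled on the open sector, so the value at `t = 0` is set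
  -- separately.
  let T : ℝ≥0 → G.E2 →L[ℝ] G.E2 := fun t => if t = 0 then ContinuousLinearMap.id ℝ _ else T' t
  have hT0 : T 0 = ContinuousLinearMap.id ℝ _ := if_pos rfl
  have hT : ∀ t : ℝ≥0, 0 < t → ∀ u, G.toC (T t u) = S (t : ℝ) (G.toC u) := fun t ht u => by
    have : T t = T' t := if_neg ht.ne'
    rw [this]
    exact hT' t (by exact_mod_cast ht) u
  have hcontr : ∀ t, ‖T t‖ ≤ 1 := by
    intro t
    rcases (zero_le (a := t)).eq_or_lt with h | h
    · rw [← h, hT0]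
      exact ContinuousLinearMap.norm_id_le
    · refine (T t).opNorm_le_bound zero_le_one fun u => ?_
      rw [← G.norm_toC (T t u), hT t h, ← G.norm_toC u]
      exact (S _).le_of_opNorm_le (hS2 _ (hsec _ (by exact_mod_cast h))) _
  refine ⟨T, ⟨hT0, fun t s => ?_, fun u => ?_⟩, ⟨1, 0, zero_le_one, le_rfl, fun t => ?_,
    fun r hr => ?_⟩, ⟨Real.pi / 2, by positivity, le_rfl, S, hS1, fun θ hθ hθ' => ⟨1, ?_⟩,
      fun t ht u => (hT t ht u).symm⟩,
    hcontr, fun t ht => ?_⟩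
  · rcases (zero_le (a := t)).eq_or_lt with h | h
    · rw [← h, zero_add, hT0]
      rfl
    rcases (zero_le (a := s)).eq_or_lt with h' | h'
    · rw [← h', add_zero, hT0]
      rfl
    ext1 u
    apply G.toC_injective
    rw [hT _ (add_pos h h'), NNReal.coe_add, hS3 _ _ (by exact_mod_cast h) (by exact_mod_cast h'),
      ContinuousLinearMap.comp_apply, hT t h, hT s h']
    rfl
  · rw [continuous_iff_continuousAt]
    intro t
    rw [G.isometry_toC.isEmbedding.continuousAt_iff]
    rcases (zero_le (a := t)).eq_or_lt with h | h
    · subst h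
      rw [ContinuousAt, Metric.tendsto_nhds]
      intro ε hε
      have h4 := Metric.tendsto_nhds.1 (hS4 (G.toC u)) ε hε
      rw [eventually_nhdsWithin_iff] at h4
      have h5 : Tendsto (fun s : ℝ≥0 => (s : ℝ)) (𝓝 0) (𝓝 0) := by
        simpa using NNReal.continuous_coe.tendsto 0
      filter_upwards [h5.eventually h4] with s hs
      simp only [Function.comp_apply, hT0, ContinuousLinearMap.id_apply]
      rcases (zero_le (a := s)).eq_or_lt with h' | h'
      · rw [← h', hT0, ContinuousLinearMap.id_apply, dist_self]
        exact hε
      · rw [hT s h']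
        exact hs (by exact_mod_cast h')
    · have ht : (0 : ℝ) < t := by exact_mod_cast h
      have hsec_open : sector (Real.pi / 2) ∈ 𝓝 ((t : ℝ) : ℂ) := by
        have : {z : ℂ | 0 < z.re} ∈ 𝓝 ((t : ℝ) : ℂ) :=
          (isOpen_lt continuous_const Complex.continuous_re).mem_nhds (by simpa using ht)
        filter_upwards [this] with z hz
        refine ⟨fun h0 => ?_, Complex.abs_arg_lt_pi_div_two_iff.2 (Or.inl hz)⟩
        simp [h0] at hz
      have hc : ContinuousAt S ((t : ℝ) : ℂ) :=
        ((hS1 _ (hsec _ ht)).differentiableAt hsec_open).continuousAt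
      have hc2 : ContinuousAt (fun s : ℝ≥0 => S ((s : ℝ) : ℂ) (G.toC u)) t := by
        have h6 : ContinuousAt (fun s : ℝ≥0 => S ((s : ℝ) : ℂ)) t :=
          ContinuousAt.comp (f := fun s : ℝ≥0 => ((s : ℝ) : ℂ)) (g := S) hc
            (Complex.continuous_ofReal.comp NNReal.continuous_coe).continuousAt
        exact ((ContinuousLinearMap.apply ℂ G.E2C (G.toC u)).continuous.continuousAt).comp h6
      refine hc2.congr ?_
      filter_upwards [Ioi_mem_nhds h] with s hs
      exact (hT s hs u).symm
  · rw [one_mul, zero_mul, Real.exp_zero]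
    exact hcontr t
  · obtain ⟨B, hB⟩ := hA.exists_resolvent hr
    obtain ⟨Q, hQ, hint⟩ := hS5 r hr
    refine ⟨B, hB, fun u => ?_⟩
    apply G.toC_injective
    have e1 := hint (G.toC u)
    rw [hQ.unique (G.isResolvent_complexifyCLM hB), complexifyCLM_toC] at e1
    rw [← e1]
    have e2 := G.toCₗᵢ.integral_comp_comm (μ := volume.restrict (Ioi (0 : ℝ)))
      (fun t : ℝ => Real.exp (-r * t) • T t.toNNReal u)
    refine Eq.trans ?_ e2
    apply setIntegral_congr_fun measurableSet_Ioi
    intro t ht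
    have ht' : 0 < t.toNNReal := Real.toNNReal_pos.2 ht
    change _ = G.toC _
    simp only
    rw [toC_smul, hT _ ht', Real.coe_toNNReal _ (le_of_lt ht)]
  · intro z hz
    exact hS2 z ⟨hz.1, hz.2.trans hθ'⟩
  · obtain ⟨B, hB, hlim⟩ := hreal t (by exact_mod_cast ht)
    refine ⟨B, hB, fun u => ?_⟩
    have : T t = T' t := if_neg ht.ne'
    rw [this]
    exact (hlim u).2

end MetricGraph

/-! ### Positivity -/

namespace MetricGraph

variable {V E : Type*} [Fintype E] {G : MetricGraph V E}

theorem inner_eq_sum (u v : G.E2) :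
    inner ℝ u v = ∑ e, ∫ x, u e x * v e x ∂(edgeMeasure (G.len e)) := by
  rw [PiLp.inner_apply]
  exact Finset.sum_congr rfl fun e _ => Lp_inner_eq _ _

theorem inner_le_inner {h u w : G.E2} (hh : ∀ e, 0 ≤ h e) (huw : ∀ e, u e ≤ w e) :
    inner ℝ h u ≤ inner ℝ h w := by
  rw [inner_eq_sum, inner_eq_sum]
  refine Finset.sum_le_sum fun e _ => ?_
  refine integral_mono_ae (MemLp.integrable_mul (p := 2) (q := 2) (Lp.memLp _) (Lp.memLp _))
    (MemLp.integrable_mul (p := 2) (q := 2) (Lp.memLp _) (Lp.memLp _)) ?_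
  filter_upwards [(Lp.coeFn_nonneg _).2 (hh e), (Lp.coeFn_le _ _).2 (huw e)] with x h1 h2
  exact mul_le_mul_of_nonneg_left h2 h1

theorem norm_eq_of_ae_abs {u w : G.E2} (h : ∀ e, w e =ᵐ[edgeMeasure (G.len e)] fun x => |u e x|) :
    ‖w‖ ^ 2 = ‖u‖ ^ 2 := by
  rw [G.norm_sq_eq, G.norm_sq_eq]
  refine Finset.sum_congr rfl fun e _ => integral_congr_ae ?_
  filter_upwards [h e] with x hx
  rw [hx, sq_abs]

namespace Coefficients

variable [Fintype V] (K : G.Coefficients)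

/-- Let `u = R h` and `w = |u|`, so that `a(u, v) + r ⟨u, v⟩ = ⟨h, v⟩`. Expanding `a(w - u, w - u) +
r ‖w - u‖²` and using `a(w, w) ≤ a(u, u)` and `‖w‖ = ‖u‖` bounds it by `2 ⟨h, u⟩ - 2 ⟨h, w⟩`, which
is at most zero as `h ≥ 0` and `u ≤ w`. Hence `u = |u|`. -/
theorem resolvent_nonneg {r : ℝ} (hr : 0 < r) {R : G.E2 →L[ℝ] G.E2} (hR : IsResolvent K.A2 r R)
    {h : G.E2} (hh : ∀ e, 0 ≤ h e) : ∀ e, 0 ≤ R h e := by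
  obtain ⟨hu, hres⟩ := hR.1 h
  have huf : R h ∈ K.formDomain := K.opDomain_le hu
  have key : ∀ v ∈ K.formDomain,
      K.formValue (R h) v = inner ℝ h v - r * inner ℝ (R h) v := fun v hv => by
    have hop : K.opValue ⟨R h, hu⟩ = r • R h - h := by
      have e : K.A2 ⟨R h, hu⟩ = K.opValue ⟨R h, hu⟩ := rfl
      rw [← e]
      exact (sub_eq_iff_eq_add.2 (sub_eq_iff_eq_add'.1 hres)).symm
    have h1 := K.formValue_eq_inner ⟨R h, hu⟩ hv
    rw [hop, neg_sub, inner_sub_left, inner_smul_left] at h1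
    exact h1
  obtain ⟨w, hw, habs, hle⟩ := K.exists_abs huf
  have hsub := K.formValue_self_nonneg (w - R h)
  have hexp : K.formValue (w - R h) (w - R h)
      = K.formValue w w - 2 * K.formValue (R h) w + K.formValue (R h) (R h) := by
    let x : K.form.domain := ⟨w, hw⟩
    let y : K.form.domain := ⟨R h, huf⟩
    have e1 : K.form.toBilin (x - y) (x - y) = K.form.toBilin x x - K.form.toBilin x y
        - (K.form.toBilin y x - K.form.toBilin y y) := by
      rw [LinearMap.map_sub₂, map_sub, map_sub]
    have e4 := K.formValue_symm w (R h)
    change K.formValue (w - R h) (w - R h) = K.formValue w w - K.formValue w (R h)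
      - (K.formValue (R h) w - K.formValue (R h) (R h)) at e1
    rw [e1, e4]
    ring
  have hin : inner ℝ h (R h) ≤ inner ℝ h w := inner_le_inner hh fun e => by
    rw [← Lp.coeFn_le]
    filter_upwards [habs e] with x hx
    rw [hx]
    exact le_abs_self _
  have hnorm := norm_eq_of_ae_abs habs
  have hn2 : ‖w - R h‖ ^ 2 = ‖w‖ ^ 2 - 2 * inner ℝ w (R h) + ‖R h‖ ^ 2 := norm_sub_sq_real w (R h)
  have k1 := key w hw
  have k2 := key (R h) huf
  rw [real_inner_self_eq_norm_sq] at k2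
  rw [real_inner_comm] at hn2
  have hz : r * ‖w - R h‖ ^ 2 ≤ 0 := by
    rw [hn2, hnorm]
    linarith
  have hz2 : ‖w - R h‖ ^ 2 ≤ 0 := nonpos_of_mul_nonpos_right hz hr
  have hz3 : w - R h = 0 := by
    rw [← norm_eq_zero]
    exact pow_eq_zero_iff two_ne_zero |>.1 (le_antisymm hz2 (sq_nonneg _))
  rw [← sub_eq_zero.1 hz3]
  intro e
  rw [← Lp.coeFn_nonneg]
  filter_upwards [habs e] with x hx
  rw [hx]
  exact abs_nonneg _

/-- Powers of the positive operators `(n / t) R(n / t, A₂)` are positive, and the cone of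
nonnegative functions is closed. -/
theorem isPositive_of_tendsto {T : ℝ≥0 → G.E2 →L[ℝ] G.E2} (h0 : IsC0Semigroup T)
    (hT : ∀ t : ℝ≥0, 0 < t → ∃ B : ℕ → G.E2 →L[ℝ] G.E2,
        (∀ n : ℕ, 2 ≤ n → IsResolvent K.A2 (n / t : ℝ) (B n)) ∧
        ∀ u, Tendsto (fun n : ℕ => (((n / t : ℝ) • B n) ^ n) u) atTop (𝓝 (T t u))) :
    G.IsPositive T := by
  intro t u hu e
  rcases (zero_le (a := t)).eq_or_lt with h | h
  · rw [← h, h0.map_zero]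
    exact hu e
  obtain ⟨B, hB, hlim⟩ := hT t h
  have ht : (0 : ℝ) < t := by exact_mod_cast h
  have hpow : ∀ n : ℕ, 2 ≤ n → ∀ k : ℕ, ∀ e, 0 ≤ ((((n / t : ℝ) • B n) ^ k) u) e := by
    intro n hn k
    have hn' : (0 : ℝ) < n := by
      have : 0 < n := by omega
      exact_mod_cast this
    have hnt : (0 : ℝ) < n / t := div_pos hn' ht
    induction k with
    | zero => exact hu
    | succ k ih =>
      intro e
      rw [pow_succ']
      have h1 := K.resolvent_nonneg hnt (hB n hn) ih e
      change 0 ≤ (n / t : ℝ) • (B n ((((n / t : ℝ) • B n) ^ k) u) e)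
      rw [← Lp.coeFn_nonneg] at h1 ⊢
      filter_upwards [h1, Lp.coeFn_smul (n / t : ℝ) (B n ((((n / t : ℝ) • B n) ^ k) u) e)]
        with x hx h2
      rw [h2]
      exact mul_nonneg hnt.le hx
  have hl := ((PiLp.continuous_apply 2 _ e).tendsto (T t u)).comp (hlim u)
  refine ge_of_tendsto hl ?_
  filter_upwards [eventually_ge_atTop 2] with n hn
  exact hpow n hn n e

end Coefficients

end MetricGraph

end

/-! ### The form, the operator and the semigroup together -/

theorem mainTheorem8 {V E : Type*} [Fintype V] [Fintype E] (G : MetricGraph V E)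
    (K : G.Coefficients) :
    -- the form and its associated operator
    K.form.IsAssociated (-K.A2) ∧
    K.form.IsSymmetric ∧ K.form.IsDenselyDefined ∧ K.form.IsContinuous ∧ K.form.IsClosed ∧
    K.form.IsAccretive ∧
    -- the operator
    Dense (K.A2.domain : Set G.E2) ∧ IsDissipative K.A2 ∧ IsSectorial (G.complexify K.A2) ∧
    IsSelfAdjoint K.A2 ∧ Set.Ioi (0 : ℝ) ⊆ pmapResolventSet K.A2 ∧
    -- for conductances in `H¹`, in particular in `C¹`, the domain consists of `H²` functions
    ((∀ e, MemH1 (G.len e) (K.c e)) → ∀ u : G.E2, u ∈ K.A2.domain ↔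
      (∀ e, MemH2 (G.len e) (u e)) ∧ G.IsContinuous u ∧ K.M *ᵥ G.L u + K.C u = 0) ∧
    -- the semigroup
    ∃ T : ℝ≥0 → G.E2 →L[ℝ] G.E2, IsC0Semigroup T ∧ IsGenerator K.A2 T ∧
      G.IsBoundedAnalytic T ∧ G.IsPositive T ∧ IsContractive T := by
  have hA : IsMDissipativeSymmetric K.A2 := K.form_isAssociated.isMDissipativeSymmetric
    K.form_isSymmetric K.form_isAccretive K.form_isClosed
  obtain ⟨T, h1, h2, h3, h4, h5⟩ := MetricGraph.exists_semigroup hA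
  exact ⟨K.form_isAssociated, K.form_isSymmetric, K.form_isDenselyDefined,
    PartialForm.isContinuous_of_isSymmetric K.form_isSymmetric K.form_isAccretive,
    K.form_isClosed, K.form_isAccretive, hA.dense_domain, hA.dissipative,
    MetricGraph.isSectorial_complexify hA, hA.isSelfAdjoint, fun r hr => hA.exists_resolvent hr,
    fun hc u => K.inOpDomain_iff_of_memH1 hc u, T, h1, h2, h3, K.isPositive_of_tendsto h1 h5, h4⟩
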